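/- Let $n\ge 1$ and $I_{n|n}=\{\pm1,\dots,\pm n\}$, with $|i|=0$ for $i>0$ and $|i|=1$ for $i<0$. The queer super-Yangian $\mathrm{Y}(\mathfrak q_n)$ is the associative superalgebra over $\mathbb C$ with generators $t_{ij}^{(r)}$ ($i,j\in I_{n|n}$, $r\ge1$) of parity $|i|+|j|$ and with the following relations for $t_{ij}(u)=\delta_{ij}+\sum_{r\ge1}t_{ij}^{(r)}u^{-r}$ and $T(u)=\sum_{i,j} E_{ij}\otimes t_{ij}(u)\in \mathrm{End}(\mathbb C^{n|n})\otimes \mathrm{Y}(\mathfrak q_n)[[u^{-1}]]$: $$t_{ij}(-u)=t_{-i,-j}(u),\qquad R(u,v)T^1(u)T^2(v)=T^2(v)T^1(u)R(u,v),$$ $$R(u,v)=1-\frac{1}{u-v}\sum_{i,j}(-1)^{|j|}E_{ij}\otimes E_{ji}-\frac1{u+v}\sum_{i,j}(-1)^{|j|}E_{ij}\otimes E_{-j,-i}$$ (the second relation being read after multiplication by $u^2-v^2$). All tensor products are tensor products of superalgebras. The matrix $T(u)$ is invertible; let $\widetilde T(u)$ be its inverse. Let $\Lambda=\sum_{i,j}(-1)^{|i||j|}E_{ij}\otimes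 E_{ij}$ and let $\tau(E_{ij})=(-1)^{|i||j|+|i|}E_{ji}$. There is exactly one series $z(u)\in \mathrm{Y}(\mathfrak q_n)[[u^{-1}]]$ with $$(\Lambda\otimes1)\,T^1(u)\,\tau_2\big(\widetilde T^2(u)\big)=\Lambda\otimes z(u);$$ it is called the central series of $\mathrm{Y}(\mathfrak q_n)$. Order the indices as $1,-1,2,-2,\dots,n,-n$ and regard $T(u)$ as an $n\times n$ matrix of $2\times2$ blocks $T_{ab}(u)\in\mathrm{End}(\mathbb C^{1|1})\otimes \mathrm{Y}(\mathfrak q_n)[[u^{-1}]]$. It has a unique factorization $T(u)=F(u)H(u)E(u)$ with $F$ block lower unitriangular, $E$ block upper unitriangular and $H=\mathrm{diag}(H_1,\dots,H_n)$ block diagonal. Each $H_a(u)$ is invertible; let $\widetilde H_a(u)$ be its inverse, let $\partial$ be the formal derivative with respect to $u$, and let $\mathrm{str}(X)=\sum_i(-1)^{|i|}X_{ii}$. **Theorem.** The series $1-\mathrm{str}(H_a(u)\,\partial\widetilde H_a(u))$, $a=1,\dots,n$, commute with each other, and $$z(u)=\prod_{a=1}^n\Big(1-\mathrm{str}\big(H_a(u)\,\partial\widetilde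 H_a(u)\big)\Big).$$ Moreover: 1. For each $a$ there is an algebra homomorphism $\varphi_a:\mathrm{Y}(\mathfrak q_1)\to \mathrm{Y}(\mathfrak q_n)$ that sends the generator matrix of $\mathrm{Y}(\mathfrak q_1)$ to $H_a(u)$. It sends the central series $z^{(1)}(u)$ of $\mathrm{Y}(\mathfrak q_1)$ to $1-\mathrm{str}(H_a(u)\,\partial\widetilde H_a(u))$, so that $z(u)=\prod_{a=1}^n\varphi_a(z^{(1)}(u))$. 2. Let $C_a(u)=h_a(u)\,\widetilde h_a(-u)$ be the quantum Berezinian, where $h_a(u)$ and $\widetilde h_a(u)$ are the $(1,1)$ entries of $H_a(u)$ and $\widetilde H_a(u)$, and define $D_a(u)$ by $C_a(u)-C_a(-u)=4u\,D_a(u)$. Then $1-\mathrm{str}(H_a(u)\,\partial\widetilde H_a(u))=C_a(u)C_a(-u)-D_a(u)D_a(-u)$ for every $a$, and $$z(u)=\prod_{a=1}^n\big(C_a(u)C_a(-u)-D_a(u)D_a(-u)\big).$$ -/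

import Mathlib

namespace QueerYangian

/-! ### Matrices over a superalgebra

Let `V` be a superspace with a homogeneous basis indexed by `ι`, the basis vector `i` having parity
`p i` modulo 2. The array `X` stands for the element `∑ E i j ⊗ X i j` of `End V ⊗ A`. All elements
that occur below are even, which means that `X i j` has parity `p i + p j`; for them the sign rule
`(E i j ⊗ x) (E j l ⊗ y) = (-1) ^ (|x| |E j l|) E i l ⊗ x y` of the tensor product of superalgebras
gives the multiplication defined here. -/

/-- Matrices over `A` with rows and columns indexed by `ι`, where the index `i` has parity `p i`,
multiplied with the sign rule. -/
def SuperMatrix {ι : Type*} (_p : ι → ℕ) (A : Type*) : Type _ := ι → ι → A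

namespace SuperMatrix

variable {ι : Type*} {p : ι → ℕ} {A : Type*}

@[ext] theorem ext {X Y : SuperMatrix p A} (h : ∀ i j, X i j = Y i j) : X = Y :=
  funext fun i => funext fun j => h i j

instance instAddCommGroup [Ring A] : AddCommGroup (SuperMatrix p A) :=
  inferInstanceAs (AddCommGroup (ι → ι → A))

instance instMul [Fintype ι] [Ring A] : Mul (SuperMatrix p A) where
  mul X Y := fun i l => ∑ j, (-1 : A) ^ ((p i + p j) * (p j + p l)) * (X i j * Y j l)

instance instOne [DecidableEq ι] [Ring A] : One (SuperMatrix p A) where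
  one := fun i j => if i = j then 1 else 0

theorem add_apply [Ring A] (X Y : SuperMatrix p A) (i j : ι) :
    (X + Y) i j = X i j + Y i j := rfl

theorem zero_apply [Ring A] (i j : ι) : (0 : SuperMatrix p A) i j = 0 := rfl

theorem one_apply [DecidableEq ι] [Ring A] (i j : ι) :
    (1 : SuperMatrix p A) i j = if i = j then 1 else 0 := rfl

theorem mul_apply [Fintype ι] [Ring A] (X Y : SuperMatrix p A) (i l : ι) :
    (X * Y) i l = ∑ j, (-1 : A) ^ ((p i + p j) * (p j + p l)) * (X i j * Y j l) := rfl

theorem sign_comm [Ring A] (m : ℕ) (x : A) : x * (-1 : A) ^ m = (-1 : A) ^ m * x :=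
  ((Commute.neg_one_right x).pow_right m).eq

theorem sign_cocycle [Ring A] (a b c d : ℕ) :
    (-1 : A) ^ ((a + c) * (c + d)) * (-1 : A) ^ ((a + b) * (b + c)) =
      (-1 : A) ^ ((a + b) * (b + d)) * (-1 : A) ^ ((b + c) * (c + d)) := by
  rw [← pow_add, ← pow_add, neg_one_pow_eq_pow_mod_two, eq_comm, neg_one_pow_eq_pow_mod_two]
  congr 1
  have h : (a + c) * (c + d) + (a + b) * (b + c) + 2 * (b * d) =
      (a + b) * (b + d) + (b + c) * (c + d) + 2 * (a * c) := by ring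
  omega

instance instRing [Fintype ι] [DecidableEq ι] [Ring A] : Ring (SuperMatrix p A) :=
  { instAddCommGroup, instMul, instOne with
    left_distrib := fun X Y Z => by
      ext i l; simp only [mul_apply, add_apply, mul_add, Finset.sum_add_distrib]
    right_distrib := fun X Y Z => by
      ext i l; simp only [mul_apply, add_apply, add_mul, mul_add, Finset.sum_add_distrib]
    zero_mul := fun X => by ext i l; simp [mul_apply, zero_apply]
    mul_zero := fun X => by ext i l; simp [mul_apply, zero_apply]
    one_mul := fun X => by
      ext i l
      rw [mul_apply, Finset.sum_eq_single i]
      · simp [one_apply, ← two_mul, mul_assoc]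
      · intro j _ hj; simp [one_apply, Ne.symm hj]
      · simp
    mul_one := fun X => by
      ext i l
      rw [mul_apply, Finset.sum_eq_single l]
      · simp [one_apply, ← two_mul, mul_left_comm (p i + p l) 2]
      · intro j _ hj; simp [one_apply, hj]
      · simp
    mul_assoc := fun X Y Z => by
      ext i l
      simp only [mul_apply, Finset.sum_mul, Finset.mul_sum]
      rw [Finset.sum_comm]
      refine Finset.sum_congr rfl fun j _ => Finset.sum_congr rfl fun k _ => ?_
      have h1 : X i j * ((-1 : A) ^ ((p j + p k) * (p k + p l)) * (Y j k * Z k l)) =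
          (-1 : A) ^ ((p j + p k) * (p k + p l)) * (X i j * (Y j k * Z k l)) := by
        rw [← mul_assoc, sign_comm, mul_assoc]
      rw [h1, mul_assoc, ← mul_assoc, sign_cocycle, mul_assoc, mul_assoc (X i j)]
    zsmul := fun n X => n • X
    nsmul := fun n X => n • X
    zsmul_zero' := fun X => zero_zsmul X
    zsmul_succ' := fun n X => SubNegMonoid.zsmul_succ' n X
    zsmul_neg' := fun n X => SubNegMonoid.zsmul_neg' n X
    nsmul_zero := fun X => zero_nsmul X
    nsmul_succ := fun n X => succ_nsmul X n }

/-- The supertrace `∑ (-1) ^ |i| X i i`. -/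
def str [Fintype ι] [Ring A] (X : SuperMatrix p A) : A := ∑ i, (-1 : A) ^ p i * X i i

/-- `id` on `A` tensored with the anti-automorphism `τ (E i j) = (-1) ^ (|i| |j| + |i|) E j i`
of `End V`. -/
def tau [Ring A] (X : SuperMatrix p A) : SuperMatrix p A :=
  fun j i => (-1 : A) ^ (p i * p j + p i) * X i j

/-- The parities of the basis `v j ⊗ v l` of `V ⊗ V`. -/
def pairParity (p : ι → ℕ) : ι × ι → ℕ := fun a => p a.1 + p a.2

/-- The element `∑ E i j ⊗ E k l ⊗ c i j k l` of `End V ⊗ End V ⊗ A`, as a matrix for the basis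
`v j ⊗ v l` of `V ⊗ V`; here `(E i j ⊗ E k l) (v j ⊗ v l) = (-1) ^ (|E k l| |j|) v i ⊗ v k`. -/
def ofTensor [Ring A] (p : ι → ℕ) (c : ι → ι → ι → ι → A) : SuperMatrix (pairParity p) A :=
  fun a b => (-1 : A) ^ ((p a.2 + p b.2) * p b.1) * c a.1 b.1 a.2 b.2

/-- `X¹ = ∑ E i j ⊗ 1 ⊗ X i j`. -/
def first [DecidableEq ι] [Ring A] (X : SuperMatrix p A) : SuperMatrix (pairParity p) A :=
  ofTensor p fun i j k l => if k = l then X i j else 0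

/-- `X² = ∑ 1 ⊗ E k l ⊗ X k l`. -/
def second [DecidableEq ι] [Ring A] (X : SuperMatrix p A) : SuperMatrix (pairParity p) A :=
  ofTensor p fun i j k l => if i = j then X k l else 0

/-- `Λ ⊗ z`, where `Λ = ∑ (-1) ^ (|i| |j|) E i j ⊗ E i j`. -/
def lambdaTensor [DecidableEq ι] [Ring A] (p : ι → ℕ) (z : A) : SuperMatrix (pairParity p) A :=
  ofTensor p fun i j k l => if k = i ∧ l = j then (-1 : A) ^ (p i * p j) * z else 0

end SuperMatrix

/-! ### Formal series in `u⁻¹`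

A power series in the variable `X = u⁻¹`. -/

section Series

variable {A : Type*} [Ring A]

/-- `f (-u)`. -/
noncomputable def negVar (f : PowerSeries A) : PowerSeries A :=
  PowerSeries.mk fun r => (-1 : A) ^ r * PowerSeries.coeff r f

/-- The derivative with respect to `u`, which sends `u ^ (-r)` to `-r u ^ (-r - 1)`. -/
noncomputable def derivU (f : PowerSeries A) : PowerSeries A :=
  PowerSeries.mk fun r => match r with
    | 0 => 0
    | s + 1 => -((s : A) * PowerSeries.coeff s f)

/-- The series `f`, in the variable number `k` out of the two variables `u⁻¹` (number `0`) and
`v⁻¹` (number `1`). -/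
noncomputable def inVar (k : Fin 2) (f : PowerSeries A) : MvPowerSeries (Fin 2) A :=
  fun m => if m = Finsupp.single k (m k) then PowerSeries.coeff (m k) f else 0

end Series

/-! ### The queer super-Yangian -/

/-- The index set `{±1, …, ±n}`: the pair `(a, false)` is the positive index number `a`, and
`(a, true)` is its negative. -/
abbrev Idx (n : ℕ) : Type := Fin n × Bool

/-- The index `-i`. -/
def Idx.neg {n : ℕ} (i : Idx n) : Idx n := (i.1, !i.2)

/-- The parity of an index of `{±1}`: positive indices are even, negative ones are odd. -/
def signParity (s : Bool) : ℕ := s.toNat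

/-- The parity of an index of `{±1, …, ±n}`. -/
def parity (n : ℕ) (i : Idx n) : ℕ := signParity i.2

/-- The `R`-matrix multiplied by `v⁻² - u⁻² = u⁻² v⁻² (u² - v²)`, which clears the denominators of
`R (u, v) = 1 - P / (u - v) - Q / (u + v)`, where `P = ∑ (-1) ^ |j| E i j ⊗ E j i` and
`Q = ∑ (-1) ^ |j| E i j ⊗ E (-j) (-i)`. -/
noncomputable def clearedR (n : ℕ) (A : Type*) [Ring A] :
    SuperMatrix (SuperMatrix.pairParity (parity n)) (MvPowerSeries (Fin 2) A) :=
  let x : MvPowerSeries (Fin 2) A := MvPowerSeries.X 0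
  let y : MvPowerSeries (Fin 2) A := MvPowerSeries.X 1
  SuperMatrix.ofTensor (parity n) fun i j k l =>
    (if i = j ∧ k = l then y ^ 2 - x ^ 2 else 0)
      - (if k = j ∧ l = i then (-1) ^ parity n j * (x * y * (x + y)) else 0)
      - (if k = j.neg ∧ l = i.neg then (-1) ^ parity n j * (x * y * (y - x)) else 0)

/-- The generator `(i, j, r)` stands for `t i j ^ (r + 1)`. -/
abbrev Gen (n : ℕ) : Type := Idx n × Idx n × ℕ

/-- The generating series `t i j (u)` in the free algebra. -/
noncomputable def freeSeries (n : ℕ) (i j : Idx n) : PowerSeries (FreeAlgebra ℂ (Gen n)) :=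
  PowerSeries.mk fun r => match r with
    | 0 => if i = j then 1 else 0
    | s + 1 => FreeAlgebra.ι ℂ (i, j, s)

/-- The matrix `T` in the free algebra, in the variable number `k`. -/
noncomputable def freeMatrix (n : ℕ) (k : Fin 2) :
    SuperMatrix (parity n) (MvPowerSeries (Fin 2) (FreeAlgebra ℂ (Gen n))) :=
  fun i j => inVar k (freeSeries n i j)

/-- The left hand side `R (u, v) T¹ (u) T² (v)`, with denominators cleared. -/
noncomputable def rttLeft (n : ℕ) :
    SuperMatrix (SuperMatrix.pairParity (parity n))
      (MvPowerSeries (Fin 2) (FreeAlgebra ℂ (Gen n))) :=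
  clearedR n (FreeAlgebra ℂ (Gen n)) * (freeMatrix n 0).first * (freeMatrix n 1).second

/-- The right hand side `T² (v) T¹ (u) R (u, v)`, with denominators cleared. -/
noncomputable def rttRight (n : ℕ) :
    SuperMatrix (SuperMatrix.pairParity (parity n))
      (MvPowerSeries (Fin 2) (FreeAlgebra ℂ (Gen n))) :=
  (freeMatrix n 1).second * (freeMatrix n 0).first * clearedR n (FreeAlgebra ℂ (Gen n))

/-- The defining relations `t i j (-u) = t (-i) (-j) (u)` and
`R (u, v) T¹ (u) T² (v) = T² (v) T¹ (u) R (u, v)`, coefficient by coefficient. -/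
inductive Rel (n : ℕ) : FreeAlgebra ℂ (Gen n) → FreeAlgebra ℂ (Gen n) → Prop
  | symm (i j : Idx n) (r : ℕ) :
      Rel n (PowerSeries.coeff r (negVar (freeSeries n i j)))
        (PowerSeries.coeff r (freeSeries n i.neg j.neg))
  | rtt (a b : Idx n × Idx n) (m : Fin 2 →₀ ℕ) :
      Rel n (MvPowerSeries.coeff m (rttLeft n a b)) (MvPowerSeries.coeff m (rttRight n a b))

/-- The queer super-Yangian `Y(q_n)`, as an associative algebra. -/
def Yangian (n : ℕ) : Type := RingQuot (Rel n)

noncomputable instance instRingYangian (n : ℕ) : Ring (Yangian n) :=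
  inferInstanceAs (Ring (RingQuot (Rel n)))

noncomputable instance instAlgebraYangian (n : ℕ) : Algebra ℂ (Yangian n) :=
  inferInstanceAs (Algebra ℂ (RingQuot (Rel n)))

/-- The projection of the free algebra onto `Y(q_n)`. -/
noncomputable def toYangian (n : ℕ) : FreeAlgebra ℂ (Gen n) →ₐ[ℂ] Yangian n :=
  RingQuot.mkAlgHom ℂ (Rel n)

/-- The generating series `t i j (u)` of `Y(q_n)`. -/
noncomputable def genSeries (n : ℕ) (i j : Idx n) : PowerSeries (Yangian n) :=
  PowerSeries.map (toYangian n : FreeAlgebra ℂ (Gen n) →+* Yangian n) (freeSeries n i j)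

/-- The generator matrix `T (u)`. -/
noncomputable def genMatrix (n : ℕ) : SuperMatrix (parity n) (PowerSeries (Yangian n)) :=
  fun i j => genSeries n i j

/-- `z` is the central series: `(Λ ⊗ 1) T¹ (u) τ₂ (T̃² (u)) = Λ ⊗ z (u)`, where `T̃ = T⁻¹`. -/
def IsCentralSeries (n : ℕ) (z : PowerSeries (Yangian n)) : Prop :=
  SuperMatrix.lambdaTensor (parity n) (1 : PowerSeries (Yangian n)) * (genMatrix n).first *
      (SuperMatrix.tau (Ring.inverse (genMatrix n))).second =
    SuperMatrix.lambdaTensor (parity n) z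

/-! ### The block Gauss decomposition -/

/-- The `2 × 2` matrices over `Y(q_n)[[u⁻¹]]`, with rows and columns indexed by `1` (`false`) and
`-1` (`true`). -/
abbrev Block (n : ℕ) : Type := SuperMatrix signParity (PowerSeries (Yangian n))

/-- `T (u)` as an `n × n` matrix of `2 × 2` blocks. -/
noncomputable def blockGenMatrix (n : ℕ) : Matrix (Fin n) (Fin n) (Block n) :=
  Matrix.of fun a b s t => genSeries n (a, s) (b, t)

/-- A factorization `T = F H E` with `F` lower unitriangular, `H` diagonal and `E` upper
unitriangular, as block matrices. -/
structure GaussDecomposition (n : ℕ) where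
  F : Matrix (Fin n) (Fin n) (Block n)
  H : Fin n → Block n
  E : Matrix (Fin n) (Fin n) (Block n)
  F_upper : ∀ a b, a < b → F a b = 0
  F_diag : ∀ a, F a a = 1
  E_lower : ∀ a b, b < a → E a b = 0
  E_diag : ∀ a, E a a = 1
  factorization : blockGenMatrix n = F * Matrix.diagonal H * E

/-- `1 - str (H ∂H̃)`, where `H̃ = H⁻¹`. -/
noncomputable def centralFactor {n : ℕ} (H : Block n) : PowerSeries (Yangian n) :=
  1 - SuperMatrix.str (H * (show Block n from fun s t => derivU (Ring.inverse H s t)))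

/-- The quantum Berezinian `C (u) = h (u) h̃ (-u)`, where `h` and `h̃` are the `(1, 1)` entries of
`H` and of `H⁻¹`. -/
noncomputable def berezinian {n : ℕ} (H : Block n) : PowerSeries (Yangian n) :=
  H false false * negVar (Ring.inverse H false false)

/-- The series `D` with `C (u) - C (-u) = 4 u D (u)`, where `C` is the quantum Berezinian. -/
noncomputable def berezinianD {n : ℕ} (H : Block n) : PowerSeries (Yangian n) :=
  (1 / 4 : ℂ) • (PowerSeries.X * (berezinian H - negVar (berezinian H)))

end QueerYangian

/-!
The theorem is proved for every matrix `T` of power series over a `ℂ`-algebra that satisfies the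
defining relations (`IsRTT`), with rows and columns indexed by a finite set with parities and an odd
involution. To such a matrix belongs the series `traceSeries T = 1 - str (T ∂T̃)`, `T̃ = T⁻¹`.

*The central series.* The defining relations give `T¹ R T̃² = T̃² R T¹`. Setting `v = u` after clearing
denominators turns the pole of `R (u, v)` at `u = v` into a derivative, and a contraction of indices
yields `∑ t c j t̃ k c = δ k j traceSeries T` (`IsRTT.tmul_inverse`). The left hand sides are the
entries of `(Λ ⊗ 1) T¹ τ₂ (T̃²)` up to sign, so `z = traceSeries T` for the generator matrix
(`isCentralSeries_iff`).

*Multiplicativity.* Solutions are stable under passing to submatrices closed under the involution,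
because the `R`-matrix only exchanges indices `i`, `k` and replaces them by `-k`, `-i`; inverses of
solutions satisfy the relations with the tensor legs reversed, and these are stable as well. Hence
for a decomposition of `T` into four blocks the upper left block `T₁₁` and its Schur complement, which
is the inverse of a block of `T̃`, are solutions again. Summing the commutation relations of `T₁₁`
with all of `T` against `T₁₁⁻¹` (`corner_trace`) expresses the columns of `T` to the right of `T₁₁` by
`traceSeries T₁₁` times the Schur complement, up to terms that do not contribute to
`∑ t c j t̃ k c`. Therefore `traceSeries` of `T` is the product of those of `T₁₁` and of its Schur
complement (`traceSeries_eq_mul`). Moreover the entries of `T₁₁` supercommute with the entries of the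
opposite block of `T̃`, so the two factors commute (`superCommute_schur`). Since a block Gauss
decomposition is an iterated Schur complement, induction on `n` gives the product formula, the
commutativity and the fact that each `H a` is a `2 × 2` solution (`IsGauss.diagonal_blocks`). The
homomorphisms from `Y(q_1)` then come from the universal property (`IsRTT.exists_hom`).

*The quantum Berezinian.* For a `2 × 2` solution with entries `t` the relations between `T` and `T̃`
in the same variable form a linear system. It implies that the series `t₋₁,₁ t̃₋₁,₁ - D`, where `D` is
defined by the quantum Berezinian, satisfies an equation in which its lowest coefficient equals its
own negative, so it vanishes (`IsRTT.berezinian_odd`). Inserting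
`D (u) = t₋₁,₁ t̃₋₁,₁` and `D (-u) = t₁,₋₁ t̃₁,₋₁` into `C (u) C (-u) - D (u) D (-u)` gives
`traceSeries T` (`IsRTT.traceSeries_eq_berezinian`).
-/

namespace QueerYangian

namespace SuperMatrix

/-! ### Rectangular supermatrices -/

section Entries

variable {ι A : Type*} {p : ι → ℕ}

/-- The supermatrix with prescribed entries. -/
def of (p : ι → ℕ) (f : ι → ι → A) : SuperMatrix p A := f

theorem of_apply (f : ι → ι → A) (i j : ι) : of p f i j = f i j := rfl

end Entries

section Rectangular

variable {ι κ μ η A : Type*} [Ring A]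

theorem sign_congr {m n : ℕ} (h : m % 2 = n % 2) : (-1 : A) ^ m = (-1 : A) ^ n := by
  rw [neg_one_pow_eq_pow_mod_two, h, ← neg_one_pow_eq_pow_mod_two]

theorem sign_mul_sign_mul_sign (a b c : ℕ) (x y : A) :
    (-1 : A) ^ a * ((-1) ^ b * x * ((-1) ^ c * y)) = (-1) ^ (a + b + c) * (x * y) := by
  rw [mul_assoc ((-1 : A) ^ b), ← mul_assoc x, sign_comm, mul_assoc, ← mul_assoc, ← mul_assoc,
    ← pow_add, ← pow_add]

/-- The sign rule product of rectangular arrays, with rows and columns of parities `p`, `q`, `r`. -/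
def rmul [Fintype κ] (p : ι → ℕ) (q : κ → ℕ) (r : μ → ℕ) (X : ι → κ → A) (Y : κ → μ → A) :
    ι → μ → A :=
  fun i l => ∑ j, (-1 : A) ^ ((p i + q j) * (q j + r l)) * (X i j * Y j l)

variable {p : ι → ℕ} {q : κ → ℕ} {r : μ → ℕ} {s : η → ℕ}

theorem rmul_assoc [Fintype κ] [Fintype μ] (X : ι → κ → A) (Y : κ → μ → A) (Z : μ → η → A) :
    rmul p r s (rmul p q r X Y) Z = rmul p q s X (rmul q r s Y Z) := by
  ext i l
  simp only [rmul, Finset.sum_mul, Finset.mul_sum]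
  rw [Finset.sum_comm]
  refine Finset.sum_congr rfl fun j _ => Finset.sum_congr rfl fun k _ => ?_
  have h1 : X i j * ((-1 : A) ^ ((q j + r k) * (r k + s l)) * (Y j k * Z k l)) =
      (-1 : A) ^ ((q j + r k) * (r k + s l)) * (X i j * (Y j k * Z k l)) := by
    rw [← mul_assoc, sign_comm, mul_assoc]
  rw [h1, mul_assoc, ← mul_assoc, sign_cocycle, mul_assoc, mul_assoc (X i j)]

theorem rmul_add [Fintype κ] (X : ι → κ → A) (Y Y' : κ → μ → A) :
    rmul p q r X (Y + Y') = rmul p q r X Y + rmul p q r X Y' := by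
  ext i l
  simp only [rmul, Pi.add_apply, mul_add, Finset.sum_add_distrib]

theorem sub_rmul [Fintype κ] (X X' : ι → κ → A) (Y : κ → μ → A) :
    rmul p q r (X - X') Y = rmul p q r X Y - rmul p q r X' Y := by
  ext i l
  simp only [rmul, Pi.sub_apply, sub_mul, mul_sub, Finset.sum_sub_distrib]

theorem rmul_neg [Fintype κ] (X : ι → κ → A) (Y : κ → μ → A) :
    rmul p q r X (-Y) = -rmul p q r X Y := by
  ext i l
  simp only [rmul, Pi.neg_apply, mul_neg, Finset.sum_neg_distrib]

theorem one_rmul [Fintype ι] [DecidableEq ι] (Y : ι → μ → A) :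
    rmul p p r (1 : SuperMatrix p A) Y = Y := by
  ext i l
  unfold rmul
  rw [Finset.sum_eq_single i]
  · simp [one_apply, ← two_mul, mul_assoc]
  · intro j _ hj; simp [one_apply, Ne.symm hj]
  · simp

theorem rmul_one [Fintype κ] [DecidableEq κ] (X : ι → κ → A) :
    rmul p q q X (1 : SuperMatrix q A) = X := by
  ext i l
  unfold rmul
  rw [Finset.sum_eq_single l]
  · simp [one_apply, ← two_mul, mul_left_comm (p i + q l) 2]
  · intro j _ hj; simp [one_apply, hj]
  · simp

end Rectangular

/-! ### Functoriality and invertibility of supermatrices -/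

section Map

variable {ι : Type*} {p : ι → ℕ} {A B : Type*} [Ring A] [Ring B]

theorem sub_apply (X Y : SuperMatrix p A) (i j : ι) : (X - Y) i j = X i j - Y i j := rfl

theorem sum_apply {α : Type*} (s : Finset α) (f : α → SuperMatrix p A) (i j : ι) :
    (∑ a ∈ s, f a) i j = ∑ a ∈ s, f a i j :=
  map_sum (⟨⟨fun X : SuperMatrix p A => X i j, rfl⟩, fun _ _ => rfl⟩ : SuperMatrix p A →+ A) f s

variable [Fintype ι] [DecidableEq ι]

/-- The entrywise action of a ring homomorphism. -/
def map (f : A →+* B) : SuperMatrix p A →+* SuperMatrix p B where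
  toFun X := of p fun i j => f (X i j)
  map_one' := by ext i j; simp only [one_apply, of_apply]; split_ifs <;> simp
  map_mul' X Y := by
    ext i j
    simp only [mul_apply, of_apply, map_sum, map_mul, map_pow, map_neg, map_one]
  map_zero' := by ext i j; simp only [zero_apply, of_apply, map_zero]
  map_add' X Y := by ext i j; simp only [add_apply, of_apply, map_add]

theorem map_apply (f : A →+* B) (X : SuperMatrix p A) (i j : ι) : map f X i j = f (X i j) := rfl

theorem coeff_sign_mul (r k : ℕ) (f : PowerSeries A) :
    PowerSeries.coeff r ((-1 : PowerSeries A) ^ k * f) = (-1 : A) ^ k * PowerSeries.coeff r f := by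
  have h : (-1 : PowerSeries A) ^ k = PowerSeries.C ((-1 : A) ^ k) := by simp
  rw [h, PowerSeries.coeff_C_mul]

/-- A matrix of power series, as a power series with matrix coefficients. -/
noncomputable def toSeries : SuperMatrix p (PowerSeries A) ≃+* PowerSeries (SuperMatrix p A) where
  toFun X := PowerSeries.mk fun r => of p fun i j => PowerSeries.coeff r (X i j)
  invFun F := of p fun i j => PowerSeries.mk fun r => PowerSeries.coeff r F i j
  left_inv X := by ext i j r; simp [of_apply]
  right_inv F := by ext r i j; simp [of_apply]
  map_mul' X Y := by
    ext r i j
    rw [PowerSeries.coeff_mul, sum_apply]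
    simp only [PowerSeries.coeff_mk, of_apply, mul_apply, map_sum, coeff_sign_mul]
    simp only [PowerSeries.coeff_mul, Finset.mul_sum]
    exact Finset.sum_comm
  map_add' X Y := by
    ext r i j
    simp [add_apply, of_apply]

/-- Via `toSeries`, such a `T` is a power series with matrix coefficients and constant term `1`. -/
theorem isUnit_of_constantCoeff {T : SuperMatrix p (PowerSeries A)}
    (h : map PowerSeries.constantCoeff T = 1) : IsUnit T := by
  have h0 : PowerSeries.constantCoeff (toSeries T) =
      ((1 : (SuperMatrix p A)ˣ) : SuperMatrix p A) := by
    rw [← PowerSeries.coeff_zero_eq_constantCoeff_apply]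
    ext i j
    have := congrFun (congrFun h i) j
    simpa [toSeries, of_apply, map_apply] using this
  have hu : IsUnit (toSeries T) :=
    ⟨⟨_, _, PowerSeries.mul_invOfUnit _ _ h0, PowerSeries.invOfUnit_mul _ _ h0⟩, rfl⟩
  simpa using hu.map (toSeries (p := p) (A := A)).symm

theorem inverse_eq_of_mul_eq_one {R : Type*} [Ring R] {x y : R} (h : x * y = 1) (h' : y * x = 1) :
    Ring.inverse x = y :=
  Ring.inverse_unit ⟨x, y, h, h'⟩

theorem map_inverse {R S : Type*} [Ring R] [Ring S] (f : R →+* S) {x : R} (h : IsUnit x) :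
    Ring.inverse (f x) = f (Ring.inverse x) :=
  inverse_eq_of_mul_eq_one (by rw [← map_mul, Ring.mul_inverse_cancel _ h, map_one])
    (by rw [← map_mul, Ring.inverse_mul_cancel _ h, map_one])

end Map

/-! ### The tensor legs of `End V ⊗ End V` -/

section Tensor

variable {ι : Type*} {p : ι → ℕ} {A : Type*} [Ring A] [DecidableEq ι]

theorem first_apply (X : SuperMatrix p A) (i k j l : ι) :
    first X (i, k) (j, l) = if k = l then X i j else 0 := by
  simp only [first, ofTensor]
  split_ifs with h
  · subst h; rw [sign_congr (n := 0)]; · simp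
    rw [← two_mul, mul_assoc]; simp
  · simp

theorem second_apply (X : SuperMatrix p A) (i k j l : ι) :
    second X (i, k) (j, l) = if i = j then (-1 : A) ^ ((p k + p l) * p j) * X k l else 0 := by
  simp only [second, ofTensor]
  split_ifs <;> simp

theorem first_one : first (1 : SuperMatrix p A) = 1 := by
  ext ⟨i, k⟩ ⟨j, l⟩
  rw [first_apply]
  simp only [one_apply, Prod.mk.injEq]
  split_ifs <;> simp_all

theorem second_one : second (1 : SuperMatrix p A) = 1 := by
  ext ⟨i, k⟩ ⟨j, l⟩
  rw [second_apply]
  simp only [one_apply, Prod.mk.injEq]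
  by_cases h : i = j <;> by_cases h' : k = l <;> simp [h, h', ← two_mul, mul_assoc]

variable [Fintype ι]

theorem first_mul_apply (X : SuperMatrix p A) (M : SuperMatrix (pairParity p) A) (i k : ι)
    (b : ι × ι) : (first X * M) (i, k) b =
      ∑ m, (-1 : A) ^ ((p i + p m) * (p m + p k + (p b.1 + p b.2))) * (X i m * M (m, k) b) := by
  rw [mul_apply, Fintype.sum_prod_type]
  refine Finset.sum_congr rfl fun m _ => ?_
  rw [Finset.sum_eq_single k]
  · rw [first_apply, if_pos rfl]
    congr 1
    apply sign_congr
    simp only [pairParity]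
    have : (p i + p k + (p m + p k)) * (p m + p k + (p b.1 + p b.2)) =
      (p i + p m) * (p m + p k + (p b.1 + p b.2)) + 2 * (p k * (p m + p k + (p b.1 + p b.2))) := by
      ring
    omega
  · intro c _ hc; rw [first_apply, if_neg (Ne.symm hc)]; simp
  · simp

theorem mul_first_apply (X : SuperMatrix p A) (M : SuperMatrix (pairParity p) A) (a : ι × ι)
    (j l : ι) : (M * first X) a (j, l) =
      ∑ m, (-1 : A) ^ ((p a.1 + p a.2 + (p m + p l)) * (p m + p j)) * (M a (m, l) * X m j) := by
  rw [mul_apply, Fintype.sum_prod_type]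
  refine Finset.sum_congr rfl fun m _ => ?_
  rw [Finset.sum_eq_single l]
  · rw [first_apply, if_pos rfl]
    congr 1
    apply sign_congr
    simp only [pairParity]
    have : (p a.1 + p a.2 + (p m + p l)) * (p m + p l + (p j + p l)) =
      (p a.1 + p a.2 + (p m + p l)) * (p m + p j) + 2 * (p l * (p a.1 + p a.2 + (p m + p l))) := by
      ring
    omega
  · intro c _ hc; rw [first_apply, if_neg hc]; simp
  · simp

theorem first_mul_second_apply (X Y : SuperMatrix p A) (i k j l : ι) :
    (first X * second Y) (i, k) (j, l) = (-1 : A) ^ (p i * (p k + p l)) * (X i j * Y k l) := by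
  rw [first_mul_apply, Finset.sum_eq_single j]
  · rw [second_apply, if_pos rfl, ← mul_assoc (X i j), sign_comm, mul_assoc, ← mul_assoc,
      ← pow_add]
    congr 1
    apply sign_congr
    have : (p i + p j) * (p j + p k + (p j + p l)) + (p k + p l) * p j =
      p i * (p k + p l) + 2 * (p j * (p i + p j + p k + p l)) := by ring
    simp only [this]
    omega
  · intro c _ hc; rw [second_apply, if_neg hc]; simp
  · simp

theorem second_mul_first_apply (X Y : SuperMatrix p A) (i k j l : ι) :
    (second Y * first X) (i, k) (j, l) = (-1 : A) ^ (p j * (p k + p l)) * (Y k l * X i j) := by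
  rw [mul_first_apply, Finset.sum_eq_single i]
  · rw [second_apply, if_pos rfl, mul_assoc, ← mul_assoc, ← pow_add]
    congr 1
    apply sign_congr
    have : (p i + p k + (p i + p l)) * (p i + p j) + (p k + p l) * p i =
      p j * (p k + p l) + 2 * (p i * (p i + p j + p k + p l)) := by ring
    simp only [this]
    omega
  · intro c _ hc; rw [second_apply, if_neg (Ne.symm hc)]; simp
  · simp

theorem first_mul (X Y : SuperMatrix p A) : first (X * Y) = first X * first Y := by
  ext ⟨i, k⟩ ⟨j, l⟩
  rw [first_mul_apply, first_apply, mul_apply]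
  simp only [first_apply]
  split_ifs with h
  · subst h
    refine Finset.sum_congr rfl fun m _ => ?_
    congr 1
    apply sign_congr
    have : (p i + p m) * (p m + p k + (p j + p k)) =
      (p i + p m) * (p m + p j) + 2 * (p k * (p i + p m)) := by ring
    simp only [this]
    omega
  · simp

theorem second_mul (X Y : SuperMatrix p A) : second (X * Y) = second X * second Y := by
  ext ⟨i, k⟩ ⟨j, l⟩
  rw [second_apply, mul_apply, mul_apply, Fintype.sum_prod_type,
    Finset.sum_eq_single (f := fun c => ∑ m, _ * (second X (i, k) (c, m) * _)) i]
  · simp only [second_apply, if_true, pairParity]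
    split_ifs with h
    · subst h
      rw [Finset.mul_sum]
      refine Finset.sum_congr rfl fun m _ => ?_
      rw [sign_mul_sign_mul_sign, ← mul_assoc, ← pow_add]
      congr 1
      apply sign_congr
      have : (p i + p k + (p i + p m)) * (p i + p m + (p i + p l)) + (p k + p m) * p i +
          (p m + p l) * p i = (p k + p l) * p i + (p k + p m) * (p m + p l) +
          2 * (p i * (2 * p i + p k + 3 * p m + p l)) := by ring
      omega
    · simp
  · intro c _ hc
    refine Finset.sum_eq_zero fun m _ => ?_
    rw [second_apply, if_neg (Ne.symm hc)]; simp
  · simp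

end Tensor

end SuperMatrix

open SuperMatrix

/-! ### Series in two variables -/

section TwoVariables

variable {A : Type*} [Ring A]

/-- The exponent of the monomial `u⁻ᵃ v⁻ᵇ`. -/
noncomputable def biIndex (a b : ℕ) : Fin 2 →₀ ℕ := Finsupp.single 0 a + Finsupp.single 1 b

@[simp] theorem biIndex_zero (a b : ℕ) : biIndex a b 0 = a := by simp [biIndex]

@[simp] theorem biIndex_one (a b : ℕ) : biIndex a b 1 = b := by simp [biIndex]

theorem eq_biIndex (m : Fin 2 →₀ ℕ) : m = biIndex (m 0) (m 1) := by
  ext i; fin_cases i <;> simp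

theorem biIndex_ext {f g : MvPowerSeries (Fin 2) A}
    (h : ∀ a b, MvPowerSeries.coeff (biIndex a b) f = MvPowerSeries.coeff (biIndex a b) g) :
    f = g := by
  ext m
  rw [eq_biIndex m]
  exact h _ _

theorem coeff_biIndex_mul (a b : ℕ) (f g : MvPowerSeries (Fin 2) A) :
    MvPowerSeries.coeff (biIndex a b) (f * g) =
      ∑ p ∈ Finset.HasAntidiagonal.antidiagonal a, ∑ q ∈ Finset.HasAntidiagonal.antidiagonal b,
        MvPowerSeries.coeff (biIndex p.1 q.1) f * MvPowerSeries.coeff (biIndex p.2 q.2) g := by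
  rw [MvPowerSeries.coeff_mul, ← Finset.sum_product']
  refine Finset.sum_nbij' (fun m => ((m.1 0, m.2 0), (m.1 1, m.2 1)))
    (fun c => (biIndex c.1.1 c.2.1, biIndex c.1.2 c.2.2)) ?_ ?_ ?_ ?_ ?_
  · rintro ⟨m, m'⟩ h
    rw [Finset.HasAntidiagonal.mem_antidiagonal] at h
    simp only at h
    have h0 := DFunLike.congr_fun h 0
    have h1 := DFunLike.congr_fun h 1
    rw [biIndex_zero] at h0
    rw [biIndex_one] at h1
    simp only [Finset.mem_product, Finset.HasAntidiagonal.mem_antidiagonal]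
    exact ⟨h0, h1⟩
  · rintro ⟨⟨p, p'⟩, ⟨q, q'⟩⟩ h
    simp only [Finset.mem_product, Finset.HasAntidiagonal.mem_antidiagonal] at h ⊢
    ext i; fin_cases i <;> simp [h.1, h.2]
  · rintro ⟨m, m'⟩ _
    simp only [← eq_biIndex]
  · rintro ⟨⟨p, p'⟩, ⟨q, q'⟩⟩ _
    simp
  · rintro ⟨m, m'⟩ _
    simp only [← eq_biIndex]

theorem coeff_inVar_zero (f : PowerSeries A) (a b : ℕ) :
    MvPowerSeries.coeff (biIndex a b) (inVar 0 f) = if b = 0 then PowerSeries.coeff a f else 0 := by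
  change (if biIndex a b = Finsupp.single 0 (biIndex a b 0) then _ else _) = _
  rw [biIndex_zero]
  congr 1
  simp [biIndex]

theorem coeff_inVar_one (f : PowerSeries A) (a b : ℕ) :
    MvPowerSeries.coeff (biIndex a b) (inVar 1 f) = if a = 0 then PowerSeries.coeff b f else 0 := by
  change (if biIndex a b = Finsupp.single 1 (biIndex a b 1) then _ else _) = _
  rw [biIndex_one]
  congr 1
  simp [biIndex]

theorem inVar_add (k : Fin 2) (f g : PowerSeries A) : inVar k (f + g) = inVar k f + inVar k g := by
  refine biIndex_ext fun a b => ?_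
  fin_cases k
  · change MvPowerSeries.coeff _ (inVar 0 _) = MvPowerSeries.coeff _ (inVar 0 _ + inVar 0 _)
    rw [map_add]; simp only [coeff_inVar_zero, map_add]; split_ifs <;> simp
  · change MvPowerSeries.coeff _ (inVar 1 _) = MvPowerSeries.coeff _ (inVar 1 _ + inVar 1 _)
    rw [map_add]; simp only [coeff_inVar_one, map_add]; split_ifs <;> simp

theorem sum_antidiagonal_fst_eq_zero {M : Type*} [AddCommMonoid M] (b : ℕ) (f : ℕ × ℕ → M)
    (h : ∀ p, p.1 ≠ 0 → f p = 0) : ∑ p ∈ Finset.HasAntidiagonal.antidiagonal b, f p = f (0, b) := by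
  cases b with
  | zero => simp
  | succ b =>
    rw [Finset.Nat.sum_antidiagonal_succ, Finset.sum_eq_zero, add_zero]
    intro p _; exact h _ (Nat.succ_ne_zero _)

theorem sum_antidiagonal_snd_eq_zero {M : Type*} [AddCommMonoid M] (b : ℕ) (f : ℕ × ℕ → M)
    (h : ∀ p, p.2 ≠ 0 → f p = 0) : ∑ p ∈ Finset.HasAntidiagonal.antidiagonal b, f p = f (b, 0) := by
  rw [← Finset.Nat.sum_antidiagonal_swap]
  exact sum_antidiagonal_fst_eq_zero b (fun p => f p.swap) fun p hp => h _ hp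

theorem inVar_mul (k : Fin 2) (f g : PowerSeries A) : inVar k (f * g) = inVar k f * inVar k g := by
  refine biIndex_ext fun a b => ?_
  fin_cases k
  · change MvPowerSeries.coeff _ (inVar 0 _) = MvPowerSeries.coeff _ (inVar 0 _ * inVar 0 _)
    rw [coeff_biIndex_mul, coeff_inVar_zero]
    simp only [coeff_inVar_zero]
    split_ifs with h
    · subst h; simp [PowerSeries.coeff_mul]
    · refine (Finset.sum_eq_zero fun p _ => Finset.sum_eq_zero fun q hq => ?_).symm
      rw [Finset.HasAntidiagonal.mem_antidiagonal] at hq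
      by_cases h1 : q.1 = 0
      · rw [if_neg (c := q.2 = 0) (by omega), mul_zero]
      · rw [if_neg h1, zero_mul]
  · change MvPowerSeries.coeff _ (inVar 1 _) = MvPowerSeries.coeff _ (inVar 1 _ * inVar 1 _)
    rw [coeff_biIndex_mul, coeff_inVar_one]
    simp only [coeff_inVar_one]
    split_ifs with h
    · subst h; simp [PowerSeries.coeff_mul]
    · refine (Finset.sum_eq_zero fun p hp => Finset.sum_eq_zero fun q _ => ?_).symm
      rw [Finset.HasAntidiagonal.mem_antidiagonal] at hp
      dsimp only
      by_cases h1 : p.1 = 0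
      · rw [if_neg (c := p.2 = 0) (by omega), mul_zero]
      · rw [if_neg h1, zero_mul]

theorem inVar_one (k : Fin 2) : inVar k (1 : PowerSeries A) = 1 := by
  refine biIndex_ext fun a b => ?_
  have h : biIndex a b = 0 ↔ a = 0 ∧ b = 0 := by
    constructor
    · intro h
      have h0 := DFunLike.congr_fun h 0
      have h1 := DFunLike.congr_fun h 1
      rw [biIndex_zero] at h0
      rw [biIndex_one] at h1
      exact ⟨h0, h1⟩
    · rintro ⟨rfl, rfl⟩; simp [biIndex]
  rw [MvPowerSeries.coeff_one]
  simp only [h]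
  fin_cases k
  · change MvPowerSeries.coeff _ (inVar 0 _) = _
    rw [coeff_inVar_zero, PowerSeries.coeff_one]; split_ifs <;> simp_all
  · change MvPowerSeries.coeff _ (inVar 1 _) = _
    rw [coeff_inVar_one, PowerSeries.coeff_one]; split_ifs <;> simp_all

/-- `inVar` as a ring homomorphism. -/
noncomputable def inVarHom (k : Fin 2) : PowerSeries A →+* MvPowerSeries (Fin 2) A where
  toFun := inVar k
  map_one' := inVar_one k
  map_mul' := inVar_mul k
  map_zero' := by simpa using inVar_add k (0 : PowerSeries A) 0
  map_add' := inVar_add k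

theorem coeff_inVar_zero_mul_inVar_one (f g : PowerSeries A) (a b : ℕ) :
    MvPowerSeries.coeff (biIndex a b) (inVarHom 0 f * inVarHom 1 g) =
      PowerSeries.coeff a f * PowerSeries.coeff b g := by
  change MvPowerSeries.coeff (biIndex a b) (inVar 0 f * inVar 1 g) = _
  rw [coeff_biIndex_mul, sum_antidiagonal_snd_eq_zero, sum_antidiagonal_fst_eq_zero]
  · simp [coeff_inVar_zero, coeff_inVar_one]
  · intro p hp; simp [coeff_inVar_zero, hp]
  · intro p hp
    refine Finset.sum_eq_zero fun q _ => ?_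
    simp [coeff_inVar_one, hp]

theorem coeff_inVar_one_mul_inVar_zero (f g : PowerSeries A) (a b : ℕ) :
    MvPowerSeries.coeff (biIndex a b) (inVarHom 1 g * inVarHom 0 f) =
      PowerSeries.coeff b g * PowerSeries.coeff a f := by
  change MvPowerSeries.coeff (biIndex a b) (inVar 1 g * inVar 0 f) = _
  rw [coeff_biIndex_mul, sum_antidiagonal_fst_eq_zero, sum_antidiagonal_snd_eq_zero]
  · simp [coeff_inVar_zero, coeff_inVar_one]
  · intro p hp; simp [coeff_inVar_zero, hp]
  · intro p hp
    refine Finset.sum_eq_zero fun q _ => ?_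
    simp [coeff_inVar_one, hp]

theorem coeff_X_zero_mul (a b : ℕ) (f : MvPowerSeries (Fin 2) A) :
    MvPowerSeries.coeff (biIndex (a + 1) b) (MvPowerSeries.X 0 * f) =
      MvPowerSeries.coeff (biIndex a b) f := by
  have : biIndex (a + 1) b = Finsupp.single 0 1 + biIndex a b := by
    ext i; fin_cases i <;> simp [biIndex, add_comm]
  rw [this, MvPowerSeries.X, MvPowerSeries.coeff_add_monomial_mul, one_mul]

theorem coeff_X_one_mul (a b : ℕ) (f : MvPowerSeries (Fin 2) A) :
    MvPowerSeries.coeff (biIndex a (b + 1)) (MvPowerSeries.X 1 * f) =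
      MvPowerSeries.coeff (biIndex a b) f := by
  have : biIndex a (b + 1) = Finsupp.single 1 1 + biIndex a b := by
    ext i; fin_cases i <;> simp [biIndex, add_comm]
  rw [this, MvPowerSeries.X, MvPowerSeries.coeff_add_monomial_mul, one_mul]

theorem coeff_X_zero_mul_zero (b : ℕ) (f : MvPowerSeries (Fin 2) A) :
    MvPowerSeries.coeff (biIndex 0 b) (MvPowerSeries.X 0 * f) = 0 := by
  rw [MvPowerSeries.X, MvPowerSeries.coeff_monomial_mul, if_neg]
  intro h
  have := h 0
  simp at this

theorem coeff_X_one_mul_zero (a : ℕ) (f : MvPowerSeries (Fin 2) A) :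
    MvPowerSeries.coeff (biIndex a 0) (MvPowerSeries.X 1 * f) = 0 := by
  rw [MvPowerSeries.X, MvPowerSeries.coeff_monomial_mul, if_neg]
  intro h
  have := h 1
  simp at this

/-- The denominator `v⁻² - u⁻²` of the `R`-matrix is not a zero divisor. -/
theorem eq_zero_of_denominator_mul {f : MvPowerSeries (Fin 2) A}
    (h : (MvPowerSeries.X 1 ^ 2 - MvPowerSeries.X 0 ^ 2) * f = 0) : f = 0 := by
  have h' : MvPowerSeries.X 1 * (MvPowerSeries.X 1 * f) =
      MvPowerSeries.X 0 * (MvPowerSeries.X 0 * f) := by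
    rw [sub_mul, sub_eq_zero, pow_two, pow_two, mul_assoc, mul_assoc] at h
    exact h
  have key : ∀ a b, MvPowerSeries.coeff (biIndex a b) f = 0 := by
    intro a
    induction a using Nat.strong_induction_on with
    | _ a ih =>
      intro b
      have hc := congrArg (MvPowerSeries.coeff (biIndex a (b + 1 + 1))) h'
      rw [coeff_X_one_mul, coeff_X_one_mul] at hc
      rw [hc]
      match a with
      | 0 => exact coeff_X_zero_mul_zero _ _
      | 1 => rw [coeff_X_zero_mul, coeff_X_zero_mul_zero]
      | a + 2 => rw [coeff_X_zero_mul, coeff_X_zero_mul]; exact ih a (by omega) _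
  exact biIndex_ext fun a b => by rw [key, map_zero]

/-- The specialization `v = u`. -/
noncomputable def diag : MvPowerSeries (Fin 2) A →+ PowerSeries A where
  toFun f := PowerSeries.mk fun r => ∑ p ∈ Finset.HasAntidiagonal.antidiagonal r,
    MvPowerSeries.coeff (biIndex p.1 p.2) f
  map_zero' := by ext r; simp
  map_add' f g := by ext r; simp [Finset.sum_add_distrib]

/-- The specialization `v = u` of `v⁻¹ ∂f / ∂v⁻¹`. -/
noncomputable def diagEuler : MvPowerSeries (Fin 2) A →+ PowerSeries A where
  toFun f := PowerSeries.mk fun r => ∑ p ∈ Finset.HasAntidiagonal.antidiagonal r,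
    (p.2 : A) * MvPowerSeries.coeff (biIndex p.1 p.2) f
  map_zero' := by ext r; simp
  map_add' f g := by ext r; simp [mul_add, Finset.sum_add_distrib]

/-- The Euler operator `f ↦ u⁻¹ df / du⁻¹`. -/
noncomputable def euler (f : PowerSeries A) : PowerSeries A :=
  PowerSeries.mk fun r => (r : A) * PowerSeries.coeff r f

theorem coeff_diag (r : ℕ) (f : MvPowerSeries (Fin 2) A) : PowerSeries.coeff r (diag f) =
    ∑ p ∈ Finset.HasAntidiagonal.antidiagonal r, MvPowerSeries.coeff (biIndex p.1 p.2) f := by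
  simp [diag]

theorem coeff_diagEuler (r : ℕ) (f : MvPowerSeries (Fin 2) A) :
    PowerSeries.coeff r (diagEuler f) =
      ∑ p ∈ Finset.HasAntidiagonal.antidiagonal r,
        (p.2 : A) * MvPowerSeries.coeff (biIndex p.1 p.2) f := by
  simp [diagEuler]

theorem coeff_euler (r : ℕ) (f : PowerSeries A) :
    PowerSeries.coeff r (euler f) = (r : A) * PowerSeries.coeff r f :=
  PowerSeries.coeff_mk _ _

theorem diag_X_zero_mul (f : MvPowerSeries (Fin 2) A) :
    diag (MvPowerSeries.X 0 * f) = PowerSeries.X * diag f := by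
  ext r
  cases r with
  | zero => simp [coeff_diag, coeff_X_zero_mul_zero]
  | succ r =>
    rw [PowerSeries.coeff_succ_X_mul, coeff_diag, coeff_diag, Finset.Nat.sum_antidiagonal_succ,
      coeff_X_zero_mul_zero, zero_add]
    simp only [coeff_X_zero_mul]

theorem diag_X_one_mul (f : MvPowerSeries (Fin 2) A) :
    diag (MvPowerSeries.X 1 * f) = PowerSeries.X * diag f := by
  ext r
  cases r with
  | zero => simp [coeff_diag, coeff_X_one_mul_zero]
  | succ r =>
    rw [PowerSeries.coeff_succ_X_mul, coeff_diag, coeff_diag, Finset.Nat.sum_antidiagonal_succ',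
      coeff_X_one_mul_zero, zero_add]
    simp only [coeff_X_one_mul]

theorem diagEuler_X_zero_mul (f : MvPowerSeries (Fin 2) A) :
    diagEuler (MvPowerSeries.X 0 * f) = PowerSeries.X * diagEuler f := by
  ext r
  cases r with
  | zero => simp [coeff_diagEuler]
  | succ r =>
    rw [PowerSeries.coeff_succ_X_mul, coeff_diagEuler, coeff_diagEuler,
      Finset.Nat.sum_antidiagonal_succ, coeff_X_zero_mul_zero, mul_zero, zero_add]
    simp only [coeff_X_zero_mul]

theorem diagEuler_X_one_mul (f : MvPowerSeries (Fin 2) A) :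
    diagEuler (MvPowerSeries.X 1 * f) = PowerSeries.X * (diagEuler f + diag f) := by
  ext r
  cases r with
  | zero => simp [coeff_diagEuler]
  | succ r =>
    rw [PowerSeries.coeff_succ_X_mul, coeff_diagEuler, map_add, coeff_diagEuler, coeff_diag,
      Finset.Nat.sum_antidiagonal_succ', ← Finset.sum_add_distrib]
    simp only [coeff_X_one_mul, coeff_X_one_mul_zero]
    simp [add_mul]

theorem diag_zero_mul_one (f g : PowerSeries A) : diag (inVarHom 0 f * inVarHom 1 g) = f * g := by
  ext r
  simp only [coeff_diag, coeff_inVar_zero_mul_inVar_one, PowerSeries.coeff_mul]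

theorem diag_one_mul_zero (f g : PowerSeries A) : diag (inVarHom 1 g * inVarHom 0 f) = g * f := by
  ext r
  simp only [coeff_diag, coeff_inVar_one_mul_inVar_zero, PowerSeries.coeff_mul]
  rw [← Finset.Nat.sum_antidiagonal_swap]; rfl

theorem diagEuler_zero_mul_one (f g : PowerSeries A) :
    diagEuler (inVarHom 0 f * inVarHom 1 g) = f * euler g := by
  ext r
  simp only [coeff_diagEuler, coeff_inVar_zero_mul_inVar_one, PowerSeries.coeff_mul, coeff_euler]
  refine Finset.sum_congr rfl fun p _ => ?_
  rw [← mul_assoc, ← mul_assoc, (Nat.cast_commute _ _).eq]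

theorem diagEuler_one_mul_zero (f g : PowerSeries A) :
    diagEuler (inVarHom 1 g * inVarHom 0 f) = euler g * f := by
  ext r
  simp only [coeff_diagEuler, coeff_inVar_one_mul_inVar_zero, PowerSeries.coeff_mul, coeff_euler]
  rw [← Finset.Nat.sum_antidiagonal_swap]
  refine Finset.sum_congr rfl fun p _ => ?_
  rw [← mul_assoc]; rfl

theorem X_mul_cancel {f g : PowerSeries A} (h : PowerSeries.X * f = PowerSeries.X * g) : f = g := by
  ext r
  simpa using congrArg (PowerSeries.coeff (r + 1)) h

theorem derivU_eq (f : PowerSeries A) : derivU f = -(PowerSeries.X * euler f) := by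
  ext r
  cases r with
  | zero => simp [derivU]
  | succ r => rw [map_neg, PowerSeries.coeff_succ_X_mul, coeff_euler]; simp [derivU]

/-- An identity with the denominators of the `R`-matrix, in the limit `v → u`: the numerator of the
pole `1 / (u - v)` contributes its derivative, and the one of `1 / (u + v)` its value. -/
theorem two_mul_diag {F G K : MvPowerSeries (Fin 2) A}
    (h : (MvPowerSeries.X 1 ^ 2 - MvPowerSeries.X 0 ^ 2) * F =
      MvPowerSeries.X 0 * MvPowerSeries.X 1 * (MvPowerSeries.X 0 + MvPowerSeries.X 1) * G +
      MvPowerSeries.X 0 * MvPowerSeries.X 1 * (MvPowerSeries.X 1 - MvPowerSeries.X 0) * K)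
    (hG : diag G = 0) :
    2 * diag F = 2 * (PowerSeries.X * diagEuler G) + PowerSeries.X * diag K := by
  have h' := congrArg diagEuler h
  simp only [sub_mul, mul_sub, add_mul, mul_add, pow_two, mul_assoc, map_add, map_sub,
    diagEuler_X_zero_mul, diagEuler_X_one_mul, diag_X_zero_mul, diag_X_one_mul, hG, mul_zero,
    add_zero] at h'
  -- `diagEuler` kills one factor `v⁻¹` of the difference `v⁻² - u⁻²`; two common factors `u⁻¹` of
  -- both sides remain.
  apply X_mul_cancel
  apply X_mul_cancel
  simp only [two_mul, mul_add]
  have e : ∀ a b c d e : PowerSeries A, a + b + b - a = c + c + (d + e + e - (d + e)) →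
    b + b = c + c + e := by
    intro a b c d e h
    have : a + b + b - a = b + b := by abel
    rw [this] at h; rw [h]; abel
  refine e (PowerSeries.X * (PowerSeries.X * diagEuler F)) _ _
    (PowerSeries.X * (PowerSeries.X * (PowerSeries.X * diagEuler K))) _ ?_
  rw [← sub_eq_zero] at h' ⊢
  rw [← h']

end TwoVariables

/-! ### Odd involutions of the index set -/

/-- The index set of a basis of `V` with parities `p` in `{0, 1}`, and an odd involution `ν`. -/
structure IsOddInvolution {ι : Type*} (p : ι → ℕ) (ν : ι → ι) : Prop where
  invol : ∀ i, ν (ν i) = i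
  add_eq_one : ∀ i, p i + p (ν i) = 1

namespace IsOddInvolution

variable {ι : Type*} {p : ι → ℕ} {ν : ι → ι}

theorem parity_eq (h : IsOddInvolution p ν) (i : ι) : (p i = 0 ∧ p (ν i) = 1) ∨
    (p i = 1 ∧ p (ν i) = 0) := by
  have := h.add_eq_one i
  omega

theorem eq_iff (h : IsOddInvolution p ν) (i j : ι) : i = ν j ↔ j = ν i :=
  ⟨fun e => by rw [e, h.invol], fun e => by rw [e, h.invol]⟩

theorem ne (h : IsOddInvolution p ν) (i : ι) : ν i ≠ i := by
  intro e
  have := h.add_eq_one i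
  rw [e] at this
  omega

theorem sum_comp [Fintype ι] (h : IsOddInvolution p ν) {M : Type*} [AddCommMonoid M] (f : ι → M) :
    ∑ i, f (ν i) = ∑ i, f i :=
  Equiv.sum_comp (Function.Involutive.toPerm ν h.invol) f

theorem sum_sign [Fintype ι] (h : IsOddInvolution p ν) {A : Type*} [Ring A] [Algebra ℂ A] :
    ∑ i, (-1 : A) ^ p i = 0 := by
  have h1 : ∑ i, (-1 : A) ^ p i = -∑ i, (-1 : A) ^ p i := by
    conv_lhs => rw [← h.sum_comp]
    rw [← Finset.sum_neg_distrib]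
    refine Finset.sum_congr rfl fun i _ => ?_
    rcases h.parity_eq i with ⟨h1, h2⟩ | ⟨h1, h2⟩ <;> simp [h1, h2]
  have h2 : (2 : ℂ) • ∑ i, (-1 : A) ^ p i = 0 := by
    rw [two_smul]; nth_rewrite 1 [h1]; simp
  have h3 := congrArg ((1 / 2 : ℂ) • ·) h2
  simpa [smul_smul] using h3

end IsOddInvolution

/-- The submatrix on the rows and columns in the range of `f`. -/
def submatrix {ι κ B : Type*} {p : ι → ℕ} (q : κ → ℕ) (f : κ → ι)
    (X : SuperMatrix p B) : SuperMatrix q B :=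
  of q fun i j => X (f i) (f j)

theorem submatrix_apply {ι κ B : Type*} {p : ι → ℕ} (q : κ → ℕ) (f : κ → ι)
    (X : SuperMatrix p B) (i j : κ) :
    submatrix q f X i j = X (f i) (f j) := rfl

/-! ### Exchange relations with an `R`-matrix -/

section Exchange

variable {ι : Type*} [DecidableEq ι] {p : ι → ℕ} {ν : ι → ι} {B : Type*} [Ring B]

/-- The element `α - β P - γ Q` with `P = ∑ (-1) ^ |j| E i j ⊗ E j i` and
`Q = ∑ (-1) ^ |j| E i j ⊗ E (ν j) (ν i)`. -/
def rElement (p : ι → ℕ) (ν : ι → ι) (α β γ : B) : SuperMatrix (pairParity p) B :=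
  ofTensor p fun i j k l =>
    (if i = j ∧ k = l then α else 0) - (if k = j ∧ l = i then (-1) ^ p j * β else 0)
      - (if k = ν j ∧ l = ν i then (-1) ^ p j * γ else 0)

theorem rElement_apply (h : IsOddInvolution p ν) (α β γ : B) (i k j l : ι) :
    rElement p ν α β γ (i, k) (j, l) =
      (if (j, l) = (i, k) then α else 0) -
        (if (j, l) = (k, i) then (-1) ^ (p i * p k) * β else 0) -
        (if (j, l) = (ν k, ν i) then (-1) ^ (p i * (p k + 1)) * γ else 0) := by
  simp only [rElement, ofTensor, mul_sub, mul_ite, mul_zero]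
  congr 1
  · congr 1
    · by_cases h1 : i = j ∧ k = l
      · obtain ⟨rfl, rfl⟩ := h1
        simp [← two_mul, mul_assoc]
      · rw [if_neg h1, if_neg]; rintro ⟨⟩; exact h1 ⟨rfl, rfl⟩
    · by_cases h1 : k = j ∧ l = i
      · obtain ⟨rfl, rfl⟩ := h1
        rw [if_pos ⟨rfl, rfl⟩, if_pos rfl]
        rcases h.parity_eq l with ⟨h1, -⟩ | ⟨h1, -⟩ <;>
          rcases h.parity_eq k with ⟨h2, -⟩ | ⟨h2, -⟩ <;> simp [h1, h2]
      · rw [if_neg h1, if_neg]; rintro ⟨⟩; exact h1 ⟨rfl, rfl⟩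
  · by_cases h1 : k = ν j ∧ l = ν i
    · obtain ⟨rfl, rfl⟩ := h1
      rw [if_pos ⟨rfl, rfl⟩, if_pos (by rw [h.invol])]
      rcases h.parity_eq i with ⟨h1, h1'⟩ | ⟨h1, h1'⟩ <;>
        rcases h.parity_eq j with ⟨h2, h2'⟩ | ⟨h2, h2'⟩ <;> simp [h1, h2, h1', h2']
    · rw [if_neg h1, if_neg]; intro e
      rw [Prod.mk.injEq, h.eq_iff] at e
      exact h1 e

variable [Fintype ι]

theorem rElement_mul_apply (h : IsOddInvolution p ν) (α β γ : B)
    (M : SuperMatrix (pairParity p) B) (i k : ι) (b : ι × ι) :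
    (rElement p ν α β γ * M) (i, k) b = α * M (i, k) b -
      (-1) ^ (p i * p k) * (β * M (k, i) b) - (-1) ^ (p i * (p k + 1)) * (γ * M (ν k, ν i) b) := by
  rw [mul_apply]
  simp only [rElement_apply h, sub_mul, mul_sub, Finset.sum_sub_distrib, ite_mul, zero_mul,
    mul_ite, mul_zero, Prod.mk.eta, Finset.sum_ite_eq', Finset.mem_univ, if_true]
  have e1 : ∀ m : ℕ, (-1 : B) ^ ((p i + p k + (p i + p k)) * m) = 1 := fun m => by
    rw [← two_mul, mul_assoc, pow_mul]; simp
  have e2 : ∀ m : ℕ, (-1 : B) ^ ((p i + p k + (p k + p i)) * m) = 1 := fun m => by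
    rw [add_comm (p k), e1]
  have e3 : ∀ m : ℕ, (-1 : B) ^ ((p i + p k + (p (ν k) + p (ν i))) * m) = 1 := fun m => by
    have h1 := h.add_eq_one i
    have h2 := h.add_eq_one k
    rw [show p i + p k + (p (ν k) + p (ν i)) = 2 by omega, pow_mul]; simp
  simp only [pairParity, e1, e2, e3, one_mul, mul_assoc]

theorem mul_rElement_apply (h : IsOddInvolution p ν) {α β γ : B} (hα : ∀ x, Commute α x)
    (hβ : ∀ x, Commute β x) (hγ : ∀ x, Commute γ x)
    (M : SuperMatrix (pairParity p) B) (a : ι × ι) (j l : ι) :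
    (M * rElement p ν α β γ) a (j, l) = α * M a (j, l) -
      (-1) ^ (p j * p l) * (β * M a (l, j)) - (-1) ^ ((p l + 1) * p j) * (γ * M a (ν l, ν j)) := by
  have hR : ∀ c : ι × ι, rElement p ν α β γ c (j, l) =
      (if c = (j, l) then α else 0) - (if c = (l, j) then (-1) ^ (p j * p l) * β else 0) -
        (if c = (ν l, ν j) then (-1) ^ ((p l + 1) * p j) * γ else 0) := by
    rintro ⟨c, d⟩
    rw [rElement_apply h]
    congr 1
    · congr 1
      · exact if_congr eq_comm rfl rfl
      · by_cases e : (c, d) = (l, j)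
        · rw [if_pos e, if_pos (by cases e; rfl)]; cases e; rw [mul_comm (p l)]
        · rw [if_neg e, if_neg]; intro e'; cases e'; exact e rfl
    · by_cases e : (c, d) = (ν l, ν j)
      · rw [if_pos e, if_pos (by cases e; simp [h.invol])]; cases e
        rcases h.parity_eq j with ⟨h1, h1'⟩ | ⟨h1, h1'⟩ <;>
          rcases h.parity_eq l with ⟨h2, h2'⟩ | ⟨h2, h2'⟩ <;> simp [h1, h2, h1', h2']
      · rw [if_neg e, if_neg]; intro e'; cases e'; exact e (by simp [h.invol])
  obtain ⟨i, k⟩ := a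
  rw [mul_apply]
  simp only [hR, mul_sub, Finset.sum_sub_distrib, mul_ite, mul_zero, Finset.sum_ite_eq',
    Finset.mem_univ, if_true]
  have e1 : ∀ m : ℕ, (-1 : B) ^ (m * (p j + p l + (p j + p l))) = 1 := fun m => by
    rw [← two_mul, mul_left_comm, pow_mul]; simp
  have e2 : ∀ m : ℕ, (-1 : B) ^ (m * (p l + p j + (p j + p l))) = 1 := fun m => by
    rw [add_comm (p l), e1]
  have e3 : ∀ m : ℕ, (-1 : B) ^ (m * (p (ν l) + p (ν j) + (p j + p l))) = 1 := fun m => by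
    have h1 := h.add_eq_one j
    have h2 := h.add_eq_one l
    rw [show p (ν l) + p (ν j) + (p j + p l) = 2 by omega, mul_comm, pow_mul]; simp
  simp only [pairParity, e1, e2, e3, one_mul]
  rw [← (hα _).eq, ← mul_assoc (M (i, k) (l, j)), sign_comm, mul_assoc, ← (hβ _).eq,
    ← mul_assoc (M (i, k) (ν l, ν j)), sign_comm, mul_assoc, ← (hγ _).eq]

variable {κ : Type*} [Fintype κ] [DecidableEq κ] {q : κ → ℕ} {ρ : κ → κ} {f : κ → ι}

/-- The `R`-matrix preserves the unordered pairs `{±i, ±k}`, so exchange relations pass to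
submatrices on sets of indices closed under `ν`. -/
theorem exchange_sub (hp : IsOddInvolution p ν) (hq : IsOddInvolution q ρ)
    (hqp : ∀ c, p (f c) = q c)
    (hf : ∀ c, f (ρ c) = ν (f c)) {α β γ : B} (hα : ∀ x, Commute α x)
    (hβ : ∀ x, Commute β x) (hγ : ∀ x, Commute γ x) {M N : SuperMatrix (pairParity p) B}
    (h : rElement p ν α β γ * M = N * rElement p ν α β γ) :
    rElement q ρ α β γ * submatrix (pairParity q) (Prod.map f f) M =
      submatrix (pairParity q) (Prod.map f f) N * rElement q ρ α β γ := by
  ext ⟨i, k⟩ ⟨j, l⟩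
  have := congrFun (congrFun h (f i, f k)) (f j, f l)
  rw [rElement_mul_apply hp, mul_rElement_apply hp hα hβ hγ] at this
  rw [rElement_mul_apply hq, mul_rElement_apply hq hα hβ hγ]
  simp only [submatrix_apply, Prod.map_apply, hf, ← hqp]
  exact this

theorem sub_first_mul_second (hqp : ∀ c, p (f c) = q c) (X Y : SuperMatrix p B) :
    submatrix (pairParity q) (Prod.map f f) (first X * second Y) =
      first (submatrix q f X) * second (submatrix q f Y) := by
  ext ⟨i, k⟩ ⟨j, l⟩
  rw [first_mul_second_apply, submatrix_apply, Prod.map_apply, Prod.map_apply,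
    first_mul_second_apply]
  simp only [hqp, submatrix_apply]

theorem sub_second_mul_first (hqp : ∀ c, p (f c) = q c) (X Y : SuperMatrix p B) :
    submatrix (pairParity q) (Prod.map f f) (second Y * first X) =
      second (submatrix q f Y) * first (submatrix q f X) := by
  ext ⟨i, k⟩ ⟨j, l⟩
  rw [second_mul_first_apply, submatrix_apply, Prod.map_apply, Prod.map_apply,
    second_mul_first_apply]
  simp only [hqp, submatrix_apply]

/-- The exchange relation `R X¹ Y² = Y² X¹ R` in components. -/
theorem exchange_apply (h : IsOddInvolution p ν) {α β γ : B} (hα : ∀ x, Commute α x)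
    (hβ : ∀ x, Commute β x) (hγ : ∀ x, Commute γ x) {X Y : SuperMatrix p B}
    (hR : rElement p ν α β γ * (first X * second Y) = second Y * first X * rElement p ν α β γ)
    (i j k l : ι) :
    α * ((-1) ^ (p i * (p k + p l)) * (X i j * Y k l) -
        (-1) ^ (p j * (p k + p l)) * (Y k l * X i j)) =
      β * ((-1) ^ (p k * p l) * (X k j * Y i l - Y k j * X i l)) +
      γ * ((-1) ^ ((p k + 1) * (p l + 1)) *
        (X (ν k) j * Y (ν i) l - Y k (ν j) * X i (ν l))) := by
  have := congrFun (congrFun hR (i, k)) (j, l)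
  rw [rElement_mul_apply h, mul_rElement_apply h hα hβ hγ] at this
  simp only [first_mul_second_apply, second_mul_first_apply] at this
  rw [← sub_eq_zero] at this ⊢
  rw [← this]
  rcases h.parity_eq i with ⟨h1, h1'⟩ | ⟨h1, h1'⟩ <;>
    rcases h.parity_eq j with ⟨h2, h2'⟩ | ⟨h2, h2'⟩ <;>
    rcases h.parity_eq k with ⟨h3, h3'⟩ | ⟨h3, h3'⟩ <;>
    rcases h.parity_eq l with ⟨h4, h4'⟩ | ⟨h4, h4'⟩ <;>
    simp only [h1, h1', h2, h2', h3, h3', h4, h4'] <;>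
    norm_num [mul_sub, mul_add] <;> abel

/-- The product `∑ ± X i m Y (-m) l`, that is `X J Y` with `J` the odd involution of `V`. -/
def jmul (p : ι → ℕ) (ν : ι → ι) (X Y : SuperMatrix p B) (i l : ι) : B :=
  ∑ m, (-1) ^ ((p i + p m) * (p m + 1 + p l)) * (X i m * Y (ν m) l)

theorem sign_central {B : Type*} [Ring B] {β : B} (hβ : ∀ x, Commute β x) (a b c : ℕ) (x y : B) :
    (-1 : B) ^ a * (x * ((-1) ^ b * (β * ((-1) ^ c * y)))) =
      β * ((-1) ^ (a + b + c) * (x * y)) := by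
  rw [← mul_assoc β, (hβ _).eq, mul_assoc _ β, ← mul_assoc _ _ (β * y), ← pow_add, ← mul_assoc x,
    sign_comm, mul_assoc, ← mul_assoc x, ← (hβ x).eq, mul_assoc β, ← mul_assoc, ← pow_add,
    ← mul_assoc, ← (hβ _).eq, mul_assoc, add_assoc]

theorem sign_central_left {B : Type*} [Ring B] {β : B} (hβ : ∀ x, Commute β x) (a b c : ℕ)
    (x y : B) :
    (-1 : B) ^ a * ((-1) ^ b * (β * ((-1) ^ c * x)) * y) = β * ((-1) ^ (a + b + c) * (x * y)) := by
  rw [← mul_assoc β, (hβ _).eq, mul_assoc _ β, ← mul_assoc _ _ (β * x), ← pow_add, mul_assoc,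
    mul_assoc, ← mul_assoc, ← pow_add, ← mul_assoc, ← (hβ _).eq, mul_assoc, add_assoc]

/-- The exchange relation `X¹ R Y² = Y² R X¹` in components. -/
theorem mixed_apply (h : IsOddInvolution p ν) {α β γ : B} (hα : ∀ x, Commute α x)
    (hβ : ∀ x, Commute β x) (hγ : ∀ x, Commute γ x) {X Y : SuperMatrix p B}
    (hR : first X * (rElement p ν α β γ * second Y) = second Y * rElement p ν α β γ * first X)
    (i j k l : ι) :
    α * ((-1) ^ (p i * (p k + p l)) * (X i j * Y k l) -
        (-1) ^ (p j * (p k + p l)) * (Y k l * X i j)) =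
      β * ((if k = j then (-1) ^ (p k * p l) * (X * Y) i l else 0) -
        (if i = l then (-1) ^ (p k * p i) * (Y * X) k j else 0)) +
      γ * ((if k = ν j then (-1) ^ ((p l + 1) * p j) * jmul p ν X Y i l else 0) -
        (if l = ν i then (-1) ^ (p i * (p k + 1)) * jmul p ν Y X k j else 0)) := by
  have hL : (first X * (rElement p ν α β γ * second Y)) (i, k) (j, l) =
      α * ((-1) ^ (p i * (p k + p l)) * (X i j * Y k l)) -
      β * (if k = j then (-1) ^ (p k * p l) * (X * Y) i l else 0) -
      γ * (if k = ν j then (-1) ^ ((p l + 1) * p j) * jmul p ν X Y i l else 0) := by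
    rw [first_mul_apply]
    simp only [rElement_mul_apply h, mul_sub, Finset.sum_sub_distrib]
    congr 1
    · congr 1
      · rw [Finset.sum_eq_single j]
        · have := sign_central hα ((p i + p j) * (p j + p k + (p j + p l))) 0
            ((p k + p l) * p j) (X i j) (Y k l)
          rw [pow_zero, one_mul] at this
          rw [second_apply, if_pos rfl, this]
          congr 2
          apply sign_congr
          rcases h.parity_eq i with ⟨h1, -⟩ | ⟨h1, -⟩ <;>
            rcases h.parity_eq j with ⟨h2, -⟩ | ⟨h2, -⟩ <;>
            rcases h.parity_eq k with ⟨h3, -⟩ | ⟨h3, -⟩ <;>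
            rcases h.parity_eq l with ⟨h4, -⟩ | ⟨h4, -⟩ <;> simp [h1, h2, h3, h4]
        · intro m _ hm; rw [second_apply, if_neg hm]; simp
        · simp
      · split_ifs with e
        · subst e
          rw [mul_apply, Finset.mul_sum, Finset.mul_sum]
          refine Finset.sum_congr rfl fun m _ => ?_
          rw [second_apply, if_pos rfl, sign_central hβ, ← mul_assoc ((-1) ^ (p k * p l)),
            ← pow_add]
          congr 2
          apply sign_congr
          rcases h.parity_eq i with ⟨h1, -⟩ | ⟨h1, -⟩ <;>
            rcases h.parity_eq m with ⟨h2, -⟩ | ⟨h2, -⟩ <;>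
            rcases h.parity_eq k with ⟨h3, -⟩ | ⟨h3, -⟩ <;>
            rcases h.parity_eq l with ⟨h4, -⟩ | ⟨h4, -⟩ <;> simp [h1, h2, h3, h4]
        · rw [mul_zero]
          refine Finset.sum_eq_zero fun m _ => ?_
          rw [second_apply, if_neg e]; simp
    · split_ifs with e
      · subst e
        rw [jmul, Finset.mul_sum, Finset.mul_sum]
        refine Finset.sum_congr rfl fun m _ => ?_
        rw [second_apply, if_pos (h.invol j), sign_central hγ,
          ← mul_assoc ((-1) ^ ((p l + 1) * p j)),
          ← pow_add]
        congr 2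
        apply sign_congr
        rcases h.parity_eq i with ⟨h1, -⟩ | ⟨h1, -⟩ <;>
          rcases h.parity_eq m with ⟨h2, h2'⟩ | ⟨h2, h2'⟩ <;>
          rcases h.parity_eq j with ⟨h3, h3'⟩ | ⟨h3, h3'⟩ <;>
          rcases h.parity_eq l with ⟨h4, -⟩ | ⟨h4, -⟩ <;> simp [h1, h2, h3, h4, h2', h3']
      · rw [mul_zero]
        refine Finset.sum_eq_zero fun m _ => ?_
        rw [second_apply, if_neg fun e' => e (by rw [← e', h.invol])]; simp
  have hL' : (second Y * rElement p ν α β γ * first X) (i, k) (j, l) =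
      α * ((-1) ^ (p j * (p k + p l)) * (Y k l * X i j)) -
      β * (if i = l then (-1) ^ (p k * p i) * (Y * X) k j else 0) -
      γ * (if l = ν i then (-1) ^ (p i * (p k + 1)) * jmul p ν Y X k j else 0) := by
    rw [mul_first_apply]
    simp only [mul_rElement_apply h hα hβ hγ, sub_mul, mul_sub, Finset.sum_sub_distrib]
    congr 1
    · congr 1
      · rw [Finset.sum_eq_single i]
        · have := sign_central_left hα ((p i + p k + (p i + p l)) * (p i + p j)) 0
            ((p k + p l) * p i) (Y k l) (X i j)
          rw [pow_zero, one_mul] at this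
          rw [second_apply, if_pos rfl, this]
          congr 2
          apply sign_congr
          rcases h.parity_eq i with ⟨h1, -⟩ | ⟨h1, -⟩ <;>
            rcases h.parity_eq j with ⟨h2, -⟩ | ⟨h2, -⟩ <;>
            rcases h.parity_eq k with ⟨h3, -⟩ | ⟨h3, -⟩ <;>
            rcases h.parity_eq l with ⟨h4, -⟩ | ⟨h4, -⟩ <;> simp [h1, h2, h3, h4]
        · intro m _ hm; rw [second_apply, if_neg (Ne.symm hm)]; simp
        · simp
      · split_ifs with e
        · subst e
          rw [mul_apply, Finset.mul_sum, Finset.mul_sum]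
          refine Finset.sum_congr rfl fun m _ => ?_
          rw [second_apply, if_pos rfl, sign_central_left hβ, ← mul_assoc ((-1) ^ (p k * p i)),
            ← pow_add]
          congr 2
          apply sign_congr
          rcases h.parity_eq i with ⟨h1, -⟩ | ⟨h1, -⟩ <;>
            rcases h.parity_eq m with ⟨h2, -⟩ | ⟨h2, -⟩ <;>
            rcases h.parity_eq k with ⟨h3, -⟩ | ⟨h3, -⟩ <;>
            rcases h.parity_eq j with ⟨h4, -⟩ | ⟨h4, -⟩ <;> simp [h1, h2, h3, h4]
        · rw [mul_zero]
          refine Finset.sum_eq_zero fun m _ => ?_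
          rw [second_apply, if_neg e]; simp
    · split_ifs with e
      · subst e
        rw [jmul, ← h.sum_comp, Finset.mul_sum, Finset.mul_sum]
        refine Finset.sum_congr rfl fun m _ => ?_
        rw [second_apply, h.invol, h.invol, if_pos rfl, sign_central_left hγ,
          ← mul_assoc ((-1) ^ (p i * (p k + 1))), ← pow_add]
        congr 2
        apply sign_congr
        rcases h.parity_eq i with ⟨h1, h1'⟩ | ⟨h1, h1'⟩ <;>
          rcases h.parity_eq m with ⟨h2, h2'⟩ | ⟨h2, h2'⟩ <;>
          rcases h.parity_eq k with ⟨h3, h3'⟩ | ⟨h3, h3'⟩ <;>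
          rcases h.parity_eq j with ⟨h4, -⟩ | ⟨h4, -⟩ <;> simp [h1, h2, h3, h4, h1', h2']
      · rw [mul_zero]
        refine Finset.sum_eq_zero fun m _ => ?_
        rw [second_apply, if_neg fun e' => e (by rw [e', h.invol])]; simp
  rw [hR, hL'] at hL
  rw [← sub_eq_zero] at hL ⊢
  refine Eq.trans ?_ (neg_eq_zero.mpr hL)
  simp only [mul_sub]
  abel

end Exchange

/-! ### Solutions of the defining relations -/

section NegVar

variable {A B : Type*} [Ring A] [Ring B]

theorem coeff_negVar (r : ℕ) (f : PowerSeries A) :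
    PowerSeries.coeff r (negVar f) = (-1) ^ r * PowerSeries.coeff r f := by
  simp [negVar]

/-- `negVar` as a ring homomorphism. -/
noncomputable def negVarHom : PowerSeries A →+* PowerSeries A where
  toFun := negVar
  map_one' := by
    ext r; rw [coeff_negVar, PowerSeries.coeff_one]; split_ifs with h <;> simp [h]
  map_mul' f g := by
    ext r
    simp only [coeff_negVar, PowerSeries.coeff_mul, Finset.mul_sum]
    refine Finset.sum_congr rfl fun a ha => ?_
    rw [Finset.HasAntidiagonal.mem_antidiagonal] at ha
    rw [← ha, ← mul_assoc _ ((-1) ^ a.2), mul_assoc _ _ ((-1) ^ a.2), sign_comm, pow_add]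
    simp only [mul_assoc]
  map_zero' := by ext r; simp [coeff_negVar]
  map_add' f g := by ext r; simp [coeff_negVar, mul_add]

theorem negVarHom_apply (f : PowerSeries A) : negVarHom f = negVar f := rfl

theorem map_negVar (φ : A →+* B) (f : PowerSeries A) :
    PowerSeries.map φ (negVar f) = negVar (PowerSeries.map φ f) := by
  ext r; simp [coeff_negVar]

theorem map_derivU (φ : A →+* B) (f : PowerSeries A) :
    PowerSeries.map φ (derivU f) = derivU (PowerSeries.map φ f) := by
  ext r; cases r <;> simp [derivU]

end NegVar

section RTT

variable {ι : Type*} [DecidableEq ι] {p : ι → ℕ} {ν : ι → ι} {A : Type*} [Ring A]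

/-- The `R`-matrix multiplied by `v⁻² - u⁻²`. -/
noncomputable def rMatrix (p : ι → ℕ) (ν : ι → ι) (A : Type*) [Ring A] :
    SuperMatrix (pairParity p) (MvPowerSeries (Fin 2) A) :=
  let x : MvPowerSeries (Fin 2) A := MvPowerSeries.X 0
  let y : MvPowerSeries (Fin 2) A := MvPowerSeries.X 1
  rElement p ν (y ^ 2 - x ^ 2) (x * y * (x + y)) (x * y * (y - x))

theorem commute_X (k : Fin 2) (f : MvPowerSeries (Fin 2) A) : Commute (MvPowerSeries.X k) f :=
  (f.commute_X k).symm

/-- The coefficient `α = v⁻² - u⁻²` of `1` in `rMatrix` is central; likewise those of `-P` and `-Q`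
below. -/
theorem commute_alpha (f : MvPowerSeries (Fin 2) A) :
    Commute (MvPowerSeries.X 1 ^ 2 - MvPowerSeries.X 0 ^ 2) f :=
  ((commute_X 1 f).pow_left 2).sub_left ((commute_X 0 f).pow_left 2)

theorem commute_beta (f : MvPowerSeries (Fin 2) A) :
    Commute (MvPowerSeries.X 0 * MvPowerSeries.X 1 * (MvPowerSeries.X 0 + MvPowerSeries.X 1)) f :=
  ((commute_X 0 f).mul_left (commute_X 1 f)).mul_left ((commute_X 0 f).add_left (commute_X 1 f))

theorem commute_gamma (f : MvPowerSeries (Fin 2) A) :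
    Commute (MvPowerSeries.X 0 * MvPowerSeries.X 1 * (MvPowerSeries.X 1 - MvPowerSeries.X 0)) f :=
  ((commute_X 0 f).mul_left (commute_X 1 f)).mul_left ((commute_X 1 f).sub_left (commute_X 0 f))

variable [Fintype ι]

/-- The matrix `T` in the variable number `k`. -/
noncomputable def matrixInVar (k : Fin 2) (T : SuperMatrix p (PowerSeries A)) :
    SuperMatrix p (MvPowerSeries (Fin 2) A) :=
  SuperMatrix.map (inVarHom k) T

/-- A matrix of series with constant term `1` that satisfies the defining relations of the queer
super-Yangian. -/
structure IsRTT (ν : ι → ι) (T : SuperMatrix p (PowerSeries A)) : Prop where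
  const : SuperMatrix.map PowerSeries.constantCoeff T = 1
  symm : ∀ i j, negVar (T i j) = T (ν i) (ν j)
  rtt : rMatrix p ν A * (first (matrixInVar 0 T) * second (matrixInVar 1 T)) =
    second (matrixInVar 1 T) * first (matrixInVar 0 T) * rMatrix p ν A

/-- The relations satisfied by the inverse of a solution of the defining relations: the order of
the two tensor legs is reversed. -/
structure IsOppositeRTT (ν : ι → ι) (T : SuperMatrix p (PowerSeries A)) : Prop where
  const : SuperMatrix.map PowerSeries.constantCoeff T = 1
  symm : ∀ i j, negVar (T i j) = T (ν i) (ν j)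
  rtt : rMatrix p ν A * (second (matrixInVar 1 T) * first (matrixInVar 0 T)) =
    first (matrixInVar 0 T) * second (matrixInVar 1 T) * rMatrix p ν A

/-- Conjugation by the odd involution. -/
def conjInvolution (h : IsOddInvolution p ν) (B : Type*) [Ring B] :
    SuperMatrix p B →+* SuperMatrix p B where
  toFun X := of p fun i j => X (ν i) (ν j)
  map_one' := by
    ext i j
    simp only [of_apply, one_apply]
    exact if_congr ⟨fun e => by rw [← h.invol i, e, h.invol], fun e => by rw [e]⟩ rfl rfl
  map_mul' X Y := by
    ext i j
    simp only [of_apply, mul_apply]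
    rw [← h.sum_comp]
    refine Finset.sum_congr rfl fun m _ => ?_
    congr 1
    rcases h.parity_eq i with ⟨h1, h1'⟩ | ⟨h1, h1'⟩ <;>
      rcases h.parity_eq m with ⟨h2, h2'⟩ | ⟨h2, h2'⟩ <;>
      rcases h.parity_eq j with ⟨h3, h3'⟩ | ⟨h3, h3'⟩ <;> norm_num [h1, h2, h3, h1', h2', h3']
  map_zero' := by ext i j; rfl
  map_add' X Y := by ext i j; rfl

theorem map_const_inverse {T : SuperMatrix p (PowerSeries A)}
    (hc : SuperMatrix.map PowerSeries.constantCoeff T = 1) :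
    SuperMatrix.map PowerSeries.constantCoeff (Ring.inverse T) = 1 := by
  rw [← map_inverse _ (isUnit_of_constantCoeff hc), hc, Ring.inverse_one]

theorem symm_inverse (h : IsOddInvolution p ν) {T : SuperMatrix p (PowerSeries A)}
    (hc : SuperMatrix.map PowerSeries.constantCoeff T = 1)
    (hs : ∀ i j, negVar (T i j) = T (ν i) (ν j)) (i j : ι) :
    negVar (Ring.inverse T i j) = Ring.inverse T (ν i) (ν j) := by
  have hu := isUnit_of_constantCoeff hc
  have e : SuperMatrix.map negVarHom T = conjInvolution h _ T := 
    SuperMatrix.ext fun i j => hs i j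
  have e' := congrArg Ring.inverse e
  rw [map_inverse _ hu, map_inverse _ hu] at e'
  exact congrFun (congrFun e' i) j

theorem inverse_exchange {R : Type*} [Ring R] {r a b a' b' : R} (ha : a * a' = 1) (ha' : a' * a = 1)
    (hb : b * b' = 1) (hb' : b' * b = 1) (h : r * (a * b) = b * a * r) :
    r * (b' * a') = a' * b' * r := by
  calc r * (b' * a') = a' * ((b' * b) * a) * (r * (b' * a')) := by rw [hb', one_mul, ha', one_mul]
    _ = a' * b' * (b * a * r) * (b' * a') := by simp only [mul_assoc]
    _ = a' * b' * (r * (a * ((b * b') * a'))) := by rw [← h]; simp only [mul_assoc]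
    _ = a' * b' * r := by rw [hb, one_mul, ha, mul_one]

theorem matrixInVar_mul_inverse (k : Fin 2) {T : SuperMatrix p (PowerSeries A)} (h : IsUnit T) :
    matrixInVar k T * matrixInVar k (Ring.inverse T) = 1 := by
  rw [matrixInVar, matrixInVar, ← map_mul, Ring.mul_inverse_cancel _ h, map_one]

theorem matrixInVar_inverse_mul (k : Fin 2) {T : SuperMatrix p (PowerSeries A)} (h : IsUnit T) :
    matrixInVar k (Ring.inverse T) * matrixInVar k T = 1 := by
  rw [matrixInVar, matrixInVar, ← map_mul, Ring.inverse_mul_cancel _ h, map_one]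

theorem first_mul_eq_one {B : Type*} [Ring B] {X Y : SuperMatrix p B} (h : X * Y = 1) :
    first X * first Y = 1 := by
  rw [← first_mul, h, first_one]

theorem second_mul_eq_one {B : Type*} [Ring B] {X Y : SuperMatrix p B} (h : X * Y = 1) :
    second X * second Y = 1 := by
  rw [← second_mul, h, second_one]

theorem IsRTT.isUnit {T : SuperMatrix p (PowerSeries A)} (hT : IsRTT ν T) : IsUnit T :=
  isUnit_of_constantCoeff hT.const

theorem IsRTT.inverse (h : IsOddInvolution p ν) {T : SuperMatrix p (PowerSeries A)}
    (hT : IsRTT ν T) : IsOppositeRTT ν (Ring.inverse T) where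
  const := map_const_inverse hT.const
  symm := symm_inverse h hT.const hT.symm
  rtt := inverse_exchange (first_mul_eq_one (matrixInVar_mul_inverse 0 hT.isUnit))
    (first_mul_eq_one (matrixInVar_inverse_mul 0 hT.isUnit))
    (second_mul_eq_one (matrixInVar_mul_inverse 1 hT.isUnit))
    (second_mul_eq_one (matrixInVar_inverse_mul 1 hT.isUnit)) hT.rtt

theorem IsOppositeRTT.inverse (h : IsOddInvolution p ν) {T : SuperMatrix p (PowerSeries A)}
    (hT : IsOppositeRTT ν T) : IsRTT ν (Ring.inverse T) where
  const := map_const_inverse hT.const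
  symm := symm_inverse h hT.const hT.symm
  rtt := by
    have hu := isUnit_of_constantCoeff hT.const
    exact inverse_exchange (second_mul_eq_one (matrixInVar_mul_inverse 1 hu))
      (second_mul_eq_one (matrixInVar_inverse_mul 1 hu))
      (first_mul_eq_one (matrixInVar_mul_inverse 0 hu))
      (first_mul_eq_one (matrixInVar_inverse_mul 0 hu)) hT.rtt

section Sub

variable {κ : Type*} [Fintype κ] [DecidableEq κ] {q : κ → ℕ} {ρ : κ → κ} {f : κ → ι}

theorem const_sub (hi : Function.Injective f) {T : SuperMatrix p (PowerSeries A)}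
    (hc : SuperMatrix.map PowerSeries.constantCoeff T = 1) :
    SuperMatrix.map PowerSeries.constantCoeff (submatrix q f T) = 1 := by
  ext i j
  have := congrFun (congrFun hc (f i)) (f j)
  rw [map_apply, one_apply] at this
  rw [map_apply, submatrix_apply, this, one_apply]
  exact if_congr hi.eq_iff rfl rfl

theorem IsRTT.sub (hp : IsOddInvolution p ν) (hq : IsOddInvolution q ρ)
    (hqp : ∀ c, p (f c) = q c) (hf : ∀ c, f (ρ c) = ν (f c)) (hi : Function.Injective f)
    {T : SuperMatrix p (PowerSeries A)} (hT : IsRTT ν T) : IsRTT ρ (submatrix q f T) where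
  const := const_sub hi hT.const
  symm i j := by simp only [submatrix_apply, hf, hT.symm]
  rtt := by
    have := exchange_sub hp hq hqp hf commute_alpha commute_beta commute_gamma hT.rtt
    rw [sub_first_mul_second hqp, sub_second_mul_first hqp] at this
    exact this

theorem IsOppositeRTT.sub (hp : IsOddInvolution p ν) (hq : IsOddInvolution q ρ)
    (hqp : ∀ c, p (f c) = q c) (hf : ∀ c, f (ρ c) = ν (f c)) (hi : Function.Injective f)
    {T : SuperMatrix p (PowerSeries A)} (hT : IsOppositeRTT ν T) :
    IsOppositeRTT ρ (submatrix q f T) where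
  const := const_sub hi hT.const
  symm i j := by simp only [submatrix_apply, hf, hT.symm]
  rtt := by
    have := exchange_sub hp hq hqp hf commute_alpha commute_beta commute_gamma hT.rtt
    rw [sub_first_mul_second hqp, sub_second_mul_first hqp] at this
    exact this

end Sub

/-- The relation between a solution and its inverse: `T¹ R T̃² = T̃² R T¹`. -/
theorem IsRTT.mixed {T : SuperMatrix p (PowerSeries A)} (hT : IsRTT ν T) :
    first (matrixInVar 0 T) * (rMatrix p ν A * second (matrixInVar 1 (Ring.inverse T))) =
      second (matrixInVar 1 (Ring.inverse T)) * rMatrix p ν A * first (matrixInVar 0 T) := by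
  have h1 := second_mul_eq_one (matrixInVar_mul_inverse 1 hT.isUnit)
  have h2 := second_mul_eq_one (matrixInVar_inverse_mul 1 hT.isUnit)
  have h := hT.rtt
  generalize first (matrixInVar 0 T) = a at *
  generalize second (matrixInVar 1 T) = b at *
  generalize second (matrixInVar 1 (Ring.inverse T)) = b' at *
  generalize rMatrix p ν A = r at *
  calc a * (r * b') = (b' * b) * a * (r * b') := by rw [h2, one_mul]
    _ = b' * (b * a * r) * b' := by simp only [mul_assoc]
    _ = b' * (r * (a * (b * b'))) := by rw [← h]; simp only [mul_assoc]
    _ = b' * r * a := by rw [h1, mul_one, mul_assoc]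

end RTT

/-! ### Relations in one variable -/

section OneVariable

variable {ι : Type*} [Fintype ι] {p : ι → ℕ} {ν : ι → ι} {A : Type*} [Ring A]

theorem map_sign_mul {B C : Type*} [Ring B] [Ring C] (φ : B →+ C) (n : ℕ) (f : B) :
    φ ((-1) ^ n * f) = (-1) ^ n * φ f := by
  rcases neg_one_pow_eq_or B n with h | h <;> rcases Nat.even_or_odd n with e | e <;>
    simp [e.neg_one_pow]

theorem two_mul_cancel [Algebra ℂ A] {f g : PowerSeries A} (h : 2 * f = 2 * g) : f = g := by
  have h' := congrArg ((1 / 2 : ℂ) • ·) h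
  simpa [two_mul, ← two_smul ℂ, smul_smul] using h'

/-- The Euler operator applied to the entries. -/
noncomputable def eulerMatrix (T : SuperMatrix p (PowerSeries A)) : SuperMatrix p (PowerSeries A) :=
  of p fun i j => euler (T i j)

/-- The product `∑ X c j Y k c` of the transposed matrices. -/
def tmul {B : Type*} [Ring B] (X Y : SuperMatrix p B) (k j : ι) : B := ∑ c, X c j * Y k c

theorem str_mul_eq {B : Type*} [Ring B] (X Y : SuperMatrix p B) :
    str (X * Y) = ∑ i, ∑ k, (-1) ^ p k * (X i k * Y k i) := by
  simp only [str, mul_apply, Finset.mul_sum]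
  refine Finset.sum_congr rfl fun i _ => Finset.sum_congr rfl fun k _ => ?_
  rw [← mul_assoc, ← pow_add]
  congr 1
  apply sign_congr
  rcases Nat.even_or_odd' (p i) with ⟨a, h1 | h1⟩ <;>
    rcases Nat.even_or_odd' (p k) with ⟨b, h2 | h2⟩ <;> rw [h1, h2] <;> ring_nf <;> omega

variable [DecidableEq ι]

theorem diag_mul (S T : SuperMatrix p (PowerSeries A)) (i l : ι) :
    diag ((matrixInVar 0 S * matrixInVar 1 T) i l) = (S * T) i l := by
  simp only [mul_apply, map_sum, map_sign_mul]
  exact Finset.sum_congr rfl fun m _ => congrArg _ (diag_zero_mul_one _ _)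

theorem diag_mul' (S T : SuperMatrix p (PowerSeries A)) (i l : ι) :
    diag ((matrixInVar 1 S * matrixInVar 0 T) i l) = (S * T) i l := by
  simp only [mul_apply, map_sum, map_sign_mul]
  exact Finset.sum_congr rfl fun m _ => congrArg _ (diag_one_mul_zero _ _)

theorem diagEuler_mul (S T : SuperMatrix p (PowerSeries A)) (i l : ι) :
    diagEuler ((matrixInVar 0 S * matrixInVar 1 T) i l) = (S * eulerMatrix T) i l := by
  simp only [mul_apply, map_sum, map_sign_mul]
  exact Finset.sum_congr rfl fun m _ => by
    rw [eulerMatrix, of_apply, ← diagEuler_zero_mul_one]; rfl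

theorem diagEuler_mul' (S T : SuperMatrix p (PowerSeries A)) (i l : ι) :
    diagEuler ((matrixInVar 1 S * matrixInVar 0 T) i l) = (eulerMatrix S * T) i l := by
  simp only [mul_apply, map_sum, map_sign_mul]
  exact Finset.sum_congr rfl fun m _ => by
    rw [eulerMatrix, of_apply, ← diagEuler_one_mul_zero]; rfl

theorem diag_jmul (S T : SuperMatrix p (PowerSeries A)) (i l : ι) :
    diag (jmul p ν (matrixInVar 0 S) (matrixInVar 1 T) i l) = jmul p ν S T i l := by
  simp only [jmul, map_sum, map_sign_mul]
  exact Finset.sum_congr rfl fun m _ => congrArg _ (diag_zero_mul_one _ _)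

theorem diag_jmul' (S T : SuperMatrix p (PowerSeries A)) (i l : ι) :
    diag (jmul p ν (matrixInVar 1 S) (matrixInVar 0 T) i l) = jmul p ν S T i l := by
  simp only [jmul, map_sum, map_sign_mul]
  exact Finset.sum_congr rfl fun m _ => congrArg _ (diag_one_mul_zero _ _)

/-- The commutation relations of the series `t i j (u)` and `t k l (u)` in the same variable. -/
theorem IsRTT.commutator (h : IsOddInvolution p ν) {T : SuperMatrix p (PowerSeries A)}
    (hT : IsRTT ν T) (i j k l : ι) :
    2 * ((-1) ^ (p i * (p k + p l)) * (T i j * T k l) -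
        (-1) ^ (p j * (p k + p l)) * (T k l * T i j)) =
      2 * (PowerSeries.X * ((-1) ^ (p k * p l) *
        (T k j * euler (T i l) - euler (T k j) * T i l))) +
      PowerSeries.X * ((-1) ^ ((p k + 1) * (p l + 1)) *
        (T (ν k) j * T (ν i) l - T k (ν j) * T i (ν l))) := by
  have := two_mul_diag
    (exchange_apply h commute_alpha commute_beta commute_gamma hT.rtt i j k l) (by
    rw [map_sign_mul, map_sub]
    simp only [matrixInVar, map_apply, diag_zero_mul_one, diag_one_mul_zero, sub_self, mul_zero])
  simpa only [matrixInVar, map_apply, map_sign_mul, map_sub, diag_zero_mul_one, diag_one_mul_zero,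
    diagEuler_zero_mul_one, diagEuler_one_mul_zero] using this

/-- The commutation relations of the entries of `T (u)` and of its inverse in the same variable. -/
theorem IsRTT.inverse_commutator (h : IsOddInvolution p ν) {T : SuperMatrix p (PowerSeries A)}
    (hT : IsRTT ν T) (i j k l : ι) :
    2 * ((-1) ^ (p i * (p k + p l)) * (T i j * Ring.inverse T k l) -
        (-1) ^ (p j * (p k + p l)) * (Ring.inverse T k l * T i j)) =
      2 * (PowerSeries.X *
        ((if k = j then (-1) ^ (p k * p l) * (T * eulerMatrix (Ring.inverse T)) i l else 0) -
        (if i = l then (-1) ^ (p k * p i) * (eulerMatrix (Ring.inverse T) * T) k j else 0))) +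
      PowerSeries.X *
        ((if k = ν j then (-1) ^ ((p l + 1) * p j) * jmul p ν T (Ring.inverse T) i l else 0) -
        (if l = ν i then (-1) ^ (p i * (p k + 1)) * jmul p ν (Ring.inverse T) T k j else 0)) := by
  have := two_mul_diag
    (mixed_apply h commute_alpha commute_beta commute_gamma hT.mixed i j k l) (by
    rw [map_sub, apply_ite diag, apply_ite diag, map_sign_mul, map_sign_mul, diag_mul, diag_mul',
      Ring.mul_inverse_cancel _ hT.isUnit, Ring.inverse_mul_cancel _ hT.isUnit, map_zero,
      one_apply, one_apply]
    split_ifs with h1 h2 h2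
    · subst h2; simp
    · simp
    · simp
    · simp)
  simp only [map_sub, apply_ite diag, apply_ite diagEuler, map_sign_mul, diagEuler_mul,
    diagEuler_mul', diag_jmul, diag_jmul', map_zero] at this
  simpa only [matrixInVar, map_apply, diag_zero_mul_one, diag_one_mul_zero] using this

/-- `str (T θT̃) = str (θT̃ T)` for the Euler operator `θ`. Contracting `T¹ R T̃² = T̃² R T¹` twice shows
that already `str (T (u) T̃ (v)) = str (T̃ (v) T (u))`, because all terms with a pole contract to a
multiple of the supertrace `0` of the identity. -/
theorem IsRTT.str_euler_comm [Algebra ℂ A] (h : IsOddInvolution p ν)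
    {T : SuperMatrix p (PowerSeries A)} (hT : IsRTT ν T) :
    str (T * eulerMatrix (Ring.inverse T)) = str (eulerMatrix (Ring.inverse T) * T) := by
  have key : str (matrixInVar 0 T * matrixInVar 1 (Ring.inverse T)) =
      str (matrixInVar 1 (Ring.inverse T) * matrixInVar 0 T) := by
    rw [← sub_eq_zero]
    apply eq_zero_of_denominator_mul
    have e : ∀ i k, (MvPowerSeries.X 1 ^ 2 - MvPowerSeries.X 0 ^ 2) *
        ((-1) ^ p k * (matrixInVar 0 T i k * matrixInVar 1 (Ring.inverse T) k i) -
          (-1) ^ p i * (matrixInVar 1 (Ring.inverse T) k i * matrixInVar 0 T i k)) =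
        MvPowerSeries.X 0 * MvPowerSeries.X 1 * (MvPowerSeries.X 0 + MvPowerSeries.X 1) *
        ((-1) ^ p k * ((-1) ^ p i * (matrixInVar 0 T * matrixInVar 1 (Ring.inverse T)) i i) -
          (-1) ^ p i * ((-1) ^ p k * (matrixInVar 1 (Ring.inverse T) * matrixInVar 0 T) k k)) := by
      intro i k
      have := mixed_apply h commute_alpha commute_beta commute_gamma hT.mixed i k k i
      rw [if_pos rfl, if_pos rfl, if_neg (h.ne k).symm, if_neg (h.ne i).symm, sub_zero, mul_zero,
        add_zero] at this
      generalize (MvPowerSeries.X 1 ^ 2 - MvPowerSeries.X 0 ^ 2 : MvPowerSeries (Fin 2) A) = α at *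
      generalize (MvPowerSeries.X 0 * MvPowerSeries.X 1 *
        (MvPowerSeries.X 0 + MvPowerSeries.X 1) : MvPowerSeries (Fin 2) A) = β at *
      rcases h.parity_eq i with ⟨h1, -⟩ | ⟨h1, -⟩ <;>
        rcases h.parity_eq k with ⟨h2, -⟩ | ⟨h2, -⟩ <;> rw [h1, h2] at this <;> rw [h1, h2] <;>
        norm_num [mul_add, mul_sub] at this ⊢ <;> rw [← sub_eq_zero] at this ⊢ <;>
        first
          | (refine Eq.trans ?_ this; abel1)
          | (refine Eq.trans ?_ (neg_eq_zero.mpr this); abel1)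
    have hs := Finset.sum_congr (rfl : Finset.univ = Finset.univ) fun i _ =>
      Finset.sum_congr (rfl : Finset.univ = Finset.univ) fun k _ => e i k
    have z1 : ∑ i, ∑ k, (-1 : MvPowerSeries (Fin 2) A) ^ p k *
        ((-1) ^ p i * (matrixInVar 0 T * matrixInVar 1 (Ring.inverse T)) i i) = 0 := by
      refine Finset.sum_eq_zero fun i _ => ?_
      rw [← Finset.sum_mul, h.sum_sign, zero_mul]
    have z2 : ∑ i, ∑ k, (-1 : MvPowerSeries (Fin 2) A) ^ p i *
        ((-1) ^ p k * (matrixInVar 1 (Ring.inverse T) * matrixInVar 0 T) k k) = 0 := by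
      rw [Finset.sum_comm]
      refine Finset.sum_eq_zero fun k _ => ?_
      rw [← Finset.sum_mul, h.sum_sign, zero_mul]
    simp only [← Finset.mul_sum, Finset.sum_sub_distrib] at hs
    simp only [← Finset.mul_sum] at z2
    rw [z1, z2, sub_zero, mul_zero] at hs
    rw [str_mul_eq, str_mul_eq, Finset.sum_comm (f := fun i k => _ * (matrixInVar 1 _ i k * _))]
    simp only [← Finset.mul_sum]
    exact hs
  have := congrArg diagEuler key
  simpa only [str, map_sum, map_sign_mul, diagEuler_mul, diagEuler_mul'] using this

/-- `1 - str (T ∂T̃)`, where `T̃ = T⁻¹`. For a diagonal block of a Gauss decomposition this is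
`centralFactor`. -/
noncomputable def traceSeries (T : SuperMatrix p (PowerSeries A)) : PowerSeries A :=
  1 - str (T * of p fun i j => derivU (Ring.inverse T i j))

theorem X_mul_comm (f : PowerSeries A) : PowerSeries.X * f = f * PowerSeries.X :=
  (PowerSeries.commute_X f).symm.eq

theorem X_sign_comm (n : ℕ) (f : PowerSeries A) :
    (-1) ^ n * (PowerSeries.X * f) = PowerSeries.X * ((-1) ^ n * f) := by
  rw [← mul_assoc, ← sign_comm, mul_assoc]

theorem traceSeries_eq (T : SuperMatrix p (PowerSeries A)) :
    traceSeries T = 1 + PowerSeries.X * str (T * eulerMatrix (Ring.inverse T)) := by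
  rw [traceSeries, sub_eq_add_neg, str_mul_eq, str_mul_eq, Finset.mul_sum, ← Finset.sum_neg_distrib]
  congr 1
  refine Finset.sum_congr rfl fun i _ => ?_
  rw [Finset.mul_sum, ← Finset.sum_neg_distrib]
  refine Finset.sum_congr rfl fun k _ => ?_
  rw [of_apply, eulerMatrix, of_apply, derivU_eq, ← X_sign_comm, mul_neg, mul_neg, neg_neg,
    ← mul_assoc (T i k), ← X_mul_comm, mul_assoc]

/-- `IsRTT.inverse_commutator` for `i = l`, with the signs of the sum `∑ t i j t̃ k i`. -/
theorem IsRTT.transposed_term (h : IsOddInvolution p ν) {T : SuperMatrix p (PowerSeries A)}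
    (hT : IsRTT ν T) (i j k : ι) :
    2 * (T i j * Ring.inverse T k i -
        (-1) ^ ((p k + p i) * (p i + p j)) * (Ring.inverse T k i * T i j)) =
      2 * (PowerSeries.X *
        ((if k = j then (-1) ^ p i * (T * eulerMatrix (Ring.inverse T)) i i else 0) -
        (-1) ^ p i * (eulerMatrix (Ring.inverse T) * T) k j)) +
      PowerSeries.X *
        (if k = ν j then (-1) ^ p j * jmul p ν T (Ring.inverse T) i i else 0) := by
  have := hT.inverse_commutator h i j k i
  rw [if_pos rfl, if_neg (c := i = ν i) (h.ne i).symm, sub_zero] at this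
  have := congrArg ((-1) ^ (p i * p k + p i) * ·) this
  simp only [mul_add, mul_sub, mul_ite, mul_zero, ← mul_assoc] at this ⊢
  by_cases hj : k = j
  · have hj' : k ≠ ν j := fun e => h.ne j (e.symm.trans hj)
    rw [if_pos hj, if_neg hj'] at this ⊢
    subst hj
    rcases h.parity_eq i with ⟨h1, -⟩ | ⟨h1, -⟩ <;>
      rcases h.parity_eq k with ⟨h2, -⟩ | ⟨h2, -⟩ <;>
      rw [h1, h2] at this <;> rw [h1, h2] <;> norm_num [mul_assoc] at this ⊢ <;> exact this
  · rw [if_neg hj] at this ⊢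
    by_cases hj' : k = ν j
    · rw [if_pos hj'] at this ⊢
      subst hj'
      rcases h.parity_eq i with ⟨h1, -⟩ | ⟨h1, -⟩ <;>
        rcases h.parity_eq j with ⟨h2, h2'⟩ | ⟨h2, h2'⟩ <;>
        rw [h1, h2, h2'] at this <;> rw [h1, h2, h2'] <;> norm_num [mul_assoc] at this ⊢ <;>
        exact this
    · rw [if_neg hj'] at this ⊢
      rcases h.parity_eq i with ⟨h1, -⟩ | ⟨h1, -⟩ <;>
        rcases h.parity_eq j with ⟨h2, -⟩ | ⟨h2, -⟩ <;>
        rcases h.parity_eq k with ⟨h3, -⟩ | ⟨h3, -⟩ <;>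
        rw [h1, h2, h3] at this <;> rw [h1, h2, h3] <;> norm_num [mul_assoc] at this ⊢ <;>
        exact this

/-- `∑ t c j t̃ k c = δ k j (1 - str (T ∂T̃))`. -/
theorem IsRTT.tmul_inverse [Algebra ℂ A] (h : IsOddInvolution p ν)
    {T : SuperMatrix p (PowerSeries A)} (hT : IsRTT ν T) (k j : ι) :
    tmul T (Ring.inverse T) k j = if k = j then traceSeries T else 0 := by
  have key : ∀ k j, 2 * (tmul T (Ring.inverse T) k j - (if k = j then 1 else 0)) =
      2 * (PowerSeries.X * (if k = j then str (T * eulerMatrix (Ring.inverse T)) else 0)) +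
      PowerSeries.X *
        (if k = ν j then (-1) ^ p j * ∑ i, jmul p ν T (Ring.inverse T) i i else 0) := by
    intro k j
    have := Finset.sum_congr (rfl : Finset.univ = Finset.univ)
      fun i _ => hT.transposed_term h i j k
    rw [Finset.sum_add_distrib] at this
    simp only [← Finset.mul_sum, Finset.sum_sub_distrib] at this
    have e1 : ∑ i, (-1) ^ ((p k + p i) * (p i + p j)) * (Ring.inverse T k i * T i j) =
        if k = j then 1 else 0 := by
      rw [← one_apply (p := p), ← Ring.inverse_mul_cancel _ hT.isUnit, mul_apply]
    rw [e1, ← Finset.sum_mul, h.sum_sign, zero_mul, sub_zero] at this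
    rw [tmul, this, str]
    congr 3
    · split_ifs <;> simp
    · split_ifs
      · rw [Finset.mul_sum]
      · simp
  -- The trace of the identity `key` against `ν` is multiplied by the supertrace `0` of the identity.
  have hXi : ∑ i, jmul p ν T (Ring.inverse T) i i = 0 := by
    have e : ∑ i, jmul p ν T (Ring.inverse T) i i = ∑ j, tmul T (Ring.inverse T) (ν j) j := by
      simp only [jmul, tmul]
      rw [Finset.sum_comm]
      refine Finset.sum_congr rfl fun m _ => Finset.sum_congr rfl fun i _ => ?_
      rw [Even.neg_one_pow, one_mul]
      rcases h.parity_eq i with ⟨h1, -⟩ | ⟨h1, -⟩ <;>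
        rcases h.parity_eq m with ⟨h2, -⟩ | ⟨h2, -⟩ <;> rw [h1, h2] <;> decide
    have := Finset.sum_congr (rfl : Finset.univ = Finset.univ) fun j _ => key (ν j) j
    simp only [if_neg (h.ne _), if_true, sub_zero, mul_zero, zero_add] at this
    rw [← Finset.mul_sum, ← Finset.mul_sum, ← Finset.sum_mul, h.sum_sign, zero_mul, mul_zero,
      ← e] at this
    exact two_mul_cancel (this.trans (mul_zero 2).symm)
  have := key k j
  rw [hXi] at this
  simp only [mul_zero, ite_self, add_zero] at this
  have := two_mul_cancel this
  rw [sub_eq_iff_eq_add] at this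
  rw [this, traceSeries_eq]
  split_ifs <;> simp [add_comm]

/-- `IsRTT.inverse_commutator` for `k = j`, with the signs of the product `T T̃`. -/
theorem IsRTT.transposed_term' (h : IsOddInvolution p ν) {T : SuperMatrix p (PowerSeries A)}
    (hT : IsRTT ν T) (i j l : ι) :
    2 * ((-1) ^ ((p i + p j) * (p j + p l)) * (T i j * Ring.inverse T j l) -
        Ring.inverse T j l * T i j) =
      2 * (PowerSeries.X *
        ((-1) ^ p j * (T * eulerMatrix (Ring.inverse T)) i l -
          (if i = l then (-1) ^ p j * (eulerMatrix (Ring.inverse T) * T) j j else 0))) -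
      PowerSeries.X *
        (if l = ν i then (-1) ^ p i * jmul p ν (Ring.inverse T) T j j else 0) := by
  have := hT.inverse_commutator h i j j l
  rw [if_pos rfl, if_neg (c := j = ν j) (h.ne j).symm, zero_sub] at this
  have := congrArg ((-1) ^ (p l * p j + p j) * ·) this
  simp only [mul_add, mul_sub, mul_ite, mul_zero, mul_neg, ← mul_assoc] at this ⊢
  by_cases hj : i = l
  · have hj' : l ≠ ν i := fun e => h.ne i (e.symm.trans hj.symm)
    rw [if_pos hj, if_neg hj'] at this ⊢
    subst hj
    rcases h.parity_eq i with ⟨h1, -⟩ | ⟨h1, -⟩ <;>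
      rcases h.parity_eq j with ⟨h2, -⟩ | ⟨h2, -⟩ <;>
      rw [h1, h2] at this <;> rw [h1, h2] <;> norm_num [mul_assoc] at this ⊢ <;> exact this
  · rw [if_neg hj] at this ⊢
    by_cases hj' : l = ν i
    · rw [if_pos hj'] at this ⊢
      subst hj'
      rcases h.parity_eq i with ⟨h1, h1'⟩ | ⟨h1, h1'⟩ <;>
        rcases h.parity_eq j with ⟨h2, h2'⟩ | ⟨h2, h2'⟩ <;>
        rw [h1, h2, h1'] at this <;> rw [h1, h2, h1'] <;> norm_num [mul_assoc] at this ⊢ <;>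
        first
          | exact this
          | (simp only [sub_eq_add_neg] at this ⊢; exact this)
    · rw [if_neg hj'] at this ⊢
      rcases h.parity_eq i with ⟨h1, -⟩ | ⟨h1, -⟩ <;>
        rcases h.parity_eq j with ⟨h2, -⟩ | ⟨h2, -⟩ <;>
        rcases h.parity_eq l with ⟨h3, -⟩ | ⟨h3, -⟩ <;>
        rw [h1, h2, h3] at this <;> rw [h1, h2, h3] <;> norm_num [mul_assoc] at this ⊢ <;>
        exact this

/-- `∑ t̃ j l t i j = δ i l (1 - str (T ∂T̃))`; the trace of `T̃ J T` appears in the proof and vanishes. -/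
theorem IsRTT.inverse_tmul_and_jmul [Algebra ℂ A] (h : IsOddInvolution p ν)
    {T : SuperMatrix p (PowerSeries A)} (hT : IsRTT ν T) :
    (∀ i l, tmul (Ring.inverse T) T i l = if i = l then traceSeries T else 0) ∧
      ∑ j, jmul p ν (Ring.inverse T) T j j = 0 := by
  have key : ∀ i l, 2 * ((if i = l then 1 else 0) - tmul (Ring.inverse T) T i l) =
      2 * (PowerSeries.X * -(if i = l then str (T * eulerMatrix (Ring.inverse T)) else 0)) -
      PowerSeries.X *
        (if l = ν i then (-1) ^ p i * ∑ j, jmul p ν (Ring.inverse T) T j j else 0) := by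
    intro i l
    have := Finset.sum_congr (rfl : Finset.univ = Finset.univ)
      fun j _ => hT.transposed_term' h i j l
    rw [Finset.sum_sub_distrib] at this
    simp only [← Finset.mul_sum, Finset.sum_sub_distrib] at this
    have e1 : ∑ j, (-1) ^ ((p i + p j) * (p j + p l)) * (T i j * Ring.inverse T j l) =
        if i = l then 1 else 0 := by
      rw [← one_apply (p := p), ← Ring.mul_inverse_cancel _ hT.isUnit, mul_apply]
    rw [e1, ← Finset.sum_mul, h.sum_sign, zero_mul, zero_sub] at this
    rw [tmul, this, hT.str_euler_comm h, str]
    congr 3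
    · split_ifs <;> simp
    · split_ifs
      · rw [Finset.mul_sum]
      · simp
  have hXi : ∑ j, jmul p ν (Ring.inverse T) T j j = 0 := by
    have e : ∑ j, jmul p ν (Ring.inverse T) T j j = ∑ i, tmul (Ring.inverse T) T (ν i) i := by
      simp only [jmul, tmul]
      rw [Finset.sum_comm]
      refine Finset.sum_congr rfl fun m _ => Finset.sum_congr rfl fun i _ => ?_
      rw [Even.neg_one_pow, one_mul]
      rcases h.parity_eq i with ⟨h1, -⟩ | ⟨h1, -⟩ <;>
        rcases h.parity_eq m with ⟨h2, -⟩ | ⟨h2, -⟩ <;> rw [h1, h2] <;> decide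
    have := Finset.sum_congr (rfl : Finset.univ = Finset.univ) fun j _ => key (ν j) j
    simp only [if_neg (h.ne _), h.invol, if_true, zero_sub, mul_zero, neg_zero, mul_neg] at this
    have hs : ∑ i, (-1 : PowerSeries A) ^ p (ν i) = 0 := by
      rw [h.sum_comp (fun i => (-1 : PowerSeries A) ^ p i), h.sum_sign]
    rw [Finset.sum_neg_distrib, Finset.sum_neg_distrib, ← Finset.mul_sum, ← Finset.mul_sum,
      ← Finset.sum_mul, hs, zero_mul, mul_zero, neg_zero, ← e, neg_eq_zero] at this
    exact two_mul_cancel (this.trans (mul_zero 2).symm)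
  refine ⟨fun i l => ?_, hXi⟩
  have := key i l
  rw [hXi] at this
  simp only [mul_zero, ite_self, sub_zero] at this
  have := two_mul_cancel this
  rw [sub_eq_iff_eq_add, ← sub_eq_iff_eq_add'] at this
  rw [← this, traceSeries_eq]
  split_ifs <;> simp

end OneVariable

/-! ### Reindexing and supercommuting elements -/

section Reindex

variable {ι : Type*} [DecidableEq ι] [Fintype ι] {p : ι → ℕ} {ν : ι → ι}
  {κ : Type*} [Fintype κ] [DecidableEq κ] {q : κ → ℕ} {A B : Type*} [Ring A] [Ring B]

/-- Renaming the indices. -/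
def subEquiv (e : κ ≃ ι) (h : ∀ c, p (e c) = q c) : SuperMatrix p A →+* SuperMatrix q A where
  toFun := submatrix q e
  map_one' := by ext i j; simp only [submatrix_apply, one_apply, e.injective.eq_iff]
  map_mul' X Y := by
    ext i j
    simp only [submatrix_apply, mul_apply, ← h]
    exact (Equiv.sum_comp e fun m => (-1 : A) ^ ((p (e i) + p m) * (p m + p (e j))) *
      (X (e i) m * Y m (e j))).symm
  map_zero' := rfl
  map_add' _ _ := rfl

theorem traceSeries_sub (e : κ ≃ ι) (h : ∀ c, p (e c) = q c) {T : SuperMatrix p (PowerSeries A)}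
    (hT : IsUnit T) : traceSeries (submatrix q e T) = traceSeries T := by
  have hi : Ring.inverse (submatrix q e T) = submatrix q e (Ring.inverse T) :=
    map_inverse (subEquiv e h) hT
  have hm := map_mul (subEquiv (A := PowerSeries A) e h) T
    (of p fun i j => derivU (Ring.inverse T i j))
  rw [traceSeries, traceSeries, hi]
  congr 1
  trans str (submatrix q e (T * of p fun i j => derivU (Ring.inverse T i j)))
  · exact congrArg str hm.symm
  · simp only [str, submatrix_apply, ← h]
    exact Equiv.sum_comp e fun i => (-1 : PowerSeries A) ^ p i *
      (T * of p fun i j => derivU (Ring.inverse T i j)) i i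

theorem map_traceSeries (φ : A →+* B) {T : SuperMatrix p (PowerSeries A)} (hT : IsUnit T) :
    PowerSeries.map φ (traceSeries T) =
      traceSeries (SuperMatrix.map (PowerSeries.map φ) T) := by
  rw [traceSeries, traceSeries, map_inverse _ hT, map_sub, map_one, str_mul_eq, str_mul_eq]
  simp only [map_sum, map_mul, map_pow, map_neg, map_one, of_apply, map_derivU, map_apply]

/-- The element `x`, of parity `m`, supercommutes with the entries of `T`. -/
def SuperCommute (m : ℕ) (x : A) (T : SuperMatrix p A) : Prop :=
  ∀ i j, x * T i j = (-1) ^ (m * (p i + p j)) * (T i j * x)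

/-- Supercommuting with `T` means commuting with `T` in the ring of supermatrices, for the diagonal
matrix with entries `± x`. -/
theorem superCommute_iff (m : ℕ) (x : A) (T : SuperMatrix p A) :
    SuperCommute m x T ↔
      Commute (of p fun i j => if i = j then (-1) ^ (p i * m) * x else 0) T := by
  have e1 : ∀ i j, ((of p fun i j => if i = j then (-1) ^ (p i * m) * x else 0) * T :
      SuperMatrix p A) i j = (-1) ^ (p i * m) * (x * T i j) := by
    intro i j
    rw [mul_apply, Finset.sum_eq_single i]
    · rw [of_apply, if_pos rfl, ← two_mul, mul_assoc 2, pow_mul, neg_one_sq, one_pow, one_mul,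
        mul_assoc]
    · intro k _ hk; rw [of_apply, if_neg (Ne.symm hk)]; simp
    · simp
  have e2 : ∀ i j, (T * of p fun i j => if i = j then (-1) ^ (p i * m) * x else 0 :
      SuperMatrix p A) i j = (-1) ^ (p j * m) * (T i j * x) := by
    intro i j
    rw [mul_apply, Finset.sum_eq_single j]
    · rw [of_apply, if_pos rfl, ← two_mul, mul_comm _ (2 * p j), mul_assoc 2, pow_mul, neg_one_sq,
        one_pow, one_mul, ← mul_assoc (T i j), sign_comm, mul_assoc]
    · intro k _ hk; rw [of_apply, if_neg hk]; simp
    · simp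
  have hs : ∀ n : ℕ, (-1 : A) ^ n * (-1) ^ n = 1 := fun n => by
    rw [← pow_add, ← two_mul, pow_mul]; simp
  constructor
  · intro h
    ext i j
    rw [e1, e2, h i j, ← mul_assoc, ← pow_add]
    congr 1
    apply sign_congr
    have : p i * m + m * (p i + p j) = p j * m + 2 * (p i * m) := by ring
    omega
  · intro h i j
    have := congrFun (congrFun h.eq i) j
    rw [e1, e2] at this
    have : (-1) ^ (p i * m) * ((-1) ^ (p i * m) * (x * T i j)) =
        (-1) ^ (p i * m) * ((-1) ^ (p j * m) * (T i j * x)) := congrArg _ this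
    rw [← mul_assoc, hs, one_mul, ← mul_assoc, ← pow_add] at this
    rw [this]
    congr 2
    ring

theorem SuperCommute.inverse {m : ℕ} {x : A} {T : SuperMatrix p A} (h : SuperCommute m x T) :
    SuperCommute m x (Ring.inverse T) := by
  rw [superCommute_iff] at h ⊢
  by_cases hT : IsUnit T
  · obtain ⟨u, rfl⟩ := hT
    rw [Ring.inverse_unit]
    exact h.units_inv_right
  · rw [Ring.inverse_non_unit _ hT]
    exact Commute.zero_right _

theorem euler_C_mul (c : A) (f : PowerSeries A) :
    euler (PowerSeries.C c * f) = PowerSeries.C c * euler f := by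
  ext r
  rw [coeff_euler, PowerSeries.coeff_C_mul, PowerSeries.coeff_C_mul, coeff_euler, ← mul_assoc,
    (Nat.cast_commute r c).eq, mul_assoc]

theorem euler_mul_C (c : A) (f : PowerSeries A) :
    euler (f * PowerSeries.C c) = euler f * PowerSeries.C c := by
  ext r
  rw [coeff_euler, PowerSeries.coeff_mul_C, PowerSeries.coeff_mul_C, coeff_euler, mul_assoc]

theorem euler_sign_mul (n : ℕ) (f : PowerSeries A) : euler ((-1) ^ n * f) = (-1) ^ n * euler f := by
  ext r
  rw [coeff_euler, coeff_sign_mul, coeff_sign_mul, coeff_euler, ← mul_assoc, sign_comm, mul_assoc]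

/-- A homogeneous constant that supercommutes with the entries of `T` commutes with the even series
`1 - str (T ∂T̃)`. -/
theorem SuperCommute.traceSeries {m : ℕ} {c : A} {T : SuperMatrix p (PowerSeries A)}
    (h : SuperCommute m (PowerSeries.C c) T) : Commute (PowerSeries.C c) (traceSeries T) := by
  have h' := h.inverse
  rw [traceSeries_eq, str_mul_eq]
  refine (Commute.one_right _).add_right (((PowerSeries.commute_X _)).mul_right ?_)
  refine Commute.sum_right _ _ _ fun i _ => Commute.sum_right _ _ _ fun k _ => ?_
  refine Commute.mul_right (((Commute.neg_one_right _).pow_right _)) ?_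
  have e : PowerSeries.C c * euler (Ring.inverse T k i) =
      (-1) ^ (m * (p k + p i)) * (euler (Ring.inverse T k i) * PowerSeries.C c) := by
    rw [← euler_C_mul, h' k i, euler_sign_mul, euler_mul_C]
  change _ * (T i k * euler (Ring.inverse T k i)) = (T i k * euler (Ring.inverse T k i)) * _
  rw [← mul_assoc, h i k, mul_assoc, mul_assoc, e, ← mul_assoc (T i k), sign_comm, mul_assoc,
    ← mul_assoc, ← pow_add, add_comm (p k), ← two_mul, pow_mul, neg_one_sq, one_pow, one_mul,
    mul_assoc]

theorem commute_of_coeff {f g : PowerSeries A}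
    (h : ∀ r, Commute (PowerSeries.C (PowerSeries.coeff r f)) g) : Commute f g := by
  have h' : ∀ r s, PowerSeries.coeff r f * PowerSeries.coeff s g =
      PowerSeries.coeff s g * PowerSeries.coeff r f := fun r s => by
    have := congrArg (PowerSeries.coeff s) (h r).eq
    rwa [PowerSeries.coeff_C_mul, PowerSeries.coeff_mul_C] at this
  change f * g = g * f
  ext r
  rw [PowerSeries.coeff_mul, PowerSeries.coeff_mul, ← Finset.Nat.sum_antidiagonal_swap]
  exact Finset.sum_congr rfl fun s _ => h' _ _

theorem commute_C_coeff {c : A} {f : PowerSeries A} (h : Commute (PowerSeries.C c) f) (r : ℕ) :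
    Commute c (PowerSeries.coeff r f) := by
  have := congrArg (PowerSeries.coeff r) h.eq
  rwa [PowerSeries.coeff_C_mul, PowerSeries.coeff_mul_C] at this

theorem commute_C_of_coeff {c : A} {f : PowerSeries A}
    (h : ∀ r, Commute c (PowerSeries.coeff r f)) :
    Commute (PowerSeries.C c) f := by
  change _ = _
  ext r
  rw [PowerSeries.coeff_C_mul, PowerSeries.coeff_mul_C, (h r).eq]

end Reindex

section Euler

variable {ι : Type*} [Fintype ι] {p : ι → ℕ} {A : Type*} [Ring A]

theorem euler_mul (f g : PowerSeries A) : euler (f * g) = euler f * g + f * euler g := by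
  ext r
  simp only [coeff_euler, map_add, PowerSeries.coeff_mul, Finset.mul_sum]
  rw [← Finset.sum_add_distrib]
  refine Finset.sum_congr rfl fun s hs => ?_
  rw [Finset.HasAntidiagonal.mem_antidiagonal] at hs
  rw [← hs, Nat.cast_add, add_mul, mul_assoc, ← mul_assoc (PowerSeries.coeff s.1 f),
    ← (Nat.cast_commute s.2 (PowerSeries.coeff s.1 f)).eq, mul_assoc]

theorem euler_sum {α : Type*} (s : Finset α) (f : α → PowerSeries A) :
    euler (∑ a ∈ s, f a) = ∑ a ∈ s, euler (f a) := by
  ext r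
  simp only [coeff_euler, map_sum, Finset.mul_sum]

theorem euler_str_mul (X Y : SuperMatrix p (PowerSeries A)) :
    euler (str (X * Y)) = str (eulerMatrix X * Y) + str (X * eulerMatrix Y) := by
  simp only [str_mul_eq, euler_sum, euler_sign_mul]
  simp only [euler_mul, mul_add, Finset.sum_add_distrib]
  rfl

/-- The derivative can be moved from `T̃` to `T`, since `str (T̃ T) = str 1 = 0`. -/
theorem traceSeries_eq_sub [DecidableEq ι] [Algebra ℂ A] {ν : ι → ι} (h : IsOddInvolution p ν)
    {T : SuperMatrix p (PowerSeries A)} (hT : IsRTT ν T) :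
    traceSeries T = 1 - PowerSeries.X * str (Ring.inverse T * eulerMatrix T) := by
  have e := euler_str_mul (Ring.inverse T) T
  have e0 : str (1 : SuperMatrix p (PowerSeries A)) = 0 := by
    simp only [str, one_apply, if_true, mul_one]
    exact h.sum_sign
  rw [Ring.inverse_mul_cancel _ hT.isUnit, e0] at e
  have e1 : euler (0 : PowerSeries A) = 0 := by ext r; simp [coeff_euler]
  rw [e1] at e
  rw [traceSeries_eq, hT.str_euler_comm h, eq_neg_of_add_eq_zero_left e.symm, mul_neg,
    sub_eq_add_neg]

end Euler

/-! ### Schur complements -/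

section Schur

variable {κ μ : Type*} [Fintype κ] [Fintype μ] [DecidableEq κ] [DecidableEq μ]
  {p : κ → ℕ} {q : μ → ℕ} {ρ : κ → κ} {σ : μ → μ} {A : Type*} [Ring A]

theorem IsOddInvolution.sum {κ μ : Type*} {p : κ → ℕ} {q : μ → ℕ} {ρ : κ → κ} {σ : μ → μ}
    (hp : IsOddInvolution p ρ) (hq : IsOddInvolution q σ) :
    IsOddInvolution (Sum.elim p q) (Sum.map ρ σ) where
  invol := by rintro (i | i) <;> simp [hp.invol, hq.invol]
  add_eq_one := by rintro (i | i) <;> simp [hp.add_eq_one, hq.add_eq_one]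

theorem SuperCommute.sub {ι κ B : Type*} [Ring B] {p : ι → ℕ} {q : κ → ℕ} {f : κ → ι} {m : ℕ}
    {x : B} {T : SuperMatrix p B} (h : SuperCommute m x T) (hqp : ∀ c, p (f c) = q c) :
    SuperCommute m x (submatrix q f T) := fun i j => by
  rw [← hqp, ← hqp]
  exact h _ _

/-- The upper left block. -/
def corner {κ μ : Type*} {p : κ → ℕ} {q : μ → ℕ} {B : Type*}
    (T : SuperMatrix (Sum.elim p q) B) : SuperMatrix p B :=
  submatrix p Sum.inl T

theorem corner_apply {κ μ : Type*} {p : κ → ℕ} {q : μ → ℕ} {B : Type*}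
    (T : SuperMatrix (Sum.elim p q) B) (i j : κ) :
    corner T i j = T (Sum.inl i) (Sum.inl j) := rfl

/-- The inverse of the upper left block. -/
noncomputable def cornerInv (T : SuperMatrix (Sum.elim p q) A) : SuperMatrix p A :=
  Ring.inverse (corner T)

/-- The Schur complement of the upper left block, defined as the inverse of the lower right block of
the inverse. -/
noncomputable def schur (T : SuperMatrix (Sum.elim p q) A) : SuperMatrix q A :=
  Ring.inverse (submatrix q Sum.inr (Ring.inverse T))

omit [DecidableEq κ] [DecidableEq μ] in
theorem mul_apply_sum (X Y : SuperMatrix (Sum.elim p q) A) (i l : κ ⊕ μ) :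
    (X * Y) i l =
      rmul (Sum.elim p q) p (Sum.elim p q) (fun i c => X i (Sum.inl c))
        (fun c l => Y (Sum.inl c) l) i l +
      rmul (Sum.elim p q) q (Sum.elim p q) (fun i c => X i (Sum.inr c))
        (fun c l => Y (Sum.inr c) l) i l := by
  rw [mul_apply, Fintype.sum_sum_type]; rfl

theorem IsRTT.corner (hp : IsOddInvolution p ρ) (hq : IsOddInvolution q σ)
    {T : SuperMatrix (Sum.elim p q) (PowerSeries A)} (hT : IsRTT (Sum.map ρ σ) T) :
    IsRTT ρ (corner T) :=
  hT.sub (hp.sum hq) hp (fun _ => rfl) (fun _ => rfl) Sum.inl_injective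

theorem IsRTT.sub_inverse (hp : IsOddInvolution p ρ) (hq : IsOddInvolution q σ)
    {T : SuperMatrix (Sum.elim p q) (PowerSeries A)} (hT : IsRTT (Sum.map ρ σ) T) :
    IsOppositeRTT σ (submatrix q Sum.inr (Ring.inverse T)) :=
  (hT.inverse (hp.sum hq)).sub (hp.sum hq) hq (fun _ => rfl) (fun _ => rfl) Sum.inr_injective

theorem IsRTT.schur (hp : IsOddInvolution p ρ) (hq : IsOddInvolution q σ)
    {T : SuperMatrix (Sum.elim p q) (PowerSeries A)} (hT : IsRTT (Sum.map ρ σ) T) :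
    IsRTT σ (schur T) :=
  (hT.sub_inverse hp hq).inverse hq

/-- The inverse of the Schur complement is the lower right block of `T⁻¹`. -/
theorem IsRTT.inverse_schur (hp : IsOddInvolution p ρ) (hq : IsOddInvolution q σ)
    {T : SuperMatrix (Sum.elim p q) (PowerSeries A)} (hT : IsRTT (Sum.map ρ σ) T) :
    Ring.inverse (QueerYangian.schur T) = submatrix q Sum.inr (Ring.inverse T) := by
  have hu := isUnit_of_constantCoeff (hT.sub_inverse hp hq).const
  exact inverse_eq_of_mul_eq_one (Ring.inverse_mul_cancel _ hu) (Ring.mul_inverse_cancel _ hu)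

omit [DecidableEq κ] [DecidableEq μ] in
theorem eq_add_of_block_inverse {a a' : κ → κ → A} {b v : κ → μ → A} {c : μ → κ → A}
    {d w w' : μ → μ → A} (ha : ∀ Y : κ → μ → A, rmul p p q (rmul p p p a' a) Y = Y)
    (h12 : rmul p p q a v + rmul p q q b w = 0)
    (h22 : ∀ Y : μ → μ → A, rmul q q q (rmul q p q c v + rmul q q q d w) Y = Y)
    (hw : ∀ Y : μ → μ → A, rmul q q q Y (rmul q q q w w') = Y) :
    d = w' + rmul q p q c (rmul p p q a' b) := by
  have hv : v = -rmul p q q (rmul p p q a' b) w := by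
    have e := congrArg (rmul p p q a') h12
    rw [rmul_add, ← rmul_assoc, ha, ← rmul_assoc] at e
    refine eq_neg_of_add_eq_zero_left (e.trans ?_)
    ext i j; simp [rmul]
  have e := h22 w'
  rw [hv, rmul_neg, ← rmul_assoc, neg_add_eq_sub, ← sub_rmul, rmul_assoc, hw] at e
  rw [← e, sub_add_cancel]

/-- The lower right block is the sum of the Schur complement and `T₂₁ T₁₁⁻¹ T₁₂`. -/
theorem eq_schur_add {T : SuperMatrix (Sum.elim p q) A} (hT : IsUnit T) (hc : IsUnit (corner T))
    (hs : IsUnit (submatrix q Sum.inr (Ring.inverse T))) (i j : μ) :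
    T (Sum.inr i) (Sum.inr j) = schur T i j +
      rmul q p q (fun i c => T (Sum.inr i) (Sum.inl c))
        (rmul p p q (cornerInv T) fun c j => T (Sum.inl c) (Sum.inr j)) i j := by
  have hi := Ring.mul_inverse_cancel _ hT
  have hl : cornerInv T * corner T = 1 := Ring.inverse_mul_cancel _ hc
  have hr : submatrix q Sum.inr (Ring.inverse T) * schur T = 1 := Ring.mul_inverse_cancel _ hs
  refine congrFun (congrFun (eq_add_of_block_inverse (a := corner T)
    (d := fun i j => T (Sum.inr i) (Sum.inr j))
    (v := fun i j => Ring.inverse T (Sum.inl i) (Sum.inr j))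
    (w := submatrix q Sum.inr (Ring.inverse T)) ?_ ?_ ?_ ?_) i) j
  · intro Y
    refine Eq.trans (congrArg (fun Z => rmul p p q Z Y) ?_) (one_rmul Y)
    exact hl
  · ext i j
    have := congrFun (congrFun hi (Sum.inl i)) (Sum.inr j)
    rw [mul_apply_sum, one_apply, if_neg Sum.inl_ne_inr] at this
    exact this
  · intro Y
    refine Eq.trans (congrArg (fun Z => rmul q q q Z Y) ?_) (one_rmul Y)
    ext i j
    have := congrFun (congrFun hi (Sum.inr i)) (Sum.inr j)
    rw [mul_apply_sum, one_apply, if_congr Sum.inr_injective.eq_iff rfl rfl] at this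
    exact this
  · intro Y
    refine Eq.trans (congrArg (fun Z => rmul q q q Y Z) ?_) (rmul_one Y)
    exact hr

theorem rmul_eq_const_mul {ι κ η B : Type*} [Fintype κ] [Ring B] {p : ι → ℕ} {q : κ → ℕ}
    {r : η → ℕ} {z : B} {X X' : ι → κ → B} (h : ∀ i j, X i j = z * X' i j) (Y : κ → η → B)
    (i : ι) (l : η) : rmul p q r X Y i l = z * rmul p q r X' Y i l := by
  simp only [rmul, Finset.mul_sum]
  refine Finset.sum_congr rfl fun j _ => ?_
  rw [h, mul_assoc, ← mul_assoc, ← sign_comm, mul_assoc]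

section Trace

variable {T : SuperMatrix (Sum.elim p q) (PowerSeries A)}

/-- The commutation relation of `t i b` and `t c l`, multiplied from the left by `x`; the signs are those of
super products in which `x` is the entry `b c` of a matrix. -/
theorem corner_commutator (hp : IsOddInvolution p ρ) (hq : IsOddInvolution q σ)
    (hT : IsRTT (Sum.map ρ σ) T) (b c : κ) (i l : κ ⊕ μ) (x : PowerSeries A) :
    2 * ((-1) ^ ((Sum.elim p q i + p c) * (p c + Sum.elim p q l)) *
          (x * T i (Sum.inl b) * T (Sum.inl c) l) -
        (-1) ^ ((p b + p c) * (p c + Sum.elim p q l)) *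
          (x * T (Sum.inl c) l) * T i (Sum.inl b)) =
      2 * (PowerSeries.X * ((-1) ^ p c * (x * corner T c b) * euler (T i l) -
        (-1) ^ p c * (x * eulerMatrix (corner T) c b) * T i l)) +
      PowerSeries.X * ((-1) ^ (Sum.elim p q l + 1) *
        (x * corner T (ρ c) b * T (Sum.map ρ σ i) l -
          x * corner T c (ρ b) * T i (Sum.map ρ σ l))) := by
  have e2 : ∀ y : PowerSeries A, x * (2 * y) = 2 * (x * y) := fun y => by
    rw [two_mul, two_mul, mul_add]
  have eX : ∀ y : PowerSeries A, x * (PowerSeries.X * y) = PowerSeries.X * (x * y) := fun y => by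
    rw [← mul_assoc, ← X_mul_comm, mul_assoc]
  have := congrArg (x * ·) (hT.commutator (hp.sum hq) i (Sum.inl b) (Sum.inl c) l)
  simp only [Sum.elim_inl, Sum.map_inl, mul_add, e2, eX] at this
  simp only [corner_apply, eulerMatrix, of_apply]
  rcases hp.parity_eq b with ⟨h1, -⟩ | ⟨h1, -⟩ <;>
    rcases hp.parity_eq c with ⟨h2, -⟩ | ⟨h2, -⟩ <;>
    rcases (hp.sum hq).parity_eq i with ⟨h3, -⟩ | ⟨h3, -⟩ <;>
    rcases (hp.sum hq).parity_eq l with ⟨h4, -⟩ | ⟨h4, -⟩ <;>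
    rw [h1, h2, h3, h4] at this <;> rw [h1, h2, h3, h4] <;>
    norm_num [mul_add, mul_sub, mul_assoc] at this ⊢ <;> rw [← sub_eq_zero] at this ⊢ <;>
    first
      | (refine Eq.trans ?_ this; abel1)
      | (refine Eq.trans ?_ (neg_eq_zero.mpr this); abel1)

variable [Algebra ℂ A]

/-- Summing the commutation relations of the upper left block with `T` against the inverse of this
block isolates `traceSeries (corner T)`. -/
theorem corner_trace (hp : IsOddInvolution p ρ) (hq : IsOddInvolution q σ)
    (hT : IsRTT (Sum.map ρ σ) T) (i l : κ ⊕ μ) :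
    rmul (Sum.elim p q) p (Sum.elim p q)
        (fun i c => ∑ b, cornerInv T b c * T i (Sum.inl b))
        (fun c l => T (Sum.inl c) l) i l -
      ∑ b, rmul p p (Sum.elim p q) (cornerInv T) (fun c l => T (Sum.inl c) l) b l *
        T i (Sum.inl b) =
      (traceSeries (corner T) - 1) * T i l := by
  have hA := hT.corner hp hq
  have hinv : cornerInv T * corner T = 1 := Ring.inverse_mul_cancel _ hA.isUnit
  -- With `x` the entries of `T₁₁⁻¹`, the sums of the factors that involve only the upper left block:
  -- all of them vanish, except the one that defines `traceSeries (corner T)`.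
  have s1 : ∑ b, ∑ c, (-1) ^ p c * (cornerInv T b c * corner T c b) = 0 := by
    rw [← str_mul_eq, hinv]
    simp only [str, one_apply, if_true, mul_one]
    exact hp.sum_sign
  have s2 : ∑ b, ∑ c, (-1) ^ p c * (cornerInv T b c * eulerMatrix (corner T) c b) =
      str (cornerInv T * eulerMatrix (corner T)) := (str_mul_eq _ _).symm
  have s3 : ∑ b, ∑ c, cornerInv T b c * corner T (ρ c) b = 0 := by
    rw [← (hA.inverse_tmul_and_jmul hp).2]
    change _ = ∑ j, jmul p ρ (cornerInv T) (corner T) j j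
    simp only [jmul]
    refine Finset.sum_congr rfl fun b _ => Finset.sum_congr rfl fun c _ => ?_
    rw [Even.neg_one_pow, one_mul]
    rcases hp.parity_eq b with ⟨h1, -⟩ | ⟨h1, -⟩ <;>
      rcases hp.parity_eq c with ⟨h2, -⟩ | ⟨h2, -⟩ <;> rw [h1, h2] <;> decide
  have s4 : ∑ b, ∑ c, cornerInv T b c * corner T c (ρ b) = 0 := by
    refine Finset.sum_eq_zero fun b _ => ?_
    have := congrFun (congrFun hinv b) (ρ b)
    rw [one_apply, if_neg (hp.ne b).symm, mul_apply] at this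
    refine Eq.trans (Finset.sum_congr rfl fun c _ => ?_) this
    rw [Even.neg_one_pow, one_mul]
    rcases hp.parity_eq b with ⟨h1, h1'⟩ | ⟨h1, h1'⟩ <;>
      rcases hp.parity_eq c with ⟨h2, -⟩ | ⟨h2, -⟩ <;> rw [h1, h2, h1'] <;> decide
  have key := Finset.sum_congr (rfl : Finset.univ = Finset.univ) fun b _ =>
    Finset.sum_congr (rfl : Finset.univ = Finset.univ) fun c _ =>
      corner_commutator hp hq hT b c i l (cornerInv T b c)
  have ez := traceSeries_eq_sub hp hA
  change _ = 1 - PowerSeries.X * str (cornerInv T * _) at ez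
  rw [← s2] at ez
  simp only [← Finset.mul_sum, Finset.sum_add_distrib, Finset.sum_sub_distrib] at key
  simp only [← Finset.sum_mul] at key
  rw [s1, s3, s4, zero_mul, zero_mul, zero_mul, sub_zero, mul_zero, mul_zero, add_zero, zero_sub,
    mul_neg, ← mul_assoc PowerSeries.X, ← neg_mul] at key
  rw [ez, sub_sub_cancel_left, ← two_mul_cancel key]
  congr 1
  rw [rmul, Finset.sum_comm]
  refine Finset.sum_congr rfl fun c _ => ?_
  rw [Finset.sum_mul, Finset.mul_sum]

/-- `T₂₁ T₁₁⁻¹` in terms of the sum `∑ ã b c t i b`. -/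
theorem corner_trace_right (hp : IsOddInvolution p ρ) (hq : IsOddInvolution q σ)
    (hT : IsRTT (Sum.map ρ σ) T) (i : κ ⊕ μ) (l : κ) :
    ∑ b, cornerInv T b l * T i (Sum.inl b) =
      traceSeries (corner T) *
        rmul (Sum.elim p q) p p (fun i c => T i (Sum.inl c)) (cornerInv T) i l := by
  have hA := hT.corner hp hq
  have hl : cornerInv T * corner T = 1 := Ring.inverse_mul_cancel _ hA.isUnit
  have hr : corner T * cornerInv T = 1 := Ring.mul_inverse_cancel _ hA.isUnit
  have key : rmul (Sum.elim p q) p p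
        (fun i c => ∑ b, cornerInv T b c * T i (Sum.inl b)) (corner T) =
      fun i l => traceSeries (corner T) * T i (Sum.inl l) := by
    funext i l
    have := corner_trace hp hq hT i (Sum.inl l)
    have e : ∀ b, rmul p p (Sum.elim p q) (cornerInv T) (fun c l => T (Sum.inl c) l) b (Sum.inl l) =
        if b = l then 1 else 0 := fun b => by
      rw [← one_apply (p := p), ← hl]; rfl
    simp only [e, ite_mul, one_mul, zero_mul, Finset.sum_ite_eq', Finset.mem_univ, if_true,
      sub_mul] at this
    exact sub_left_inj.mp this
  have key' := (rmul_assoc _ _ _).symm.trans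
    (congrArg (fun Y => rmul (Sum.elim p q) p p Y (cornerInv T)) key)
  have e := congrArg (rmul (Sum.elim p q) p p fun i c => ∑ b, cornerInv T b c * T i (Sum.inl b)) hr
  have e' := (e.trans (rmul_one _)).symm.trans key'
  exact (congrFun (congrFun e' i) l).trans (rmul_eq_const_mul (fun _ _ => rfl) _ _ _)

/-- Here `∑ ã b c t i b` is known from `IsRTT.inverse_tmul_and_jmul`, and only the second sum of
`corner_trace` remains. -/
theorem corner_trace_inl (hp : IsOddInvolution p ρ) (hq : IsOddInvolution q σ)
    (hT : IsRTT (Sum.map ρ σ) T) (i : κ) (l : μ) :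
    ∑ b, rmul p p q (cornerInv T) (fun c l => T (Sum.inl c) (Sum.inr l)) b l *
      T (Sum.inl i) (Sum.inl b) = T (Sum.inl i) (Sum.inr l) := by
  have := corner_trace hp hq hT (Sum.inl i) (Sum.inr l)
  have e : ∀ c, ∑ b, cornerInv T b c * T (Sum.inl i) (Sum.inl b) =
      if i = c then traceSeries (corner T) else 0 := fun c =>
    ((hT.corner hp hq).inverse_tmul_and_jmul hp).1 i c
  rw [rmul, Finset.sum_eq_single i, e, if_pos rfl, sub_mul, one_mul, Sum.elim_inl, ← two_mul,
    mul_assoc, pow_mul, neg_one_sq, one_pow, one_mul] at this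
  · exact sub_right_inj.mp this
  · intro c _ hc; rw [e, if_neg hc.symm, zero_mul, mul_zero]
  · simp

/-- The lower right block in terms of the Schur complement, up to a combination of the columns of the
lower left block. -/
theorem corner_trace_inr (hp : IsOddInvolution p ρ) (hq : IsOddInvolution q σ)
    (hT : IsRTT (Sum.map ρ σ) T) (i : μ) (l : μ) :
    T (Sum.inr i) (Sum.inr l) = traceSeries (corner T) * schur T i l +
      ∑ b, rmul p p q (cornerInv T) (fun c l => T (Sum.inl c) (Sum.inr l)) b l *
        T (Sum.inr i) (Sum.inl b) := by
  have := corner_trace hp hq hT (Sum.inr i) (Sum.inr l)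
  have e : rmul (Sum.elim p q) p (Sum.elim p q)
      (fun i c => ∑ b, cornerInv T b c * T i (Sum.inl b)) (fun c l => T (Sum.inl c) l)
        (Sum.inr i) (Sum.inr l) =
      traceSeries (corner T) * (T (Sum.inr i) (Sum.inr l) - schur T i l) := by
    rw [eq_schur_add hT.isUnit (hT.corner hp hq).isUnit
      (isUnit_of_constantCoeff (hT.sub_inverse hp hq).const), add_sub_cancel_left]
    refine (rmul_eq_const_mul (fun i c => corner_trace_right hp hq hT i c) _ _ _).trans
      (congrArg _ ?_)
    exact congrFun (congrFun (rmul_assoc (p := q) (q := p) (r := p) (s := q)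
      (fun i c => T (Sum.inr i) (Sum.inl c)) (cornerInv T)
      fun c j => T (Sum.inl c) (Sum.inr j)) i) l
  rw [e, mul_sub, sub_mul, one_mul, sub_sub, sub_right_inj] at this
  exact this.symm

/-- Both sides are read off from `IsRTT.tmul_inverse` on the diagonal of the lower right block, which
has to be nonempty. -/
theorem traceSeries_eq_mul_of_nonempty [Nonempty μ] (hp : IsOddInvolution p ρ)
    (hq : IsOddInvolution q σ)
    (hT : IsRTT (Sum.map ρ σ) T) :
    traceSeries T = traceSeries (corner T) * traceSeries (schur T) := by
  obtain ⟨k⟩ := ‹Nonempty μ›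
  have h := hp.sum hq
  have hS := hT.schur hp hq
  have e1 := hT.tmul_inverse h (Sum.inr k) (Sum.inr k)
  have e2 := fun b => hT.tmul_inverse h (Sum.inr k) (Sum.inl b)
  have e3 := hS.tmul_inverse hq k k
  rw [hT.inverse_schur hp hq] at e3
  simp only [if_neg Sum.inr_ne_inl, tmul, Fintype.sum_sum_type] at e2
  rw [if_pos rfl] at e1 e3
  rw [tmul, Fintype.sum_sum_type] at e1
  -- The off-diagonal relations `e2` remove the combination of columns of the left blocks.
  have e0 := Finset.sum_congr (rfl : Finset.univ = Finset.univ) fun b _ => congrArg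
    (rmul p p q (cornerInv T) (fun c l => T (Sum.inl c) (Sum.inr l)) b k * ·) (e2 b)
  simp only [mul_zero, Finset.sum_const_zero, mul_add, Finset.sum_add_distrib, Finset.mul_sum,
    ← mul_assoc] at e0
  rw [← e1, ← e3, tmul, Finset.mul_sum]
  have c1 : ∑ c, T (Sum.inl c) (Sum.inr k) * Ring.inverse T (Sum.inr k) (Sum.inl c) =
      ∑ c, ∑ b, rmul p p q (cornerInv T) (fun c l => T (Sum.inl c) (Sum.inr l)) b k *
        T (Sum.inl c) (Sum.inl b) * Ring.inverse T (Sum.inr k) (Sum.inl c) :=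
    Finset.sum_congr rfl fun c _ => by rw [← Finset.sum_mul, corner_trace_inl hp hq hT]
  have c2 : ∑ i, T (Sum.inr i) (Sum.inr k) * Ring.inverse T (Sum.inr k) (Sum.inr i) =
      ∑ i, traceSeries (corner T) * (schur T i k * Ring.inverse T (Sum.inr k) (Sum.inr i)) +
      ∑ i, ∑ b, rmul p p q (cornerInv T) (fun c l => T (Sum.inl c) (Sum.inr l)) b k *
        T (Sum.inr i) (Sum.inl b) * Ring.inverse T (Sum.inr k) (Sum.inr i) := by
    rw [← Finset.sum_add_distrib]
    refine Finset.sum_congr rfl fun i _ => ?_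
    rw [← Finset.sum_mul, ← mul_assoc, ← add_mul, ← corner_trace_inr hp hq hT]
  rw [c1, c2, add_left_comm,
    (congrArg₂ (· + ·) Finset.sum_comm Finset.sum_comm).trans e0, add_zero]
  rfl

omit [Algebra ℂ A] in
/-- The entries of the upper left block of `T` supercommute with the entries of the lower right
block of `T⁻¹`. -/
theorem superCommute_corner (hp : IsOddInvolution p ρ) (hq : IsOddInvolution q σ)
    (hT : IsRTT (Sum.map ρ σ) T) (k l : μ) (s : ℕ) :
    SuperCommute (q k + q l)
      (PowerSeries.C (PowerSeries.coeff s (Ring.inverse T (Sum.inr k) (Sum.inr l))))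
      (corner T) := by
  intro i j
  have := mixed_apply (hp.sum hq) commute_alpha commute_beta commute_gamma hT.mixed
    (Sum.inl i) (Sum.inl j) (Sum.inr k) (Sum.inr l)
  rw [if_neg Sum.inr_ne_inl, if_neg Sum.inl_ne_inr, if_neg (by simp), if_neg (by simp), sub_zero,
    mul_zero, mul_zero, add_zero] at this
  have := sub_eq_zero.mp (eq_zero_of_denominator_mul this)
  simp only [Sum.elim_inl, Sum.elim_inr] at this
  ext r
  have h2 : (-1) ^ (p i * (q k + q l)) * (PowerSeries.coeff r (T (Sum.inl i) (Sum.inl j)) *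
        PowerSeries.coeff s (Ring.inverse T (Sum.inr k) (Sum.inr l))) =
      (-1) ^ (p j * (q k + q l)) * (PowerSeries.coeff s (Ring.inverse T (Sum.inr k) (Sum.inr l)) *
        PowerSeries.coeff r (T (Sum.inl i) (Sum.inl j))) := by
    have := congrArg (MvPowerSeries.coeff (biIndex r s)).toAddMonoidHom this
    rw [map_sign_mul, map_sign_mul] at this
    simpa only [matrixInVar, map_apply, LinearMap.toAddMonoidHom_coe,
      coeff_inVar_zero_mul_inVar_one, coeff_inVar_one_mul_inVar_zero] using this
  rw [PowerSeries.coeff_C_mul, coeff_sign_mul, PowerSeries.coeff_mul_C, corner_apply]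
  generalize PowerSeries.coeff r (T (Sum.inl i) (Sum.inl j)) = x at *
  generalize PowerSeries.coeff s (Ring.inverse T (Sum.inr k) (Sum.inr l)) = y at *
  have h3 := congrArg ((-1) ^ (p j * (q k + q l)) * ·) h2
  rw [← mul_assoc, ← mul_assoc _ _ (_ * _), ← pow_add, ← pow_add] at h3
  refine Eq.trans ?_ (h3.symm.trans ?_)
  · rw [Even.neg_one_pow ⟨_, rfl⟩, one_mul]
  · congr 2; ring

omit [Algebra ℂ A] in
/-- The coefficients of `1 - str (T ∂T̃)` for the upper left block commute with the Schur
complement. -/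
theorem superCommute_schur (hp : IsOddInvolution p ρ) (hq : IsOddInvolution q σ)
    (hT : IsRTT (Sum.map ρ σ) T) (r : ℕ) :
    SuperCommute 0 (PowerSeries.C (PowerSeries.coeff r (traceSeries (corner T)))) (schur T) := by
  refine SuperCommute.inverse fun k l => ?_
  rw [zero_mul, pow_zero, one_mul]
  refine commute_C_of_coeff fun s => ?_
  exact (commute_C_coeff (superCommute_corner hp hq hT k l s).traceSeries r).symm

/-- The series `1 - str (T ∂T̃)` is multiplicative along block decompositions. -/
theorem traceSeries_eq_mul (hp : IsOddInvolution p ρ) (hq : IsOddInvolution q σ)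
    (hT : IsRTT (Sum.map ρ σ) T) :
    traceSeries T = traceSeries (corner T) * traceSeries (schur T) := by
  rcases isEmpty_or_nonempty μ with hμ | hμ
  · have e : traceSeries (schur T) = 1 := by simp [traceSeries, str]
    rw [e, mul_one]
    exact (traceSeries_sub (Equiv.sumEmpty κ μ).symm (fun _ => rfl) hT.isUnit).symm
  · exact traceSeries_eq_mul_of_nonempty hp hq hT

omit [Algebra ℂ A] in
theorem SuperCommute.schur {m : ℕ} {c : PowerSeries A} (h : SuperCommute m c T) :
    SuperCommute m c (schur T) := by
  exact (h.inverse.sub (fun _ => rfl)).inverse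

end Trace

end Schur

/-! ### Block Gauss decompositions -/

section Gauss

variable {S : Type*} [Ring S]

/-- The factorization `T = F H E` with `F` lower unitriangular, `H` diagonal and `E` upper
unitriangular. -/
structure IsGauss {n : ℕ} (T F : Matrix (Fin n) (Fin n) S) (H : Fin n → S)
    (E : Matrix (Fin n) (Fin n) S) : Prop where
  F_upper : ∀ a b, a < b → F a b = 0
  F_diag : ∀ a, F a a = 1
  E_lower : ∀ a b, b < a → E a b = 0
  E_diag : ∀ a, E a a = 1
  factorization : T = F * Matrix.diagonal H * E

theorem gauss_product_apply {n : ℕ} (F : Matrix (Fin n) (Fin n) S) (H : Fin n → S)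
    (E : Matrix (Fin n) (Fin n) S) (a b : Fin n) :
    (F * Matrix.diagonal H * E) a b = ∑ c, F a c * H c * E c b := by
  rw [Matrix.mul_apply]
  simp only [Matrix.mul_diagonal]

/-- The Schur complement of the first diagonal entry. -/
noncomputable def firstSchur {n : ℕ} (T : Matrix (Fin (n + 1)) (Fin (n + 1)) S) :
    Matrix (Fin n) (Fin n) S :=
  Matrix.of fun a b => T a.succ b.succ - T a.succ 0 * (Ring.inverse (T 0 0) * T 0 b.succ)

theorem firstSchur_apply {n : ℕ} (T : Matrix (Fin (n + 1)) (Fin (n + 1)) S) (a b : Fin n) :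
    firstSchur T a b = T a.succ b.succ - T a.succ 0 * (Ring.inverse (T 0 0) * T 0 b.succ) := rfl

variable {n : ℕ} {T F : Matrix (Fin (n + 1)) (Fin (n + 1)) S} {H : Fin (n + 1) → S}
  {E : Matrix (Fin (n + 1)) (Fin (n + 1)) S}

theorem IsGauss.apply (h : IsGauss T F H E) (a b : Fin (n + 1)) :
    T a b = F a 0 * H 0 * E 0 b + ∑ c : Fin n, F a c.succ * H c.succ * E c.succ b := by
  rw [← Fin.sum_univ_succ fun c => F a c * H c * E c b, ← gauss_product_apply, ← h.factorization]

theorem IsGauss.H_zero (h : IsGauss T F H E) : H 0 = T 0 0 := by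
  rw [h.apply, h.F_diag, h.E_diag, one_mul, mul_one, Finset.sum_eq_zero, add_zero]
  intro c _
  rw [h.F_upper _ _ c.succ_pos, zero_mul, zero_mul]

theorem IsGauss.F_col (h : IsGauss T F H E) (a : Fin (n + 1)) : F a 0 * T 0 0 = T a 0 := by
  rw [h.apply a 0, h.E_diag, mul_one, h.H_zero, Finset.sum_eq_zero, add_zero]
  intro c _
  rw [h.E_lower _ _ c.succ_pos, mul_zero]

theorem IsGauss.E_row (h : IsGauss T F H E) (b : Fin (n + 1)) : T 0 0 * E 0 b = T 0 b := by
  rw [h.apply 0 b, h.F_diag, one_mul, h.H_zero, Finset.sum_eq_zero, add_zero]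
  intro c _
  rw [h.F_upper _ _ c.succ_pos, zero_mul, zero_mul]

theorem IsGauss.firstSchur (h : IsGauss T F H E) (hu : IsUnit (T 0 0)) :
    IsGauss (firstSchur T) (F.submatrix Fin.succ Fin.succ) (fun a => H a.succ)
      (E.submatrix Fin.succ Fin.succ) where
  F_upper a b hab := h.F_upper _ _ (Fin.succ_lt_succ_iff.mpr hab)
  F_diag a := h.F_diag _
  E_lower a b hab := h.E_lower _ _ (Fin.succ_lt_succ_iff.mpr hab)
  E_diag a := h.E_diag _
  factorization := by
    ext a b
    rw [gauss_product_apply, firstSchur_apply, ← h.E_row b.succ, ← mul_assoc (Ring.inverse _),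
      Ring.inverse_mul_cancel _ hu, one_mul, ← h.F_col, h.apply a.succ b.succ, h.H_zero,
      add_sub_cancel_left]
    rfl

/-- A Gauss decomposition of the Schur complement of `T 0 0` extends to one of `T`. -/
theorem isGauss_of_firstSchur (hu : IsUnit (T 0 0)) {F H E}
    (h : IsGauss (QueerYangian.firstSchur T) F H E) :
    IsGauss T
      (Matrix.of (Fin.cons (Fin.cons 1 0)
        fun a => Fin.cons (T a.succ 0 * Ring.inverse (T 0 0)) (F a)))
      (Fin.cons (T 0 0) H)
      (Matrix.of (Fin.cons (Fin.cons 1 fun b => Ring.inverse (T 0 0) * T 0 b.succ)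
        fun a => Fin.cons 0 (E a))) where
  F_upper a b hab := by
    cases b using Fin.cases with
    | zero => exact absurd hab (Fin.not_lt_zero _)
    | succ b =>
      cases a using Fin.cases with
      | zero => rfl
      | succ a => exact h.F_upper _ _ (Fin.succ_lt_succ_iff.mp hab)
  F_diag a := by
    cases a using Fin.cases with
    | zero => rfl
    | succ a => exact h.F_diag a
  E_lower a b hab := by
    cases a using Fin.cases with
    | zero => exact absurd hab (Fin.not_lt_zero _)
    | succ a =>
      cases b using Fin.cases with
      | zero => rfl
      | succ b => exact h.E_lower _ _ (Fin.succ_lt_succ_iff.mp hab)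
  E_diag a := by
    cases a using Fin.cases with
    | zero => rfl
    | succ a => exact h.E_diag a
  factorization := by
    ext a b
    rw [gauss_product_apply, Fin.sum_univ_succ]
    cases a using Fin.cases with
    | zero =>
      cases b using Fin.cases with
      | zero => simp
      | succ b => simp [← mul_assoc, Ring.mul_inverse_cancel _ hu]
    | succ a =>
      cases b using Fin.cases with
      | zero => simp [mul_assoc, Ring.inverse_mul_cancel _ hu]
      | succ b =>
        have := congrFun (congrFun h.factorization a) b
        rw [firstSchur_apply, gauss_product_apply, sub_eq_iff_eq_add] at this
        simp [this, mul_assoc, ← mul_assoc (T 0 0), Ring.mul_inverse_cancel _ hu, add_comm]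

theorem IsGauss.ext_of_firstSchur (hu : IsUnit (T 0 0)) {F' H' E'} (h : IsGauss T F H E)
    (h' : IsGauss T F' H' E')
    (hF : F.submatrix Fin.succ Fin.succ = F'.submatrix Fin.succ Fin.succ)
    (hH : (fun a : Fin n => H a.succ) = fun a => H' a.succ)
    (hE : E.submatrix Fin.succ Fin.succ = E'.submatrix Fin.succ Fin.succ) :
    F = F' ∧ H = H' ∧ E = E' := by
  refine ⟨?_, ?_, ?_⟩
  · ext a b
    cases b using Fin.cases with
    | zero => exact hu.mul_right_cancel ((h.F_col a).trans (h'.F_col a).symm)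
    | succ b =>
      cases a using Fin.cases with
      | zero => rw [h.F_upper _ _ b.succ_pos, h'.F_upper _ _ b.succ_pos]
      | succ a => exact congrFun (congrFun hF a) b
  · ext a
    cases a using Fin.cases with
    | zero => rw [h.H_zero, h'.H_zero]
    | succ a => exact congrFun hH a
  · ext a b
    cases a using Fin.cases with
    | zero => exact hu.mul_left_cancel ((h.E_row b).trans (h'.E_row b).symm)
    | succ a =>
      cases b using Fin.cases with
      | zero => rw [h.E_lower _ _ a.succ_pos, h'.E_lower _ _ a.succ_pos]
      | succ b => exact congrFun (congrFun hE a) b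

end Gauss

section Blocks

variable {A : Type*} [Ring A]

theorem isOddInvolution_not : IsOddInvolution signParity not where
  invol := by decide
  add_eq_one := by decide

theorem isOddInvolution_neg (n : ℕ) : IsOddInvolution (parity n) Idx.neg where
  invol i := by simp [Idx.neg]
  add_eq_one i := isOddInvolution_not.add_eq_one i.2

/-- A matrix over `{±1, …, ±n}` as an `n × n` matrix of `2 × 2` blocks. -/
def blocks {n : ℕ} {B : Type*} (T : SuperMatrix (parity n) B) :
    Matrix (Fin n) (Fin n) (SuperMatrix signParity B) :=
  Matrix.of fun a b => of signParity fun s t => T (a, s) (b, t)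

/-- The splitting of `{±1, …, ±(n + 1)}` into `{±1}` and the rest. -/
def splitIdx (n : ℕ) : Bool ⊕ Idx n ≃ Idx (n + 1) where
  toFun := Sum.elim (fun s => (0, s)) fun i => (i.1.succ, i.2)
  invFun i := Fin.cases (motive := fun _ => Bool ⊕ Idx n) (Sum.inl i.2)
    (fun a => Sum.inr (a, i.2)) i.1
  left_inv := by rintro (s | ⟨a, s⟩) <;> rfl
  right_inv := by
    rintro ⟨a, s⟩
    cases a using Fin.cases <;> rfl

/-- The first block row and column split off. -/
def split {n : ℕ} {B : Type*} (T : SuperMatrix (parity (n + 1)) B) :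
    SuperMatrix (Sum.elim signParity (parity n)) B :=
  submatrix _ (splitIdx n) T

theorem parity_splitIdx (n : ℕ) (c : Bool ⊕ Idx n) :
    parity (n + 1) (splitIdx n c) = Sum.elim signParity (parity n) c := by
  rcases c with s | ⟨a, s⟩ <;> rfl

theorem IsRTT.split {n : ℕ} {T : SuperMatrix (parity (n + 1)) (PowerSeries A)}
    (hT : IsRTT Idx.neg T) : IsRTT (Sum.map not Idx.neg) (split T) :=
  hT.sub (isOddInvolution_neg _) (isOddInvolution_not.sum (isOddInvolution_neg _))
    (parity_splitIdx n) (by rintro (s | ⟨a, s⟩) <;> rfl) (splitIdx n).injective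

theorem blocks_schur_split {n : ℕ} {T : SuperMatrix (parity (n + 1)) (PowerSeries A)}
    (hT : IsRTT Idx.neg T) : blocks (schur (split T)) = firstSchur (blocks T) := by
  have h := hT.split
  have hq := isOddInvolution_neg n
  refine Matrix.ext fun a b => SuperMatrix.ext fun s t => ?_
  have := eq_schur_add h.isUnit (h.corner isOddInvolution_not hq).isUnit
    (isUnit_of_constantCoeff (h.sub_inverse isOddInvolution_not hq).const) (a, s) (b, t)
  rw [firstSchur_apply, SuperMatrix.sub_apply]
  exact eq_sub_of_add_eq this.symm

/-- Existence and uniqueness of the block Gauss decomposition, by induction along Schur complements. -/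
theorem exists_unique_gauss {n : ℕ} {T : SuperMatrix (parity n) (PowerSeries A)}
    (hT : IsRTT Idx.neg T) :
    ∃ F H E, IsGauss (blocks T) F H E ∧
      ∀ F' H' E', IsGauss (blocks T) F' H' E' → F' = F ∧ H' = H ∧ E' = E := by
  induction n with
  | zero =>
    refine ⟨1, fun _ => 1, 1, ⟨fun a => a.elim0, fun a => a.elim0, fun a => a.elim0,
      fun a => a.elim0, ?_⟩, fun F' H' E' _ => ⟨?_, ?_, ?_⟩⟩
    · exact Matrix.ext fun a => a.elim0
    · exact Matrix.ext fun a => a.elim0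
    · exact funext fun a => a.elim0
    · exact Matrix.ext fun a => a.elim0
  | succ n ih =>
    have hu : IsUnit (blocks T 0 0) :=
      (hT.split.corner isOddInvolution_not (isOddInvolution_neg n)).isUnit
    obtain ⟨F, H, E, hG, hun⟩ := ih (hT.split.schur isOddInvolution_not (isOddInvolution_neg n))
    rw [blocks_schur_split hT] at hG hun
    refine ⟨_, _, _, isGauss_of_firstSchur hu hG, fun F' H' E' hG' => ?_⟩
    obtain ⟨h1, h2, h3⟩ := hun _ _ _ (hG'.firstSchur hu)
    exact hG'.ext_of_firstSchur hu (isGauss_of_firstSchur hu hG) h1 h2 h3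

/-- The diagonal blocks of a Gauss decomposition of a solution of the defining relations are
solutions, and the series `1 - str (T ∂T̃)` is the product of those of the diagonal blocks, which
commute. The last clause carries the induction for commutativity. -/
theorem IsGauss.diagonal_blocks [Algebra ℂ A] {n : ℕ} {T : SuperMatrix (parity n) (PowerSeries A)}
    (hT : IsRTT Idx.neg T) {F H E} (hG : IsGauss (blocks T) F H E) :
    (∀ a, IsRTT not (H a)) ∧
      traceSeries T = (List.ofFn fun a => traceSeries (H a)).prod ∧
      (∀ a b, Commute (traceSeries (H a)) (traceSeries (H b))) ∧
      ∀ c, SuperCommute 0 (PowerSeries.C c) T →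
        ∀ a, Commute (PowerSeries.C c) (traceSeries (H a)) := by
  induction n with
  | zero =>
    exact ⟨fun a => a.elim0, by simp [traceSeries, str], fun a => a.elim0, fun _ _ a => a.elim0⟩
  | succ n ih =>
    have hp := isOddInvolution_not
    have hq := isOddInvolution_neg n
    have hC := hT.split.corner hp hq
    have hu : IsUnit (blocks T 0 0) := hC.isUnit
    have hS := hT.split.schur hp hq
    have hG' := hG.firstSchur hu
    rw [← blocks_schur_split hT] at hG'
    obtain ⟨h1, h2, h3, h4⟩ := ih hS hG'
    have hH : H 0 = corner (split T) := hG.H_zero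
    have h0 : ∀ b : Fin n, Commute (traceSeries (H 0)) (traceSeries (H b.succ)) := fun b => by
      refine commute_of_coeff fun r => h4 _ ?_ b
      rw [hH]
      exact superCommute_schur hp hq hT.split r
    refine ⟨fun a => ?_, ?_, fun a b => ?_, fun c hc a => ?_⟩
    · cases a using Fin.cases with
      | zero => rw [hH]; exact hC
      | succ a => exact h1 a
    · rw [List.ofFn_succ, List.prod_cons, ← h2, hH, ← traceSeries_eq_mul hp hq hT.split]
      exact (traceSeries_sub (splitIdx n) (parity_splitIdx n) hT.isUnit).symm
    · cases a using Fin.cases with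
      | zero =>
        cases b using Fin.cases with
        | zero => exact Commute.refl _
        | succ b => exact h0 b
      | succ a =>
        cases b using Fin.cases with
        | zero => exact (h0 a).symm
        | succ b => exact h3 a b
    · have hc' : SuperCommute 0 (PowerSeries.C c) (split T) :=
        hc.sub (parity_splitIdx n)
      cases a using Fin.cases with
      | zero =>
        rw [hH]
        exact (hc'.sub (f := Sum.inl) fun _ => rfl).traceSeries
      | succ a => exact h4 c hc'.schur a

end Blocks

/-! ### The quantum Berezinian -/

section LowCoefficients

variable {A : Type*} [Ring A]

theorem coeff_mul_of_low_left {f : PowerSeries A} {r : ℕ}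
    (h : ∀ m < r, PowerSeries.coeff m f = 0) (g : PowerSeries A) :
    PowerSeries.coeff r (f * g) = PowerSeries.coeff r f * PowerSeries.constantCoeff g := by
  rw [PowerSeries.coeff_mul, Finset.sum_eq_single (r, 0)]
  · simp only [PowerSeries.coeff_zero_eq_constantCoeff_apply]
  · rintro ⟨i, j⟩ hij hne
    rw [Finset.HasAntidiagonal.mem_antidiagonal] at hij
    rw [h i (by by_contra hc; exact hne (by ext <;> simp at hij ⊢ <;> omega)), zero_mul]
  · intro hn
    exact absurd (Finset.HasAntidiagonal.mem_antidiagonal.mpr (add_zero r)) hn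

theorem coeff_mul_of_low_right {f : PowerSeries A} {r : ℕ}
    (h : ∀ m < r, PowerSeries.coeff m f = 0) (g : PowerSeries A) :
    PowerSeries.coeff r (g * f) = PowerSeries.constantCoeff g * PowerSeries.coeff r f := by
  rw [PowerSeries.coeff_mul, Finset.sum_eq_single (0, r)]
  · simp only [PowerSeries.coeff_zero_eq_constantCoeff_apply]
  · rintro ⟨i, j⟩ hij hne
    rw [Finset.HasAntidiagonal.mem_antidiagonal] at hij
    rw [h j (by by_contra hc; exact hne (by ext <;> simp at hij ⊢ <;> omega)), mul_zero]
  · intro hn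
    exact absurd (Finset.HasAntidiagonal.mem_antidiagonal.mpr (zero_add r)) hn

/-- A series `f` with `f a = a (-f + s (x f + y f(-u)))`, where `s` has no constant term and `a`
has constant term `1`, vanishes: its lowest coefficient would be equal to its negative. -/
theorem eq_zero_of_mul_eq [Algebra ℂ A] {f a s x y : PowerSeries A}
    (ha : PowerSeries.constantCoeff a = 1) (hs : PowerSeries.constantCoeff s = 0)
    (h : f * a = a * (-f + s * (x * f + y * negVar f))) : f = 0 := by
  ext r
  induction r using Nat.strong_induction_on with
  | _ r ih =>
    simp only [map_zero] at ih ⊢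
    have h1 : ∀ m < r, PowerSeries.coeff m (x * f + y * negVar f) = 0 := fun m hm => by
      have l1 : ∀ k < m, PowerSeries.coeff k f = 0 := fun k hk => ih k (hk.trans hm)
      have l2 : ∀ k < m, PowerSeries.coeff k (negVar f) = 0 := fun k hk => by
        rw [coeff_negVar, l1 k hk, mul_zero]
      rw [map_add, coeff_mul_of_low_right l1, coeff_mul_of_low_right l2, coeff_negVar, ih m hm,
        mul_zero, mul_zero, mul_zero, add_zero]
    have h2 : ∀ m ≤ r, PowerSeries.coeff m (s * (x * f + y * negVar f)) = 0 := fun m hm => by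
      rw [coeff_mul_of_low_right fun k hk => h1 k (hk.trans_le hm), hs, zero_mul]
    have h3 := congrArg (PowerSeries.coeff r) h
    rw [coeff_mul_of_low_left ih, coeff_mul_of_low_right, ha, one_mul, mul_one, map_add, map_neg,
      h2 r le_rfl, add_zero, eq_neg_iff_add_eq_zero, ← two_smul ℂ] at h3
    · have := congrArg ((1 / 2 : ℂ) • ·) h3
      simpa [smul_smul] using this
    · intro m hm
      rw [map_add, map_neg, ih m hm, h2 m hm.le, neg_zero, add_zero]

end LowCoefficients

section Berezinian

/-- The solution of the linear system that expresses products of entries of `T` and `T⁻¹` in one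
order in terms of the products in the other order. -/
theorem berezinian_linear_system {R M : Type*} [CommRing R] [AddCommGroup M] [Module R M] (h c : R)
    (hc : 2 * c = h) {P₁ P₂ Q₁ Q₂ P₁' P₂' Q₁' Q₂' : M}
    (e₁ : P₁ - P₁' = h • (P₁ - Q₁ - P₁' + Q₁'))
    (e₂ : P₂ - P₂' = -h • (P₂ - Q₂ - P₂' + Q₂'))
    (e₃ : -Q₂ - Q₁' = h • (P₂ - Q₂ - P₁' + Q₁'))
    (e₄ : Q₁ + Q₂' = h • (P₁ - Q₁ - P₂' + Q₂')) :
    Q₁' - c • (P₁' - P₂') = -(Q₂ - c • (P₁ - P₂)) +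
      h • ((2 - 2 * h + h ^ 2) • (Q₂ - c • (P₁ - P₂)) + (-h ^ 2) • (Q₁ - c • (P₁ - P₂))) := by
  have q₁ : Q₁' = (h * (1 - h)) • (P₁ - P₂) + h ^ 2 • Q₁ - (1 - h) ^ 2 • Q₂ := by
    linear_combination (norm := module) (-(1 - h)) • e₃ + (-h) • e₁
  have p₁ : P₁' = (1 - h ^ 2) • P₁ + (h * (1 + h)) • Q₁ + h ^ 2 • P₂ + (h * (1 - h)) • Q₂ := by
    linear_combination (norm := module) (-(1 + h)) • e₁ + h • e₃
  have p₂ : P₂' = (1 - h ^ 2) • P₂ - (h * (1 - h)) • Q₂ + h ^ 2 • P₁ - (h * (1 + h)) • Q₁ := by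
    linear_combination (norm := module) (-(1 - h)) • e₂ + h • e₄
  rw [q₁, p₁, p₂, ← hc]
  module

variable {A : Type*} [Ring A] [Algebra ℂ A] {T : SuperMatrix signParity (PowerSeries A)}

omit [Algebra ℂ A] in
theorem bool_jmul (X Y : SuperMatrix signParity (PowerSeries A)) :
    jmul signParity not X Y false true = X false false * Y true true - X false true * Y false true ∧
    jmul signParity not X Y true false =
      X true true * Y false false - X true false * Y true false := by
  constructor
  · simp [jmul, signParity, (by decide : Odd 3), Odd.neg_one_pow]
    abel1
  · simp [jmul, signParity, (by decide : Even 4)]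
    abel1

/-- Division by `2` in the relations with the factor `s = u⁻¹`, in the form used for the action of
`ℂ[X]` where `X` acts as `s / 2`. -/
theorem half_eq {f g : PowerSeries A} (h : 2 * f = PowerSeries.X * g) :
    f = Polynomial.aeval (R := ℂ) ((1 / 2 : ℂ) • (PowerSeries.X : PowerSeries A))
      Polynomial.X * g := by
  rw [Polynomial.aeval_X, smul_mul_assoc, ← h, two_mul, ← two_smul ℂ, smul_smul]
  norm_num

theorem negVar_smul (c : ℂ) (f : PowerSeries A) : negVar (c • f) = c • negVar f := by
  ext r
  rw [coeff_negVar]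
  change (-1) ^ r * (c • PowerSeries.coeff r f) = c • PowerSeries.coeff r (negVar f)
  rw [coeff_negVar, mul_smul_comm]

omit [Algebra ℂ A] in
theorem negVar_X : negVar (PowerSeries.X : PowerSeries A) = -PowerSeries.X := by
  ext r
  rw [coeff_negVar, map_neg, PowerSeries.coeff_X]
  split_ifs with h <;> simp [h]

/-- The series `D` of the quantum Berezinian is `t₁,₋₁ t̃₁,₋₁ = t₋₁,₁ t̃₋₁,₁`. -/
theorem IsRTT.berezinian_odd (hT : IsRTT not T) :
    T true false * Ring.inverse T true false =
      (1 / 4 : ℂ) • (PowerSeries.X * (T false false * Ring.inverse T true true -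
        T true true * Ring.inverse T false false)) := by
  have h := isOddInvolution_not
  have hi := Ring.mul_inverse_cancel _ hT.isUnit
  have hi' := Ring.inverse_mul_cancel _ hT.isUnit
  have hI := hT.inverse h
  have i₁ := hT.inverse_commutator h false false true true
  have i₂ := hT.inverse_commutator h true true false false
  have i₃ := hT.inverse_commutator h true false true false
  have i₄ := hT.inverse_commutator h false true false true
  have m₁ := congrFun (congrFun hi false) false
  have m₂ := congrFun (congrFun hi' true) false
  have m₃ := congrFun (congrFun hi' false) false
  have s₁ := (hT.inverse_tmul_and_jmul h).1 true false
  have s₂ := hT.tmul_inverse h false true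
  have s₃ := hT.tmul_inverse h true false
  have ha : PowerSeries.constantCoeff (T false false) = 1 :=
    congrFun (congrFun hT.const false) false
  have n₁ : negVar (T false false) = T true true := hT.symm _ _
  have n₂ : negVar (T true true) = T false false := hT.symm _ _
  have n₃ : negVar (T true false) = T false true := hT.symm _ _
  have n₄ : negVar (Ring.inverse T false false) = Ring.inverse T true true := hI.symm _ _
  have n₅ : negVar (Ring.inverse T true true) = Ring.inverse T false false := hI.symm _ _
  have n₆ : negVar (Ring.inverse T true false) = Ring.inverse T false true := hI.symm _ _
  simp only [(bool_jmul _ _).1, (bool_jmul _ _).2] at i₁ i₂ i₃ i₄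
  simp only [mul_apply, one_apply, tmul, Fintype.sum_bool] at m₁ m₂ m₃ s₁ s₂ s₃
  simp [signParity] at i₁ i₂ i₃ i₄ m₁ m₂ m₃ s₁ s₂ s₃
  generalize T false false = a at *
  generalize T false true = b at *
  generalize T true false = b' at *
  generalize T true true = a' at *
  generalize Ring.inverse T false false = x at *
  generalize Ring.inverse T false true = y at *
  generalize Ring.inverse T true false = y' at *
  generalize Ring.inverse T true true = x' at *
  -- The central series `s / 2`, `s = u⁻¹`, acts as the variable of a polynomial ring, so that the linear
  -- system can be solved over a commutative ring.
  rw [← sub_eq_zero]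
  let φ := Polynomial.aeval (R := ℂ) ((1 / 2 : ℂ) • (PowerSeries.X : PowerSeries A))
  let : Module (Polynomial ℂ) (PowerSeries A) := Module.compHom _ φ.toRingHom
  have hφ : ∀ (p : Polynomial ℂ) (f : PowerSeries A), p • f = φ p * f := fun _ _ => rfl
  have hc : ∀ f : PowerSeries A, (Polynomial.C (1 / 2) * Polynomial.X : Polynomial ℂ) • f =
      (1 / 4 : ℂ) • (PowerSeries.X * f) := fun f => by
    rw [hφ, map_mul, Polynomial.aeval_C, Polynomial.aeval_X, ← Algebra.smul_def, smul_smul,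
      smul_mul_assoc]
    norm_num
  have key := berezinian_linear_system (R := Polynomial ℂ) (M := PowerSeries A) Polynomial.X
    (Polynomial.C (1 / 2) * Polynomial.X)
    (by rw [← mul_assoc, ← Polynomial.C_ofNat, ← map_mul]; norm_num)
    (P₁ := a * x') (P₂ := a' * x) (Q₁ := b * y) (Q₂ := b' * y') (P₁' := x' * a) (P₂' := x * a')
    (Q₁' := y' * b') (Q₂' := y * b)
    (by rw [hφ]; exact (half_eq i₁).trans (congrArg (_ * ·) (by abel1)))
    (by rw [neg_smul, hφ, ← mul_neg]; exact (half_eq i₂).trans (congrArg (_ * ·) (by abel1)))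
    (by rw [hφ]; exact (half_eq i₃).trans (congrArg (_ * ·) (by abel1)))
    (by rw [hφ]; exact (half_eq i₄).trans (congrArg (_ * ·) (by abel1)))
  rw [hc, hc] at key
  refine eq_zero_of_mul_eq (a := a) (s := φ Polynomial.X)
    (x := φ (2 - 2 * Polynomial.X + Polynomial.X ^ 2)) (y := φ (-Polynomial.X ^ 2)) ha ?_ ?_
  · rw [Polynomial.aeval_X, Algebra.smul_def, map_mul, PowerSeries.constantCoeff_X, mul_zero]
  · have hn : negVar (b' * y' - (1 / 4 : ℂ) • (PowerSeries.X * (a * x' - a' * x))) =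
        b * y - (1 / 4 : ℂ) • (PowerSeries.X * (a * x' - a' * x)) := by
      rw [← negVarHom_apply, map_sub, map_mul, negVarHom_apply, negVarHom_apply, negVarHom_apply,
        n₃, n₆, negVar_smul, ← negVarHom_apply, map_mul, map_sub, map_mul, map_mul]
      simp only [negVarHom_apply, n₁, n₂, n₄, n₅, negVar_X, neg_mul, ← mul_neg, neg_sub]
    rw [hn, ← hφ, ← hφ, ← hφ, ← key]
    have r₁ : b' * y' * a = a * (y' * b') := by
      rw [mul_assoc, eq_neg_of_add_eq_zero_right m₂, ← mul_assoc a, eq_neg_of_add_eq_zero_right s₃,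
        mul_neg, neg_mul, mul_assoc]
    have r₂ : a' * x * a = a * (x * a') := by
      rw [mul_assoc, ← mul_assoc a, neg_add_eq_iff_eq_add.mp m₁, neg_add_eq_iff_eq_add.mp m₃,
        mul_add,
        add_mul, mul_one, one_mul, mul_assoc b, eq_neg_of_add_eq_zero_left s₁, ← mul_assoc a',
        eq_neg_of_add_eq_zero_left s₂, mul_neg, neg_mul, mul_assoc]
    have r₃ : (a * x' - a' * x) * a = a * (x' * a - x * a') := by
      rw [sub_mul, mul_sub, r₂, mul_assoc]
    have e : ∀ g : PowerSeries A, a * ((1 / 4 : ℂ) • (PowerSeries.X * g)) =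
        (1 / 4 : ℂ) • (PowerSeries.X * (a * g)) := fun g => by
      rw [mul_smul_comm, ← mul_assoc, ← X_mul_comm, mul_assoc]
    refine (sub_mul _ _ _).trans (Eq.trans ?_ (mul_sub _ _ _).symm)
    rw [e, r₁, smul_mul_assoc, mul_assoc PowerSeries.X, r₃]

/-- In terms of the quantum Berezinian `C (u) = h (u) h̃ (-u)`. -/
theorem IsRTT.traceSeries_eq_berezinian (hT : IsRTT not T) {C D : PowerSeries A}
    (hC : C = T false false * negVar (Ring.inverse T false false))
    (hD : D = (1 / 4 : ℂ) • (PowerSeries.X * (C - negVar C))) :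
    traceSeries T = C * negVar C - D * negVar D := by
  have h := isOddInvolution_not
  have hI := hT.inverse h
  have n₁ : negVar (T false false) = T true true := hT.symm _ _
  have n₄ : negVar (Ring.inverse T false false) = Ring.inverse T true true := hI.symm _ _
  have n₅ : negVar (Ring.inverse T true true) = Ring.inverse T false false := hI.symm _ _
  have n₃ : negVar (T true false) = T false true := hT.symm _ _
  have n₆ : negVar (Ring.inverse T true false) = Ring.inverse T false true := hI.symm _ _
  have hi' := Ring.inverse_mul_cancel _ hT.isUnit
  have m₁ := congrFun (congrFun hi' true) true
  have s₀ := hT.tmul_inverse h false false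
  have s₂ := hT.tmul_inverse h false true
  have s₃ := hT.tmul_inverse h true false
  have hC' : negVar C = T true true * Ring.inverse T false false := by
    rw [hC, n₄, ← negVarHom_apply, map_mul, negVarHom_apply, negVarHom_apply, n₁, n₅]
  have hD' : D = T true false * Ring.inverse T true false := by
    rw [hT.berezinian_odd, hD, hC', hC, n₄]
  have hD'' : negVar D = T false true * Ring.inverse T false true := by
    rw [hD', ← negVarHom_apply, map_mul, negVarHom_apply, negVarHom_apply, n₃, n₆]
  rw [hC', hD'', hD', hC, n₄]
  simp only [mul_apply, one_apply, tmul, Fintype.sum_bool] at m₁ s₀ s₂ s₃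
  simp [signParity] at m₁ s₀ s₂ s₃
  rw [← s₀]
  generalize T false false = a at *
  generalize T false true = b at *
  generalize T true false = b' at *
  generalize T true true = a' at *
  generalize Ring.inverse T false false = x at *
  generalize Ring.inverse T false true = y at *
  generalize Ring.inverse T true false = y' at *
  generalize Ring.inverse T true true = x' at *
  have m : x' * a' = 1 + y' * b := by
    rw [← m₁, (by decide : Even 4).neg_one_pow, one_mul]; abel1
  have e : a * x' * (a' * x) = a * x + b' * x' * (a' * y) := by
    rw [mul_assoc, ← mul_assoc x', m, add_mul, one_mul, mul_add, mul_assoc y', ← mul_assoc a y',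
      eq_neg_of_add_eq_zero_right s₃, eq_neg_of_add_eq_zero_right s₂, neg_mul_neg]
  rw [e, mul_assoc b' x', ← mul_assoc x', m, add_mul, one_mul, mul_add, mul_assoc y',
    ← mul_assoc b' y']
  abel1

end Berezinian

/-! ### The generator matrix and the universal property -/

section Universal

variable {A B : Type*} [Ring A] [Ring B]

theorem map_inVar (φ : A →+* B) (k : Fin 2) (f : PowerSeries A) :
    MvPowerSeries.map φ (inVar k f) = inVar k (PowerSeries.map φ f) := by
  ext m
  rw [MvPowerSeries.coeff_map]
  change φ (if m = Finsupp.single k (m k) then _ else _) =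
    if m = Finsupp.single k (m k) then _ else _
  rw [apply_ite φ, map_zero, PowerSeries.coeff_map]

variable {ι : Type*} [DecidableEq ι] {p : ι → ℕ} {ν : ι → ι}

theorem map_ofTensor [Fintype ι] (φ : A →+* B) (c : ι → ι → ι → ι → A) :
    SuperMatrix.map φ (ofTensor p c) = ofTensor p fun i j k l => φ (c i j k l) := by
  ext a b
  rw [map_apply, ofTensor, ofTensor, map_mul, map_pow, map_neg, map_one]

theorem map_first [Fintype ι] (φ : A →+* B) (X : SuperMatrix p A) :
    SuperMatrix.map φ (first X) = first (SuperMatrix.map φ X) := by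
  rw [first, map_ofTensor, first]
  simp only [apply_ite φ, map_zero, map_apply]

theorem map_second [Fintype ι] (φ : A →+* B) (X : SuperMatrix p A) :
    SuperMatrix.map φ (second X) = second (SuperMatrix.map φ X) := by
  rw [second, map_ofTensor, second]
  simp only [apply_ite φ, map_zero, map_apply]

theorem map_rMatrix [Fintype ι] (φ : A →+* B) :
    SuperMatrix.map (MvPowerSeries.map φ) (rMatrix p ν A) = rMatrix p ν B := by
  rw [rMatrix, rMatrix, rElement, map_ofTensor, rElement]
  simp only [map_sub, apply_ite (MvPowerSeries.map φ), map_zero, map_mul, map_pow, map_add, map_neg,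
    map_one, MvPowerSeries.map_X]

theorem map_matrixInVar [Fintype ι] (φ : A →+* B) (k : Fin 2) (T : SuperMatrix p (PowerSeries A)) :
    SuperMatrix.map (MvPowerSeries.map φ) (matrixInVar k T) =
      matrixInVar k (SuperMatrix.map (PowerSeries.map φ) T) := by
  ext i j
  exact congrArg _ (map_inVar φ k (T i j))

/-- The generator matrix over the free algebra. -/
noncomputable def freeGenMatrix (n : ℕ) :
    SuperMatrix (parity n) (PowerSeries (FreeAlgebra ℂ (Gen n))) :=
  of (parity n) fun i j => freeSeries n i j

theorem rttLeft_eq (n : ℕ) : rttLeft n = rMatrix (parity n) Idx.neg _ *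
    (first (matrixInVar 0 (freeGenMatrix n)) * second (matrixInVar 1 (freeGenMatrix n))) :=
  mul_assoc _ _ _

theorem rttRight_eq (n : ℕ) : rttRight n = second (matrixInVar 1 (freeGenMatrix n)) *
    first (matrixInVar 0 (freeGenMatrix n)) * rMatrix (parity n) Idx.neg _ := rfl

theorem map_rttLeft {n : ℕ} (φ : FreeAlgebra ℂ (Gen n) →+* B)
    {T : SuperMatrix (parity n) (PowerSeries B)}
    (hT : SuperMatrix.map (PowerSeries.map φ) (freeGenMatrix n) = T) :
    SuperMatrix.map (MvPowerSeries.map φ) (rttLeft n) = rMatrix (parity n) Idx.neg B *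
      (first (matrixInVar 0 T) * second (matrixInVar 1 T)) := by
  rw [rttLeft_eq, map_mul, map_mul, map_rMatrix, map_first, map_second, map_matrixInVar,
    map_matrixInVar, hT]

theorem map_rttRight {n : ℕ} (φ : FreeAlgebra ℂ (Gen n) →+* B)
    {T : SuperMatrix (parity n) (PowerSeries B)}
    (hT : SuperMatrix.map (PowerSeries.map φ) (freeGenMatrix n) = T) :
    SuperMatrix.map (MvPowerSeries.map φ) (rttRight n) =
      second (matrixInVar 1 T) * first (matrixInVar 0 T) * rMatrix (parity n) Idx.neg B := by
  rw [rttRight_eq, map_mul, map_mul, map_rMatrix, map_first, map_second, map_matrixInVar,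
    map_matrixInVar, hT]

theorem toYangian_rel {n : ℕ} {x y : FreeAlgebra ℂ (Gen n)} (h : Rel n x y) :
    toYangian n x = toYangian n y :=
  RingQuot.mkAlgHom_rel ℂ h

theorem isRTT_genMatrix (n : ℕ) : IsRTT Idx.neg (genMatrix n) where
  const := by
    ext i j
    rw [map_apply, one_apply]
    change PowerSeries.constantCoeff (genSeries n i j) = _
    rw [genSeries, ← PowerSeries.coeff_zero_eq_constantCoeff_apply,
      PowerSeries.coeff_map, freeSeries, PowerSeries.coeff_mk]
    split_ifs <;> simp
  symm i j := by
    change negVar (genSeries n i j) = genSeries n i.neg j.neg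
    rw [genSeries, ← map_negVar, genSeries]
    ext r
    rw [PowerSeries.coeff_map, PowerSeries.coeff_map]
    exact toYangian_rel (Rel.symm i j r)
  rtt := by
    rw [← map_rttLeft (toYangian n : FreeAlgebra ℂ (Gen n) →+* Yangian n) (T := genMatrix n) rfl,
      ← map_rttRight (toYangian n : FreeAlgebra ℂ (Gen n) →+* Yangian n) (T := genMatrix n) rfl]
    ext a b m
    rw [map_apply, map_apply, MvPowerSeries.coeff_map, MvPowerSeries.coeff_map]
    exact toYangian_rel (Rel.rtt a b m)

/-- The universal property of the queer super-Yangian. -/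
theorem IsRTT.exists_hom [Algebra ℂ B] {n : ℕ} {T : SuperMatrix (parity n) (PowerSeries B)}
    (hT : IsRTT Idx.neg T) : ∃ φ : Yangian n →ₐ[ℂ] B,
      ∀ i j, PowerSeries.map (φ : Yangian n →+* B) (genSeries n i j) = T i j := by
  let ψ : FreeAlgebra ℂ (Gen n) →ₐ[ℂ] B :=
    FreeAlgebra.lift ℂ fun g => PowerSeries.coeff (g.2.2 + 1) (T g.1 g.2.1)
  have hψ : ∀ i j, PowerSeries.map (ψ : FreeAlgebra ℂ (Gen n) →+* B) (freeSeries n i j) =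
      T i j := by
    intro i j
    ext r
    rw [PowerSeries.coeff_map, freeSeries, PowerSeries.coeff_mk]
    cases r with
    | zero =>
      have := congrFun (congrFun hT.const i) j
      rw [map_apply, one_apply] at this
      rw [PowerSeries.coeff_zero_eq_constantCoeff_apply, this]
      dsimp only
      split_ifs <;> simp
    | succ r => exact FreeAlgebra.lift_ι_apply _ _
  have hm : SuperMatrix.map (PowerSeries.map (ψ : FreeAlgebra ℂ (Gen n) →+* B)) (freeGenMatrix n) =
      T := SuperMatrix.ext hψ
  have hr : ∀ ⦃x y⦄, Rel n x y → ψ x = ψ y := by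
    intro x y h
    cases h with
    | symm i j r =>
      have := congrArg (PowerSeries.coeff r) (hT.symm i j)
      rw [← hψ, ← hψ, ← map_negVar, PowerSeries.coeff_map, PowerSeries.coeff_map] at this
      exact this
    | rtt a b m =>
      have := congrArg (MvPowerSeries.coeff m) (congrFun (congrFun hT.rtt a) b)
      rw [← map_rttLeft _ hm, ← map_rttRight _ hm, map_apply, map_apply, MvPowerSeries.coeff_map,
        MvPowerSeries.coeff_map] at this
      exact this
  refine ⟨RingQuot.liftAlgHom ℂ ⟨ψ, hr⟩, fun i j => ?_⟩
  rw [← hψ]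
  ext r
  rw [genSeries, PowerSeries.coeff_map, PowerSeries.coeff_map, PowerSeries.coeff_map]
  exact RingQuot.liftAlgHom_mkAlgHom_apply ℂ ψ hr _

end Universal

/-! ### The central series -/

section Central

variable {ι : Type*} [DecidableEq ι] {p : ι → ℕ} {A : Type*} [Ring A]

theorem lambdaTensor_apply (z : A) (i k j l : ι) :
    lambdaTensor p z (i, k) (j, l) = if k = i ∧ l = j then (-1) ^ p l * z else 0 := by
  rw [lambdaTensor, ofTensor]
  dsimp only
  split_ifs with h
  · obtain ⟨rfl, rfl⟩ := h
    rw [← mul_assoc, ← pow_add]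
    congr 1
    apply sign_congr
    rcases Nat.even_or_odd' (p k) with ⟨a, h1 | h1⟩ <;>
      rcases Nat.even_or_odd' (p l) with ⟨b, h2 | h2⟩ <;> rw [h1, h2] <;> ring_nf <;> omega
  · rw [mul_zero]

/-- The entries of `(Λ ⊗ 1) X¹ τ₂ (Y²)`: the signs of `Λ`, `τ` and the tensor product combine to the
unsigned product `tmul`. -/
theorem lambdaTensor_mul_apply [Fintype ι] (X Y : SuperMatrix p A) (i k j l : ι) :
    (lambdaTensor p (1 : A) * first X * second (tau Y)) (i, k) (j, l) =
      if k = i then (-1) ^ p l * tmul X Y l j else 0 := by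
  rw [mul_assoc, mul_apply, Fintype.sum_prod_type]
  simp only [lambdaTensor_apply, first_mul_second_apply]
  split_ifs with h
  · subst h
    rw [tmul, Finset.mul_sum]
    refine Finset.sum_congr rfl fun a _ => ?_
    rw [Finset.sum_eq_single a]
    · simp only [and_self, if_true, mul_one, tau, pairParity]
      rw [← mul_assoc (X a j), sign_comm, mul_assoc _ (X a j), ← mul_assoc, ← mul_assoc,
        ← mul_assoc, ← pow_add, ← pow_add, ← pow_add]
      congr 1
      apply sign_congr
      obtain ⟨c, hc⟩ := Nat.even_mul_succ_self (p a)
      have e : (p k + p k + (p a + p a)) * (p a + p a + (p j + p l)) + p a + p a * (p a + p l) +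
          (p l * p a + p l) =
          p l + 2 * ((p k + p a) * (p a + p a + (p j + p l)) + p a * p l) + p a * (p a + 1) := by
        ring
      omega
    · intro b _ hb
      rw [if_neg fun e => hb e.2, zero_mul, mul_zero]
    · simp
  · refine Finset.sum_eq_zero fun a _ => Finset.sum_eq_zero fun b _ => ?_
    rw [if_neg fun e => h e.1, zero_mul, mul_zero]

/-- For `n = 0` the identity that defines the central series is void, and it does not determine `z`. -/
theorem isCentralSeries_iff {n : ℕ} (hn : 0 < n) (z : PowerSeries (Yangian n)) :
    IsCentralSeries n z ↔ z = traceSeries (genMatrix n) := by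
  have hT := isRTT_genMatrix n
  have h := isOddInvolution_neg n
  have key : ∀ i k j l, (lambdaTensor (parity n) (1 : PowerSeries (Yangian n)) *
      (genMatrix n).first * (tau (Ring.inverse (genMatrix n))).second) (i, k) (j, l) =
      lambdaTensor (parity n) (traceSeries (genMatrix n)) (i, k) (j, l) := fun i k j l => by
    rw [lambdaTensor_mul_apply, hT.tmul_inverse h, lambdaTensor_apply, ite_and, mul_ite, mul_zero]
  constructor
  · intro hz
    have := (congrFun (congrFun hz ((⟨0, hn⟩, false), (⟨0, hn⟩, false)))
      ((⟨0, hn⟩, false), (⟨0, hn⟩, false))).symm.trans (key _ _ _ _)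
    rw [lambdaTensor_apply, lambdaTensor_apply, if_pos ⟨rfl, rfl⟩, if_pos ⟨rfl, rfl⟩] at this
    simpa [parity, signParity] using this
  · rintro rfl
    refine SuperMatrix.ext fun a b => ?_
    exact key a.1 a.2 b.1 b.2

end Central

/-- A Gauss decomposition of the generator matrix, as a Gauss decomposition of its matrix of
blocks. -/
theorem GaussDecomposition.isGauss {n : ℕ} (G : GaussDecomposition n) :
    IsGauss (blocks (genMatrix n)) G.F G.H G.E :=
  ⟨G.F_upper, G.F_diag, G.E_lower, G.E_diag, G.factorization⟩

theorem nonempty_unique_gaussDecomposition (n : ℕ) : Nonempty (Unique (GaussDecomposition n)) := by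
  obtain ⟨F, H, E, hG, hu⟩ := exists_unique_gauss (isRTT_genMatrix n)
  refine ⟨⟨⟨F, H, E, hG.F_upper, hG.F_diag, hG.E_lower, hG.E_diag, hG.factorization⟩⟩, fun G => ?_⟩
  obtain ⟨h1, h2, h3⟩ := hu _ _ _ G.isGauss
  cases G
  cases h1
  cases h2
  cases h3
  rfl

/-- A `2 × 2` solution of the defining relations is the image of the generator matrix of
`Y(q_1)`. -/
theorem IsRTT.exists_hom_one {n : ℕ} {H : Block n} (hH : IsRTT not H) :
    ∃ φ : Yangian 1 →ₐ[ℂ] Yangian n,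
      (∀ s t, PowerSeries.map (φ : Yangian 1 →+* Yangian n) (genSeries 1 (0, s) (0, t)) = H s t) ∧
      PowerSeries.map (φ : Yangian 1 →+* Yangian n) (traceSeries (genMatrix 1)) =
        traceSeries H := by
  have hs : IsRTT Idx.neg (submatrix (parity 1) Prod.snd H) :=
    hH.sub isOddInvolution_not (isOddInvolution_neg 1) (fun _ => rfl) (fun _ => rfl)
      fun i j h => Prod.ext (Subsingleton.elim _ _) h
  obtain ⟨φ, hφ⟩ := hs.exists_hom
  refine ⟨φ, fun s t => hφ _ _, ?_⟩
  rw [map_traceSeries _ (isRTT_genMatrix 1).isUnit]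
  have e : SuperMatrix.map (PowerSeries.map (φ : Yangian 1 →+* Yangian n)) (genMatrix 1) =
      submatrix (parity 1) Prod.snd H := SuperMatrix.ext hφ
  rw [e]
  exact traceSeries_sub (Equiv.uniqueProd Bool (Fin 1)) (fun _ => rfl) hH.isUnit

end QueerYangian

theorem mainTheorem2 (n : ℕ) (hn : 0 < n) :
    IsUnit (QueerYangian.genMatrix n) ∧
    (∃! z, QueerYangian.IsCentralSeries n z) ∧
    (∃! z₁, QueerYangian.IsCentralSeries 1 z₁) ∧
    Nonempty (Unique (QueerYangian.GaussDecomposition n)) ∧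
    ∀ (z : PowerSeries (QueerYangian.Yangian n)) (z₁ : PowerSeries (QueerYangian.Yangian 1))
      (G : QueerYangian.GaussDecomposition n),
      QueerYangian.IsCentralSeries n z → QueerYangian.IsCentralSeries 1 z₁ →
      (∀ a, IsUnit (G.H a)) ∧
      (∀ a b, Commute (QueerYangian.centralFactor (G.H a)) (QueerYangian.centralFactor (G.H b))) ∧
      z = (List.ofFn fun a => QueerYangian.centralFactor (G.H a)).prod ∧
      (∃ φ : Fin n → (QueerYangian.Yangian 1 →ₐ[ℂ] QueerYangian.Yangian n),
        (∀ (a : Fin n) (s t : Bool),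
          PowerSeries.map (φ a : QueerYangian.Yangian 1 →+* QueerYangian.Yangian n)
            (QueerYangian.genSeries 1 (0, s) (0, t)) = G.H a s t) ∧
        (∀ a : Fin n,
          PowerSeries.map (φ a : QueerYangian.Yangian 1 →+* QueerYangian.Yangian n) z₁ =
            QueerYangian.centralFactor (G.H a)) ∧
        z = (List.ofFn fun a : Fin n =>
          PowerSeries.map (φ a : QueerYangian.Yangian 1 →+* QueerYangian.Yangian n) z₁).prod) ∧
      (∀ a, QueerYangian.centralFactor (G.H a) =
        QueerYangian.berezinian (G.H a) * QueerYangian.negVar (QueerYangian.berezinian (G.H a)) -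
          QueerYangian.berezinianD (G.H a) *
            QueerYangian.negVar (QueerYangian.berezinianD (G.H a))) ∧
      z = (List.ofFn fun a =>
        QueerYangian.berezinian (G.H a) * QueerYangian.negVar (QueerYangian.berezinian (G.H a)) -
          QueerYangian.berezinianD (G.H a) *
            QueerYangian.negVar (QueerYangian.berezinianD (G.H a))).prod := by

  have hT := QueerYangian.isRTT_genMatrix n
  refine ⟨hT.isUnit, ?_, ?_, QueerYangian.nonempty_unique_gaussDecomposition n, ?_⟩
  · exact ⟨_, (QueerYangian.isCentralSeries_iff hn _).mpr rfl,
      fun z hz => (QueerYangian.isCentralSeries_iff hn z).mp hz⟩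
  · exact ⟨_, (QueerYangian.isCentralSeries_iff one_pos _).mpr rfl,
      fun z hz => (QueerYangian.isCentralSeries_iff one_pos z).mp hz⟩
  intro z z₁ G hz hz₁
  rw [QueerYangian.isCentralSeries_iff hn] at hz
  rw [QueerYangian.isCentralSeries_iff one_pos] at hz₁
  subst hz hz₁
  obtain ⟨h1, h2, h3, -⟩ := G.isGauss.diagonal_blocks hT
  choose φ hφ hφ' using fun a => (h1 a).exists_hom_one
  have hB : ∀ a, QueerYangian.centralFactor (G.H a) =
      QueerYangian.berezinian (G.H a) * QueerYangian.negVar (QueerYangian.berezinian (G.H a)) -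
        QueerYangian.berezinianD (G.H a) *
          QueerYangian.negVar (QueerYangian.berezinianD (G.H a)) :=
    fun a => (h1 a).traceSeries_eq_berezinian rfl rfl
  refine ⟨fun a => (h1 a).isUnit, h3, h2, ⟨φ, hφ, hφ', ?_⟩, hB, ?_⟩
  · simp only [hφ']
    exact h2
  · simp only [← hB]
    exact h2
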